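/- **Model.** A contextual bandit has finitely many actions $a\in[K]$, random contexts $X_t$, a known feature map $\varphi(x,a)\in\mathbb{R}^p$ and rewards $R_t^a=\varphi(X_t,a)^\top\gamma_{0,t}+\epsilon_t$. Write $\varphi_t=\varphi(X_t,a_t)$ for the feature of the played action. There are $T_0$ offline rounds $t\in[-T_0]=\{-T_0,\dots,-1\}$, played by an arbitrary (possibly adaptive) agent, and $T\ge 2$ online rounds $t\in[T]=\{1,\dots,T\}$. In each phase $\epsilon_t$ has conditional mean zero and is conditionally $\sigma$-sub-Gaussian given $(\varphi_\tau,R_\tau^{a_\tau})$ for the earlier rounds $\tau$ of that phase and given $\varphi_t$. Almost surely $\|\varphi(X_t,a)\|_2\le L$ for all $a$; moreover $\|\gamma_{0,t}\|_2\le M$; and $\gamma_{0,t}$ is the same for all $t\in[T]$. **Invariant subspace decomposition.** $\mathbb{R}^p=\mathcal S^{\rm inv}\oplus\mathcal S^{\rm res}$ with $\mathcal S^{\rm res}=(\mathcal S^{\rm inv})^\perp$, dimensions $p^{\rm inv}<p$ and $p^{\rm res}=p-p^{\rm inv}$, and matrices $U^{\rm inv},U^{\rm res}$ whose columns are orthonormal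 bases. There is $\beta^{\rm inv}\in\mathcal S^{\rm inv}$ with $\gamma_{0,t}-\beta^{\rm inv}\in\mathcal S^{\rm res}$ for all $t\in[-T_0]\cup[T]$. In the offline rounds the two projections of the (centred) features are uncorrelated: $\mathbb{E}[(U^{\rm inv})^\top\varphi_t\varphi_t^\top U^{\rm res}\mid \varphi_\tau,\,-T_0\le\tau<t]=0$ for $t\in[-T_0]$. The decomposition is known. **Minimum eigenvalue.** With $\hat\Sigma_{[-T_0]}=\sum_{t\in[-T_0]}\varphi_t\varphi_t^\top$ and some $\lambda_0>0$, $\lambda_{\min}(\tfrac1{T_0}\hat\Sigma_{[-T_0]})\ge\lambda_0$ almost surely. **Algorithm (ISD-linUCB with known subspaces).** Let $\|x\|_A=\sqrt{x^\top Ax}$, let $\lambda>0$ be a ridge parameter, $\eta=1/T$, $\hat\Sigma_t=\lambda I+\sum_{\tau=1}^t\varphi_\tau\varphi_\tau^\top$, and $$\hat\beta=U^{\rm inv}\big((U^{\rm inv})^\top\hat\Sigma_{[-T_0]}U^{\rm inv}\big)^{-1}\sum_{t\in[-T_0]}(U^{\rm inv})^\top\varphi_tR_t^{a_t},$$ $$\hat\delta_t=U^{\rm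 res}\big((U^{\rm res})^\top\hat\Sigma_{t-1}U^{\rm res}\big)^{-1}\sum_{\tau=1}^{t-1}(U^{\rm res})^\top\varphi_\tau(R_\tau^{a_\tau}-\varphi_\tau^\top\hat\beta),$$ $$r=\sigma\sqrt{2\log\tfrac1\eta+p^{\rm inv}\log\tfrac{L^2}{p^{\rm inv}\lambda_0}}+2L^2M\sqrt{\tfrac2{\lambda_0}\log\tfrac{p^{\rm inv}+1}{\eta}}$$ (the term $p^{\rm inv}\log\tfrac{L^2}{p^{\rm inv}\lambda_0}$ is read as $0$ if $p^{\rm inv}=0$), $$r_t=\sigma\sqrt{2\log\tfrac1\eta+p^{\rm res}\log\big(1+\tfrac{tL^2}{\lambda p^{\rm res}}\big)}+\sqrt\lambda M+\frac{2L^2}{\sqrt\lambda}\sqrt{2(t-1)\log\tfrac{p+1}\eta}\;\frac{r}{\sqrt{\lambda_0T_0}},$$ $\hat{\mathcal C}^\beta=\{\beta\in\mathcal S^{\rm inv}:\|\hat\beta-\beta\|_{\hat\Sigma_{[-T_0]}}\le r\}$ and $\hat{\mathcal C}^\delta_t=\{\delta\in\mathcal S^{\rm res}:\|\hat\delta_t-\delta\|_{\hat\Sigma_{t-1}}\le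 r_t\}$. In round $t\in[T]$ the algorithm plays an $a_t$ maximizing $\max_{\gamma\in\hat{\mathcal C}^\beta\oplus\hat{\mathcal C}^\delta_t}\varphi(X_t,a)^\top\gamma$ over $a\in[K]$. **Theorem.** Fix $L,M,\sigma,\lambda>0$. There are $k\in\mathbb{N}$ and $c\in\mathbb R$ depending only on $L,M,\sigma,\lambda$, and constants $C(p^{\rm res})$ depending in addition only on $p^{\rm res}$, such that in every setting as above the regret $\operatorname{Reg}_T=\mathbb{E}\big[\sum_{t=1}^T(R_t^{a_t^*}-R_t^{a_t})\big]$, where $a_t^*$ maximizes $\varphi(X_t,a)^\top\gamma_{0,t}$ over $a$, is well defined and satisfies $$\operatorname{Reg}_T\le\log(pT)^k\,\sqrt T\left(c\,p^{\rm res}+C(p^{\rm res})\Big(\sqrt{\tfrac{p^{\rm inv}}{\lambda_0}}+\tfrac1{\lambda_0}\Big)\sqrt{\tfrac T{T_0}}\right);$$ that is, for fixed $p^{\rm res}$ it is $\tilde O\big(\sqrt T\big(p^{\rm res}+(\sqrt{p^{\rm inv}/\lambda_0}+1/\lambda_0)\sqrt{T/T_0}\big)\big)$. Moreover the oracle rate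 holds with a dimension-free constant when $T_0$ is large compared with $T$: if $\big(\sqrt{p^{\rm inv}/\lambda_0}+1/\lambda_0\big)^2\,T\le p^{\rm res}\,T_0$, then $$\operatorname{Reg}_T\le c\,\log(pT)^k\,p^{\rm res}\sqrt T .$$ -/

import Mathlib

open MeasureTheory Matrix
open scoped Pointwise

noncomputable section

namespace ISDBandit

/-- The weighted norm `‖x‖_A = √(xᵀ A x)`. -/
def matNorm {p : ℕ} (A : Matrix (Fin p) (Fin p) ℝ) (x : Fin p → ℝ) : ℝ :=
  Real.sqrt (x ⬝ᵥ (A *ᵥ x))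

/-- The Euclidean norm of a coordinate vector (the norm instance of `Fin p → ℝ` is the sup norm,
which is not used anywhere). -/
def l2norm {p : ℕ} (x : Fin p → ℝ) : ℝ := Real.sqrt (x ⬝ᵥ x)

/-- The smallest eigenvalue of a square matrix (used for symmetric matrices of positive size). -/
def minEigenvalue {p : ℕ} (A : Matrix (Fin p) (Fin p) ℝ) : ℝ :=
  sInf {x : ℝ | Module.End.HasEigenvalue (Matrix.toLin' A) x}

/-- The linear subspace spanned by the columns of `U`. -/
def colSpace {p q : ℕ} (U : Matrix (Fin p) (Fin q) ℝ) : Submodule ℝ (Fin p → ℝ) :=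
  LinearMap.range (Matrix.mulVecLin U)

/-- The rounds `[-T₀] = {-T₀, …, -1}`. -/
def offRounds (T₀ : ℕ) : Finset ℤ := Finset.Icc (-(T₀ : ℤ)) (-1)

/-- The rounds `[T] = {1, …, T}`. -/
def onRounds (T : ℕ) : Finset ℤ := Finset.Icc 1 (T : ℤ)

/-- A linear contextual bandit with `K` actions and time-varying parameter, together with the
actions that are played in it: feature map `φ`, parameters `γ t`, contexts `X t`, played actions
`a t` and noise variables `ε t`. Rounds are indexed by `ℤ`; negative rounds are offline. -/
structure LinearBandit (Ω : Type*) (𝒳 : Type*) [MeasurableSpace Ω] [MeasurableSpace 𝒳]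
    (p K : ℕ) where
  φ : 𝒳 → Fin K → (Fin p → ℝ)
  γ : ℤ → Fin p → ℝ
  X : ℤ → Ω → 𝒳
  a : ℤ → Ω → Fin K
  ε : ℤ → Ω → ℝ
  measurable_φ : ∀ i, Measurable fun x => φ x i
  measurable_X : ∀ t, Measurable (X t)
  measurable_a : ∀ t, Measurable (a t)
  measurable_ε : ∀ t, Measurable (ε t)

namespace LinearBandit

variable {Ω : Type*} {𝒳 : Type*} [MeasurableSpace Ω] [MeasurableSpace 𝒳] {p K : ℕ}
variable (B : LinearBandit Ω 𝒳 p K)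

/-- The reward `R_t^i = φ(X_t, i)ᵀ γ_t + ε_t` of action `i`. -/
def reward (t : ℤ) (i : Fin K) (ω : Ω) : ℝ := B.φ (B.X t ω) i ⬝ᵥ B.γ t + B.ε t ω

/-- The feature vector `φ_t = φ(X_t, a_t)` of the played action. -/
def feat (t : ℤ) (ω : Ω) : Fin p → ℝ := B.φ (B.X t ω) (B.a t ω)

/-- The observed reward `R_t^{a_t}`. -/
def obs (t : ℤ) (ω : Ω) : ℝ := B.reward t (B.a t ω) ω

/-- The sigma-algebra generated by the played features and observed rewards of the rounds
`s, …, t - 1` and by the played feature of round `t`. -/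
@[reducible]
def history (s t : ℤ) : MeasurableSpace Ω :=
  (⨆ τ ∈ Finset.Icc s (t - 1),
    MeasurableSpace.comap (fun ω => (B.feat τ ω, B.obs τ ω)) inferInstance) ⊔
  MeasurableSpace.comap (B.feat t) inferInstance

/-- The sigma-algebra generated by the played features of the rounds `s, …, t - 1`. -/
@[reducible]
def pastFeatures (s t : ℤ) : MeasurableSpace Ω :=
  ⨆ τ ∈ Finset.Icc s (t - 1), MeasurableSpace.comap (B.feat τ) inferInstance

/-- The sample covariance matrix `Σ̂_S = ∑_{τ ∈ S} φ_τ φ_τᵀ`. -/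
def sampleCov (S : Finset ℤ) (ω : Ω) : Matrix (Fin p) (Fin p) ℝ :=
  ∑ τ ∈ S, Matrix.vecMulVec (B.feat τ ω) (B.feat τ ω)

/-- The regularized sample covariance matrix `Σ̂_t = λ I + ∑_{τ = 1}^{t} φ_τ φ_τᵀ`. -/
def regCov (lam : ℝ) (t : ℤ) (ω : Ω) : Matrix (Fin p) (Fin p) ℝ :=
  lam • (1 : Matrix (Fin p) (Fin p) ℝ) + B.sampleCov (Finset.Icc 1 t) ω

end LinearBandit

/-- Conditionally on `m`, the random variable `Z` has mean zero and is `σ`-sub-Gaussian. -/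
def CondSubGaussian {Ω : Type*} (m : MeasurableSpace Ω) {m0 : MeasurableSpace Ω} (μ : Measure Ω)
    (σ : ℝ) (Z : Ω → ℝ) : Prop :=
  Integrable Z μ ∧ μ[Z | m] =ᵐ[μ] 0 ∧
  ∀ s : ℝ, Integrable (fun ω => Real.exp (s * Z ω)) μ ∧
    μ[fun ω => Real.exp (s * Z ω) | m] ≤ᵐ[μ] fun _ => Real.exp (σ ^ 2 * s ^ 2 / 2)

/-- The noise is conditionally centred and `σ`-sub-Gaussian in all offline and online rounds, and
`L` and `M` bound the features and the parameters. -/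
structure IsModel {Ω 𝒳 : Type*} [MeasurableSpace Ω] [MeasurableSpace 𝒳] {p K : ℕ}
    (B : LinearBandit Ω 𝒳 p K) (μ : Measure Ω) (T₀ T : ℕ) (L M σ : ℝ) : Prop where
  noise_off : ∀ t ∈ offRounds T₀, CondSubGaussian (B.history (-(T₀ : ℤ)) t) μ σ (B.ε t)
  noise_on : ∀ t ∈ onRounds T, CondSubGaussian (B.history 1 t) μ σ (B.ε t)
  feature_bound : ∀ t ∈ offRounds T₀ ∪ onRounds T, ∀ᵐ ω ∂μ, ∀ i, l2norm (B.φ (B.X t ω) i) ≤ L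
  param_bound : ∀ t ∈ offRounds T₀ ∪ onRounds T, l2norm (B.γ t) ≤ M
  param_const : ∀ t ∈ onRounds T, B.γ t = B.γ 1

/-- The columns of `Uinv` and `Ures` are orthonormal bases of an invariant subspace `S^inv` and of
its orthogonal complement `S^res ≠ 0`: the projections of the offline features to the two subspaces
are uncorrelated (features being centred, the covariance is the mean of the product; since the
offline agent may be adaptive, the mean is taken given the features of the earlier offline
rounds), and the component of the parameter in `S^inv` is the same in all rounds.
Maximality of `dim S^inv` is not required. -/
structure IsISD {Ω 𝒳 : Type*} [MeasurableSpace Ω] [MeasurableSpace 𝒳] {p K pinv pres : ℕ}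
    (B : LinearBandit Ω 𝒳 p K) (μ : Measure Ω) (T₀ T : ℕ)
    (Uinv : Matrix (Fin p) (Fin pinv) ℝ) (Ures : Matrix (Fin p) (Fin pres) ℝ) : Prop where
  dim_add : pinv + pres = p
  dim_lt : pinv < p
  orthonormal_inv : Uinvᵀ * Uinv = 1
  orthonormal_res : Uresᵀ * Ures = 1
  orthogonal : Uinvᵀ * Ures = 0
  uncorrelated : ∀ t ∈ offRounds T₀, ∀ i j,
    μ[fun ω => (Uinvᵀ *ᵥ B.feat t ω) i * (Uresᵀ *ᵥ B.feat t ω) j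
      | B.pastFeatures (-(T₀ : ℤ)) t] =ᵐ[μ] 0
  decomposition : ∃ β ∈ colSpace Uinv, ∀ t ∈ offRounds T₀ ∪ onRounds T,
    ∃ δ ∈ colSpace Ures, B.γ t = β + δ

/-- The smallest eigenvalue of `(1/T₀) Σ̂_{[-T₀]}` is almost surely at least `λ₀`. -/
def MinEigAssumption {Ω 𝒳 : Type*} [MeasurableSpace Ω] [MeasurableSpace 𝒳] {p K : ℕ}
    (B : LinearBandit Ω 𝒳 p K) (μ : Measure Ω) (T₀ : ℕ) (lam0 : ℝ) : Prop :=
  ∀ᵐ ω ∂μ, lam0 ≤ minEigenvalue ((1 / (T₀ : ℝ)) • B.sampleCov (offRounds T₀) ω)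

/-- The tuning parameters of the algorithm: ridge parameter `lam`, confidence parameter `η`,
bounds `L`, `M` on features and parameters, noise level `σ`, eigenvalue bound `lam0`. -/
structure Params where
  lam : ℝ
  η : ℝ
  L : ℝ
  M : ℝ
  σ : ℝ
  lam0 : ℝ

/-- The squared radius of the confidence set of the invariant component. -/
def rhoInv (P : Params) (pinv : ℕ) : ℝ :=
  (P.σ * Real.sqrt (2 * Real.log (1 / P.η) + pinv * Real.log (P.L ^ 2 / (pinv * P.lam0)))
    + 2 * P.L ^ 2 * P.M * Real.sqrt (2 / P.lam0 * Real.log ((pinv + 1) / P.η))) ^ 2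

/-- The squared radius of the confidence set of the residual component in round `t`. -/
def rhoRes (P : Params) (p pinv pres T₀ : ℕ) (t : ℤ) : ℝ :=
  (P.σ * Real.sqrt (2 * Real.log (1 / P.η)
      + pres * Real.log (1 + t * P.L ^ 2 / (P.lam * pres)))
    + Real.sqrt P.lam * P.M
    + 1 / Real.sqrt P.lam
      * (2 * P.L ^ 2 * Real.sqrt (2 * ((t : ℝ) - 1) * Real.log ((p + 1) / P.η)))
      * Real.sqrt (rhoInv P pinv / (P.lam0 * T₀))) ^ 2

section Algorithm

variable {Ω : Type*} {𝒳 : Type*} [MeasurableSpace Ω] [MeasurableSpace 𝒳] {p K pinv pres : ℕ}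
variable (B : LinearBandit Ω 𝒳 p K) (P : Params) (T₀ : ℕ)
variable (Uinv : Matrix (Fin p) (Fin pinv) ℝ) (Ures : Matrix (Fin p) (Fin pres) ℝ)

/-- The offline least squares estimate of the invariant component. -/
def betaHat (ω : Ω) : Fin p → ℝ :=
  Uinv *ᵥ ((Uinvᵀ * B.sampleCov (offRounds T₀) ω * Uinv)⁻¹ *ᵥ
    ∑ t ∈ offRounds T₀, B.obs t ω • (Uinvᵀ *ᵥ B.feat t ω))

/-- The ridge estimate of the residual component in round `t`. -/
def deltaHat (t : ℤ) (ω : Ω) : Fin p → ℝ :=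
  Ures *ᵥ ((Uresᵀ * B.regCov P.lam (t - 1) ω * Ures)⁻¹ *ᵥ
    ∑ τ ∈ Finset.Icc 1 (t - 1),
      (B.obs τ ω - B.feat τ ω ⬝ᵥ betaHat B T₀ Uinv ω) • (Uresᵀ *ᵥ B.feat τ ω))

/-- The confidence set of the invariant component. -/
def confBeta (ω : Ω) : Set (Fin p → ℝ) :=
  {β | β ∈ colSpace Uinv ∧
    matNorm (B.sampleCov (offRounds T₀) ω) (betaHat B T₀ Uinv ω - β) ^ 2 ≤ rhoInv P pinv}

/-- The confidence set of the residual component in round `t`. -/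
def confDelta (t : ℤ) (ω : Ω) : Set (Fin p → ℝ) :=
  {δ | δ ∈ colSpace Ures ∧
    matNorm (B.regCov P.lam (t - 1) ω) (deltaHat B P T₀ Uinv Ures t ω - δ) ^ 2
      ≤ rhoRes P p pinv pres T₀ t}

/-- The upper confidence bound of action `i` in round `t`: the maximum of `φ(X_t, i)ᵀ γ` over
`γ` in the sum of the two confidence sets. -/
def ucb (t : ℤ) (i : Fin K) (ω : Ω) : ℝ :=
  sSup ((fun γ => B.φ (B.X t ω) i ⬝ᵥ γ) ''
    (confBeta B P T₀ Uinv ω + confDelta B P T₀ Uinv Ures t ω))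

/-- The actions of the online rounds are those of ISD-linUCB with known subspaces and with the
invariant component estimated once, from the offline rounds (ties are broken arbitrarily). -/
def PlaysISDLinUCB (μ : Measure Ω) (T : ℕ) : Prop :=
  ∀ t ∈ onRounds T, ∀ᵐ ω ∂μ, ∀ i,
    ucb B P T₀ Uinv Ures t i ω ≤ ucb B P T₀ Uinv Ures t (B.a t ω) ω

end Algorithm

/-- `astar t` is an optimal action in every online round `t`. -/
def IsOptimal {Ω 𝒳 : Type*} [MeasurableSpace Ω] [MeasurableSpace 𝒳] {p K : ℕ}
    (B : LinearBandit Ω 𝒳 p K) (T : ℕ) (astar : ℤ → Ω → Fin K) : Prop :=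
  ∀ t ∈ onRounds T, ∀ ω i,
    B.φ (B.X t ω) i ⬝ᵥ B.γ t ≤ B.φ (B.X t ω) (astar t ω) ⬝ᵥ B.γ t

/-- The sum of the reward differences over the online rounds. -/
def rewardGap {Ω 𝒳 : Type*} [MeasurableSpace Ω] [MeasurableSpace 𝒳] {p K : ℕ}
    (B : LinearBandit Ω 𝒳 p K) (T : ℕ) (astar : ℤ → Ω → Fin K) (ω : Ω) : ℝ :=
  ∑ t ∈ onRounds T, (B.reward t (astar t ω) ω - B.reward t (B.a t ω) ω)

/-- The dynamic regret `Reg_T`. -/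
def regret {Ω 𝒳 : Type*} [MeasurableSpace Ω] [MeasurableSpace 𝒳] {p K : ℕ}
    (B : LinearBandit Ω 𝒳 p K) (μ : Measure Ω) (T : ℕ) (astar : ℤ → Ω → Fin K) : ℝ :=
  ∫ ω, rewardGap B T astar ω ∂μ

end ISDBandit

end

/-! The regret of ISD-linUCB.

In a round in which both confidence sets contain the components of the parameter, optimism bounds
the instantaneous regret by twice the width of the confidence interval of the played action
(`gap_le_two_mul_confWidth`). The invariant part of this width is at most
`L √(rhoInv / (T₀ lam0))`, and the squares of the residual parts are summed over the rounds by the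
elliptical potential lemma (`sum_inv_quadratic_le`). In every other round the regret is at most
`2 L M`. Hence it suffices that the confidence sets fail in each single round with probability
`O(1/√T)`, since the failures then cost `O(√T)` in total, and no bound uniform in time is needed.

Offline (`exists_offline_event`), the estimation error has two parts. The noise is controlled by a
self-normalized bound (`self_normalized_bound`). The contribution of the time-varying residual
components is a vector martingale, because the two projections of the features are uncorrelated,
and it obeys a dimension-free Hoeffding inequality (`vector_hoeffding`). The failure probability
`1/√T` in place of `1/T` for the noise, and half of the second summand of the radius, leave room for
passing from the unregularized Gram matrix `A` to `A + T₀ lam0 • 1 ≤ 2 A`.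

Online (`exists_online_event`), the noise is controlled in the same way. The error of the offline
estimate enters the ridge estimate as a misspecification whose size is known; as
`‖∑ e_k x_k‖_{A⁻¹} ≤ ‖e‖`, its effect is bounded deterministically, and nothing is needed about the
correlation of the online features.

The radii dominate these deviations only if `log T` exceeds a constant that depends on
`L, M, σ, lam`. For smaller `T` the trivial bound `2 L M T` on the regret is of the required order.
Since `lam0 p ≤ L²`, the dimension-dependent term `pinv log (L² / (pinv lam0)) ≤ L² / lam0` of the
radius is dominated by the square of its second summand, so that every dimension other than `pres` enters the
regret through `1 / lam0` and `log (p T)` only.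

The self-normalized bound rests on the supermartingale
`exp (‖S_n‖²_{A_n⁻¹} / 2) (det A_n / V^d)^{-1/2}`. By the rank-one update formulas for the inverse
and for the determinant one step of it reduces to a one-dimensional Gaussian mixture
(`lintegral_exp_quadratic_le`), evaluated under a regular conditional distribution of the noise. The
vector Hoeffding inequality follows Pinelis: `s ↦ cosh √s` is convex, so that `cosh ‖S + Y‖` lies
below an affine function of `Y`. -/

namespace ISDBandit

/-! ### Regularized Gram matrices -/

/-- The matrix `V • 1 + ∑_{k < n} x_k x_kᵀ`. -/
noncomputable def ridgeGram {d : ℕ} (V : ℝ) (x : ℕ → Fin d → ℝ) (n : ℕ) :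
    Matrix (Fin d) (Fin d) ℝ :=
  V • (1 : Matrix (Fin d) (Fin d) ℝ) + ∑ k ∈ Finset.range n, vecMulVec (x k) (x k)

section LinearAlgebra

variable {d : ℕ}

theorem ridgeGram_succ (V : ℝ) (x : ℕ → Fin d → ℝ) (n : ℕ) :
    ridgeGram V x (n + 1) = ridgeGram V x n + vecMulVec (x n) (x n) := by
  simp [ridgeGram, Finset.sum_range_succ, add_assoc]

theorem ridgeGram_mulVec (V : ℝ) (x : ℕ → Fin d → ℝ) (n : ℕ) (w : Fin d → ℝ) :
    ridgeGram V x n *ᵥ w = V • w + ∑ k ∈ Finset.range n, (x k ⬝ᵥ w) • x k := by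
  simp [ridgeGram, Matrix.add_mulVec, Matrix.sum_mulVec, Matrix.smul_mulVec, vecMulVec_mulVec]

theorem dotProduct_ridgeGram_mulVec (V : ℝ) (x : ℕ → Fin d → ℝ) (n : ℕ) (w : Fin d → ℝ) :
    w ⬝ᵥ (ridgeGram V x n *ᵥ w) =
      V * (w ⬝ᵥ w) + ∑ k ∈ Finset.range n, (x k ⬝ᵥ w) ^ 2 := by
  rw [ridgeGram_mulVec, dotProduct_add, dotProduct_smul, dotProduct_sum, smul_eq_mul]
  congr 1
  refine Finset.sum_congr rfl fun k _ => ?_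
  rw [dotProduct_smul, dotProduct_comm w, smul_eq_mul, sq]

theorem zero_le_dotProduct_self (w : Fin d → ℝ) : 0 ≤ w ⬝ᵥ w :=
  Finset.sum_nonneg fun i _ => mul_self_nonneg (w i)

theorem isHermitian_ridgeGram (V : ℝ) (x : ℕ → Fin d → ℝ) (n : ℕ) :
    (ridgeGram V x n).IsHermitian := by
  ext i j
  simp only [ridgeGram, conjTranspose_apply, Matrix.add_apply, Matrix.smul_apply,
    Matrix.sum_apply, vecMulVec_apply, star_trivial, Matrix.one_apply, eq_comm (a := i) (b := j)]
  simp only [mul_comm]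

theorem posDef_ridgeGram {V : ℝ} (hV : 0 < V) (x : ℕ → Fin d → ℝ) (n : ℕ) :
    (ridgeGram V x n).PosDef := by
  refine PosDef.of_dotProduct_mulVec_pos (isHermitian_ridgeGram V x n) fun w hw => ?_
  rw [star_trivial, dotProduct_ridgeGram_mulVec]
  have h1 : 0 < w ⬝ᵥ w := lt_of_le_of_ne (zero_le_dotProduct_self w)
    (fun h => hw (dotProduct_self_eq_zero.1 h.symm))
  have h2 : 0 ≤ ∑ k ∈ Finset.range n, (x k ⬝ᵥ w) ^ 2 := Finset.sum_nonneg fun _ _ => sq_nonneg _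
  positivity

theorem trace_ridgeGram (V : ℝ) (x : ℕ → Fin d → ℝ) (n : ℕ) :
    (ridgeGram V x n).trace = V * d + ∑ k ∈ Finset.range n, x k ⬝ᵥ x k := by
  simp [ridgeGram, trace_add, trace_smul, trace_sum, trace_vecMulVec]

theorem PosDef.mulVec_inv_mulVec {A : Matrix (Fin d) (Fin d) ℝ} (hA : A.PosDef)
    (v : Fin d → ℝ) : A *ᵥ (A⁻¹ *ᵥ v) = v := by
  rw [mulVec_mulVec, mul_nonsing_inv _ ((isUnit_iff_isUnit_det A).1 hA.isUnit), one_mulVec]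

theorem PosDef.inv_mulVec_eq {A : Matrix (Fin d) (Fin d) ℝ} (hA : A.PosDef)
    {v y : Fin d → ℝ} (h : A *ᵥ y = v) : A⁻¹ *ᵥ v = y := by
  rw [← h, mulVec_mulVec, nonsing_inv_mul _ ((isUnit_iff_isUnit_det A).1 hA.isUnit), one_mulVec]

theorem IsHermitian.dotProduct_mulVec_comm {A : Matrix (Fin d) (Fin d) ℝ} (hA : A.IsHermitian)
    (v w : Fin d → ℝ) : v ⬝ᵥ (A *ᵥ w) = w ⬝ᵥ (A *ᵥ v) := by
  have h : Aᵀ = A := hA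
  rw [dotProduct_mulVec, ← mulVec_transpose, h, dotProduct_comm]

/-- The Cauchy–Schwarz inequality for the pair of dual norms `‖·‖_A` and `‖·‖_{A⁻¹}`. -/
theorem PosDef.sq_dotProduct_le {A : Matrix (Fin d) (Fin d) ℝ} (hA : A.PosDef)
    (w v : Fin d → ℝ) : (w ⬝ᵥ v) ^ 2 ≤ (w ⬝ᵥ (A *ᵥ w)) * (v ⬝ᵥ (A⁻¹ *ᵥ v)) := by
  set y := A⁻¹ *ᵥ v with hy
  have hAy : A *ᵥ y = v := PosDef.mulVec_inv_mulVec hA v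
  have h : ∀ s : ℝ, 0 ≤ (w ⬝ᵥ (A *ᵥ w)) * (s * s) + (2 * (w ⬝ᵥ v)) * s + v ⬝ᵥ y := fun s => by
    have h0 := hA.posSemidef.dotProduct_mulVec_nonneg (s • w + y)
    rw [star_trivial, mulVec_add, mulVec_smul, hAy] at h0
    have h1 : y ⬝ᵥ (A *ᵥ w) = w ⬝ᵥ v := by
      rw [IsHermitian.dotProduct_mulVec_comm hA.1, hAy]
    simp only [dotProduct_add, add_dotProduct, smul_dotProduct, dotProduct_smul, smul_eq_mul,
      h1, dotProduct_comm y v] at h0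
    linarith
  have := discrim_le_zero h
  rw [discrim] at this
  nlinarith

theorem PosDef.inv_quadratic_nonneg {A : Matrix (Fin d) (Fin d) ℝ} (hA : A.PosDef)
    (v : Fin d → ℝ) : 0 ≤ v ⬝ᵥ (A⁻¹ *ᵥ v) := by
  simpa using hA.inv.posSemidef.dotProduct_mulVec_nonneg v

theorem PosDef.add_vecMulVec_self {A : Matrix (Fin d) (Fin d) ℝ} (hA : A.PosDef)
    (x : Fin d → ℝ) : (A + vecMulVec x x).PosDef := by
  refine hA.add_posSemidef ?_
  simpa using posSemidef_vecMulVec_self_star x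

/-- The Sherman–Morrison formula for the quadratic form `v ↦ vᵀ A⁻¹ v` when a new data point
`x` with response `e` arrives. -/
theorem PosDef.inv_quadratic_rankOne_update {A : Matrix (Fin d) (Fin d) ℝ} (hA : A.PosDef)
    (x s : Fin d → ℝ) (e : ℝ) :
    (s + e • x) ⬝ᵥ ((A + vecMulVec x x)⁻¹ *ᵥ (s + e • x)) =
      s ⬝ᵥ (A⁻¹ *ᵥ s) + (2 * (x ⬝ᵥ (A⁻¹ *ᵥ s)) * e + (x ⬝ᵥ (A⁻¹ *ᵥ x)) * e ^ 2
        - (x ⬝ᵥ (A⁻¹ *ᵥ s)) ^ 2) / (1 + x ⬝ᵥ (A⁻¹ *ᵥ x)) := by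
  set v := s + e • x with hv
  set u := x ⬝ᵥ (A⁻¹ *ᵥ x) with hu
  set z := x ⬝ᵥ (A⁻¹ *ᵥ s) with hz
  have hu0 : 0 ≤ u := PosDef.inv_quadratic_nonneg hA x
  have hu1 : 1 + u ≠ 0 := by positivity
  have hxv : x ⬝ᵥ (A⁻¹ *ᵥ v) = z + e * u := by
    rw [hv, mulVec_add, mulVec_smul, dotProduct_add, dotProduct_smul, smul_eq_mul]
  have hinv : (A + vecMulVec x x)⁻¹ *ᵥ v
      = A⁻¹ *ᵥ v - ((z + e * u) / (1 + u)) • (A⁻¹ *ᵥ x) := by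
    refine PosDef.inv_mulVec_eq (PosDef.add_vecMulVec_self hA x) ?_
    rw [add_mulVec, mulVec_sub, mulVec_sub, mulVec_smul, mulVec_smul,
      PosDef.mulVec_inv_mulVec hA, PosDef.mulVec_inv_mulVec hA, vecMulVec_mulVec,
      vecMulVec_mulVec, hxv, ← hu]
    ext i
    simp only [Pi.add_apply, Pi.sub_apply, Pi.smul_apply, smul_eq_mul, MulOpposite.smul_eq_mul_unop,
      MulOpposite.unop_op]
    field_simp
    ring
  have hsx : s ⬝ᵥ (A⁻¹ *ᵥ x) = z := by
    rw [hz, IsHermitian.dotProduct_mulVec_comm hA.inv.1]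
  rw [hinv, dotProduct_sub, dotProduct_smul, smul_eq_mul, hv, mulVec_add, mulVec_smul]
  simp only [dotProduct_add, add_dotProduct, smul_dotProduct, dotProduct_smul, smul_eq_mul, hsx,
    ← hu, ← hz]
  field_simp
  ring

/-- The matrix determinant lemma. -/
theorem PosDef.det_rankOne_update {A : Matrix (Fin d) (Fin d) ℝ} (hA : A.PosDef)
    (x : Fin d → ℝ) :
    (A + vecMulVec x x).det = A.det * (1 + x ⬝ᵥ (A⁻¹ *ᵥ x)) := by
  have hu : IsUnit A.det := (isUnit_iff_isUnit_det A).1 hA.isUnit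
  rw [vecMulVec_eq Unit, det_add_replicateCol_mul_replicateRow hu]
  congr 2
  rw [Matrix.mul_assoc, ← replicateCol_mulVec]
  simp [Matrix.mul_apply, dotProduct]

/-- The determinant is the product of the eigenvalues, each of which is bounded through
`y ≤ m exp(y/m - 1)`. The choice `m = tr A / d` gives the inequality of arithmetic and geometric
means, and a smaller `m` a bound that is linear in the trace. -/
theorem PosDef.det_le {A : Matrix (Fin d) (Fin d) ℝ} (hA : A.PosDef) {m : ℝ} (hm : 0 < m) :
    A.det ≤ m ^ d * Real.exp (A.trace / m - d) := by
  rw [hA.1.det_eq_prod_eigenvalues, hA.1.trace_eq_sum_eigenvalues]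
  calc ∏ i, (hA.1.eigenvalues i : ℝ)
      ≤ ∏ i : Fin d, (m * Real.exp (hA.1.eigenvalues i / m - 1)) := by
        refine Finset.prod_le_prod (fun i _ => (hA.eigenvalues_pos i).le) fun i _ => ?_
        have h := Real.add_one_le_exp (hA.1.eigenvalues i / m - 1)
        rw [sub_add_cancel, div_le_iff₀ hm] at h
        linarith
    _ = _ := by
        rw [Finset.prod_mul_distrib, Finset.prod_const, Finset.card_univ, Fintype.card_fin,
          ← Real.exp_sum, Finset.sum_sub_distrib, ← Finset.sum_div]
        simp

theorem log_det_ridgeGram_le {V : ℝ} (hV : 0 < V) (x : ℕ → Fin d → ℝ) (n : ℕ) {b : ℝ}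
    (hb : ∀ k < n, x k ⬝ᵥ x k ≤ b) :
    Real.log ((ridgeGram V x n).det / V ^ d) ≤ n * b / V := by
  have hA := posDef_ridgeGram hV x n
  have h := PosDef.det_le hA hV
  have h1 : (ridgeGram V x n).det / V ^ d ≤ Real.exp (n * b / V) := by
    rw [div_le_iff₀ (by positivity), mul_comm]
    refine h.trans ?_
    gcongr
    rw [trace_ridgeGram, add_div, mul_div_cancel_left₀ _ hV.ne', add_sub_cancel_left]
    gcongr
    calc ∑ k ∈ Finset.range n, x k ⬝ᵥ x k ≤ ∑ k ∈ Finset.range n, b :=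
          Finset.sum_le_sum fun k hk => hb k (Finset.mem_range.1 hk)
      _ = n * b := by simp
  calc _ ≤ Real.log (Real.exp (n * b / V)) :=
        Real.log_le_log (div_pos hA.det_pos (by positivity)) h1
    _ = _ := Real.log_exp _

theorem log_det_ridgeGram_le_mul_log {V : ℝ} (hV : 0 < V) (hd : 0 < d) (x : ℕ → Fin d → ℝ) (n : ℕ)
    {b : ℝ} (hb0 : 0 ≤ b) (hb : ∀ k < n, x k ⬝ᵥ x k ≤ b) :
    Real.log ((ridgeGram V x n).det / V ^ d) ≤ d * Real.log (1 + n * b / (V * d)) := by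
  have hA := posDef_ridgeGram hV x n
  have hd' : (0 : ℝ) < d := by exact_mod_cast hd
  have hm : 0 < V * (1 + n * b / (V * d)) := by positivity
  have h := PosDef.det_le hA hm
  have h1 : (ridgeGram V x n).det / V ^ d ≤ (1 + n * b / (V * d)) ^ d := by
    rw [div_le_iff₀ (by positivity), mul_comm, ← mul_pow]
    refine h.trans (mul_le_of_le_one_right (by positivity) ?_)
    rw [Real.exp_le_one_iff, sub_nonpos, div_le_iff₀ hm, trace_ridgeGram]
    have : ∑ k ∈ Finset.range n, x k ⬝ᵥ x k ≤ n * b := by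
      calc ∑ k ∈ Finset.range n, x k ⬝ᵥ x k ≤ ∑ k ∈ Finset.range n, b :=
            Finset.sum_le_sum fun k hk => hb k (Finset.mem_range.1 hk)
        _ = n * b := by simp
    have h2 : (d : ℝ) * (V * (1 + n * b / (V * d))) = V * d + n * b := by
      field_simp
    linarith
  calc _ ≤ Real.log ((1 + n * b / (V * d)) ^ d) :=
        Real.log_le_log (div_pos hA.det_pos (by positivity)) h1
    _ = _ := Real.log_pow _ _

/-- The elliptical potential lemma: each squared norm `u = x_kᵀ A_k⁻¹ x_k ≤ q` is at most
`(1 + q) log (1 + u)`, and `∏ (1 + u)` telescopes to the ratio of the determinants. -/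
theorem sum_inv_quadratic_le {V : ℝ} (hV : 0 < V) (x : ℕ → Fin d → ℝ) (n : ℕ) {q : ℝ}
    (hq : ∀ k < n, x k ⬝ᵥ ((ridgeGram V x k)⁻¹ *ᵥ x k) ≤ q) :
    ∑ k ∈ Finset.range n, x k ⬝ᵥ ((ridgeGram V x k)⁻¹ *ᵥ x k) ≤
      (1 + q) * Real.log ((ridgeGram V x n).det / V ^ d) := by
  induction n with
  | zero => simp [ridgeGram, (pow_pos hV d).ne']
  | succ n ih =>
    have hA := posDef_ridgeGram hV x n
    have hu := PosDef.inv_quadratic_nonneg hA (x n)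
    have hqn := hq n (Nat.lt_succ_self n)
    rw [Finset.sum_range_succ, ridgeGram_succ, PosDef.det_rankOne_update hA, mul_div_right_comm,
      Real.log_mul (div_pos hA.det_pos (by positivity)).ne' (by positivity), mul_add]
    refine add_le_add (ih fun k hk => hq k (hk.trans (Nat.lt_succ_self n))) ?_
    set u := x n ⬝ᵥ ((ridgeGram V x n)⁻¹ *ᵥ x n)
    have h1 : u / (1 + u) ≤ Real.log (1 + u) := by
      have := Real.one_sub_inv_le_log_of_pos (show 0 < 1 + u by positivity)
      refine le_trans (le_of_eq ?_) this
      field_simp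
      ring
    rw [div_le_iff₀ (by positivity)] at h1
    nlinarith [Real.log_nonneg (show 1 ≤ 1 + u by linarith)]

theorem inv_quadratic_le {V : ℝ} (hV : 0 < V) (x : ℕ → Fin d → ℝ) (n : ℕ) (v : Fin d → ℝ) :
    v ⬝ᵥ ((ridgeGram V x n)⁻¹ *ᵥ v) ≤ (v ⬝ᵥ v) / V := by
  have hA := posDef_ridgeGram hV x n
  set y := (ridgeGram V x n)⁻¹ *ᵥ v with hy
  have hAy : ridgeGram V x n *ᵥ y = v := PosDef.mulVec_inv_mulVec hA v
  have h1 := dotProduct_ridgeGram_mulVec V x n y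
  rw [hAy, dotProduct_comm y v] at h1
  have h2 : 0 ≤ ∑ k ∈ Finset.range n, (x k ⬝ᵥ y) ^ 2 := Finset.sum_nonneg fun _ _ => sq_nonneg _
  have h3 : 0 ≤ (v - V • y) ⬝ᵥ (v - V • y) := zero_le_dotProduct_self _
  simp only [dotProduct_sub, sub_dotProduct, smul_dotProduct, dotProduct_smul, smul_eq_mul,
    dotProduct_comm y v] at h3
  rw [le_div_iff₀ hV]
  nlinarith

/-! ### The smallest eigenvalue -/

/-- The smallest eigenvalue of a positive semidefinite matrix bounds its quadratic form from
below. -/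
theorem le_quadratic_of_le_minEigenvalue {A : Matrix (Fin d) (Fin d) ℝ} (hA : A.PosSemidef)
    {l : ℝ} (hl : l ≤ minEigenvalue A) (v : Fin d → ℝ) : l * (v ⬝ᵥ v) ≤ v ⬝ᵥ (A *ᵥ v) := by
  have hB : (A - l • (1 : Matrix (Fin d) (Fin d) ℝ)).IsHermitian :=
    hA.1.sub (by rw [Matrix.IsHermitian, conjTranspose_smul, star_trivial, conjTranspose_one])
  have hpos : (A - l • (1 : Matrix (Fin d) (Fin d) ℝ)).PosSemidef := by
    rw [hB.posSemidef_iff_eigenvalues_nonneg]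
    intro i
    have h1 := hB.mulVec_eigenvectorBasis i
    set y : Fin d → ℝ := ⇑(hB.eigenvectorBasis i) with hy
    have hy0 : y ≠ 0 := fun h => by
      have h0 := hB.eigenvectorBasis.orthonormal.ne_zero i
      exact h0 (by ext j; exact congrFun h j)
    have h2 : A *ᵥ y = (hB.eigenvalues i + l) • y := by
      rw [sub_mulVec, smul_mulVec, one_mulVec, sub_eq_iff_eq_add] at h1
      rw [h1, add_smul]
    have h3 : Module.End.HasEigenvalue (Matrix.toLin' A) (hB.eigenvalues i + l) :=
      Module.End.hasEigenvalue_of_hasEigenvector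
        (x := y) ⟨Module.End.mem_eigenspace_iff.2 (by rw [toLin'_apply, h2]), hy0⟩
    have hbdd : BddBelow {x : ℝ | Module.End.HasEigenvalue (Matrix.toLin' A) x} := by
      refine ⟨0, fun x hx => ?_⟩
      obtain ⟨w, hw⟩ := hx.exists_hasEigenvector
      have h4 : A *ᵥ w = x • w := by simpa using hw.apply_eq_smul
      have h5 := hA.dotProduct_mulVec_nonneg w
      rw [star_trivial, h4, dotProduct_smul, smul_eq_mul] at h5
      have h6 : 0 < w ⬝ᵥ w := lt_of_le_of_ne (zero_le_dotProduct_self w)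
        (fun h => hw.2 (dotProduct_self_eq_zero.1 h.symm))
      exact nonneg_of_mul_nonneg_left h5 h6
    have h7 : minEigenvalue A ≤ hB.eigenvalues i + l := csInf_le hbdd h3
    simp only [Pi.zero_apply]
    linarith
  have h := hpos.dotProduct_mulVec_nonneg v
  rw [star_trivial, sub_mulVec, smul_mulVec, one_mulVec, dotProduct_sub, dotProduct_smul,
    smul_eq_mul] at h
  linarith

end LinearAlgebra

/-! ### Sub-Gaussian noise and the Gaussian mixture -/

section Gaussian
open ProbabilityTheory

theorem gaussianPDFReal_mul_exp_linear (m : ℝ) {v : NNReal} (hv : v ≠ 0) (y t : ℝ) :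
    gaussianPDFReal m v t * Real.exp (t * y) =
      Real.exp (m * y + v * y ^ 2 / 2) * gaussianPDFReal (m + v * y) v t := by
  have hv' : (v : ℝ) ≠ 0 := by exact_mod_cast hv
  rw [gaussianPDFReal, gaussianPDFReal, mul_assoc, ← Real.exp_add, mul_left_comm, ← Real.exp_add]
  congr 2
  field_simp
  ring

theorem gaussianPDFReal_mul_exp_sq (z : ℝ) {u v : NNReal} (hu : u ≠ 0) (hv : (v : ℝ) = u / (1 + u))
    (t : ℝ) :
    gaussianPDFReal (z / (1 + u)) v t * Real.exp (t ^ 2 / 2) =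
      Real.sqrt (1 + u) * Real.exp (z ^ 2 / (2 * (1 + u))) * gaussianPDFReal z u t := by
  have hu' : (u : ℝ) ≠ 0 := by exact_mod_cast hu
  have hu0 : (0 : ℝ) ≤ u := u.2
  have hu1 : (1 : ℝ) + u ≠ 0 := by positivity
  have hs : (Real.sqrt (2 * Real.pi * v))⁻¹
      = Real.sqrt (1 + u) * (Real.sqrt (2 * Real.pi * u))⁻¹ := by
    rw [hv, ← mul_div_assoc, Real.sqrt_div (by positivity), inv_div, div_eq_mul_inv]
  have he : -(t - z / (1 + u)) ^ 2 / (2 * v) + t ^ 2 / 2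
      = z ^ 2 / (2 * (1 + u)) + -(t - z) ^ 2 / (2 * u) := by
    rw [hv]
    field_simp
    ring
  rw [gaussianPDFReal, gaussianPDFReal, mul_assoc, ← Real.exp_add, he, hs, Real.exp_add]
  ring

/-- One step of the method of mixtures. The integrand is, up to a factor that does not depend on
`y`, the moment generating function at `y` of the Gaussian law with mean `z / (1 + u)` and
variance `u / (1 + u)`. -/
theorem lintegral_exp_quadratic_le {ν : Measure ℝ} [SFinite ν]
    (hν : ∀ s : ℝ, ∫⁻ y, ENNReal.ofReal (Real.exp (s * y)) ∂ν ≤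
      ENNReal.ofReal (Real.exp (s ^ 2 / 2)))
    (z : ℝ) {u : ℝ} (hu : 0 ≤ u) :
    ∫⁻ y, ENNReal.ofReal (Real.exp ((2 * z * y + u * y ^ 2 - z ^ 2) / (1 + u) / 2)) ∂ν ≤
      ENNReal.ofReal (Real.sqrt (1 + u)) := by
  rcases hu.eq_or_lt with rfl | hu
  · have h : ∀ y : ℝ, ENNReal.ofReal
        (Real.exp ((2 * z * y + 0 * y ^ 2 - z ^ 2) / (1 + 0) / 2)) =
        ENNReal.ofReal (Real.exp (-(z ^ 2 / 2))) * ENNReal.ofReal (Real.exp (z * y)) := fun y => by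
      rw [← ENNReal.ofReal_mul (Real.exp_nonneg _), ← Real.exp_add]
      congr 2
      ring
    simp_rw [h]
    rw [lintegral_const_mul _ (by fun_prop)]
    refine (mul_le_mul_right (hν z) _).trans ?_
    rw [← ENNReal.ofReal_mul (Real.exp_nonneg _), ← Real.exp_add]
    simp
  · lift u to NNReal using hu.le
    have hu0 : u ≠ 0 := by rintro rfl; simp at hu
    have hu1 : (1 : ℝ) + u ≠ 0 := by positivity
    set v : NNReal := u / (1 + u) with hv
    have hv0 : v ≠ 0 := by positivity
    have hv' : (v : ℝ) = u / (1 + u) := by simp [hv]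
    set m : ℝ := z / (1 + u) with hm
    have hy : ∀ y : ℝ, ENNReal.ofReal
        (Real.exp ((2 * z * y + u * y ^ 2 - z ^ 2) / (1 + u) / 2)) =
        ENNReal.ofReal (Real.exp (-(z ^ 2 / (2 * (1 + u))))) *
          ∫⁻ t, ENNReal.ofReal (gaussianPDFReal m v t * Real.exp (t * y)) := fun y => by
      simp_rw [gaussianPDFReal_mul_exp_linear m hv0, ENNReal.ofReal_mul (Real.exp_nonneg _)]
      rw [lintegral_const_mul _ (by fun_prop), lintegral_gaussianPDFReal_eq_one _ hv0, mul_one,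
        ← ENNReal.ofReal_mul (Real.exp_nonneg _), ← Real.exp_add]
      congr 2
      rw [hv', hm]
      field_simp
      ring
    have hswap : ∫⁻ y, (∫⁻ t, ENNReal.ofReal (gaussianPDFReal m v t * Real.exp (t * y))) ∂ν =
        ∫⁻ t, ∫⁻ y, ENNReal.ofReal (gaussianPDFReal m v t * Real.exp (t * y)) ∂ν := by
      rw [lintegral_lintegral_swap]
      have : Measurable fun p : ℝ × ℝ => gaussianPDFReal m v p.2 :=
        (measurable_gaussianPDFReal m v).comp measurable_snd
      refine Measurable.aemeasurable ?_
      simp only [Function.uncurry_def]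
      fun_prop
    simp_rw [hy]
    rw [lintegral_const_mul', hswap]
    · calc _ ≤ ENNReal.ofReal (Real.exp (-(z ^ 2 / (2 * (1 + u))))) *
            ∫⁻ t, ENNReal.ofReal (Real.sqrt (1 + u) * Real.exp (z ^ 2 / (2 * (1 + u)))
              * gaussianPDFReal z u t) := by
            gcongr with t
            simp_rw [ENNReal.ofReal_mul (gaussianPDFReal_nonneg m v t)]
            rw [lintegral_const_mul _ (by fun_prop), ← gaussianPDFReal_mul_exp_sq z hu0 hv',
              ENNReal.ofReal_mul (gaussianPDFReal_nonneg m v t)]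
            gcongr
            exact hν t
        _ = _ := by
            simp_rw [ENNReal.ofReal_mul (mul_nonneg (Real.sqrt_nonneg (1 + (u : ℝ)))
              (Real.exp_nonneg (z ^ 2 / (2 * (1 + u)))))]
            rw [lintegral_const_mul _ (by fun_prop), lintegral_gaussianPDFReal_eq_one _ hu0,
              mul_one, ← ENNReal.ofReal_mul (Real.exp_nonneg _), mul_left_comm, ← Real.exp_add]
            simp
    · exact ENNReal.ofReal_ne_top

end Gaussian

section Noise

variable {Ω : Type*} {m0 : MeasurableSpace Ω} {μ : Measure Ω}

theorem CondSubGaussian.div_const {m : MeasurableSpace Ω} {σ : ℝ} (hσ : 0 < σ) {Z : Ω → ℝ}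
    (h : CondSubGaussian m μ σ Z) : CondSubGaussian m μ 1 fun ω => Z ω / σ := by
  refine ⟨h.1.div_const σ, ?_, fun s => ?_⟩
  · have h1 := condExp_smul (μ := μ) σ⁻¹ Z m
    have h2 : (fun ω => Z ω / σ) = σ⁻¹ • Z := by ext ω; simp [div_eq_inv_mul]
    rw [h2]
    filter_upwards [h1, h.2.1] with ω h3 h4
    simp [h3, h4]
  · have h1 : (fun ω => Real.exp (s * (Z ω / σ))) = fun ω => Real.exp (s / σ * Z ω) := by
      ext ω; congr 1; ring
    rw [h1]
    refine ⟨(h.2.2 _).1, (h.2.2 (s / σ)).2.trans (Filter.Eventually.of_forall fun ω => ?_)⟩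
    simp only
    refine (congrArg Real.exp ?_).le
    field_simp

theorem lintegral_condDistrib {β : Type*} [MeasurableSpace β] [IsFiniteMeasure μ] {X : Ω → β}
    {Z : Ω → ℝ} (hX : Measurable X) (hZ : Measurable Z) {f : β × ℝ → ENNReal}
    (hf : Measurable f) :
    ∫⁻ ω, f (X ω, Z ω) ∂μ =
      ∫⁻ ω, ∫⁻ y, f (X ω, y) ∂(ProbabilityTheory.condDistrib Z X μ (X ω)) ∂μ := by
  rw [← lintegral_map (f := f) (g := fun ω => (X ω, Z ω)) hf (hX.prodMk hZ),
    ← ProbabilityTheory.compProd_map_condDistrib hZ.aemeasurable, Measure.lintegral_compProd hf,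
    lintegral_map (Measurable.lintegral_kernel_prod_right' hf) hX]

/-- A conditionally sub-Gaussian variable has a regular conditional distribution that is
sub-Gaussian at all arguments of the moment generating function simultaneously; hence random
arguments that are known to the conditioning sigma-algebra are allowed. -/
theorem CondSubGaussian.exists_kernel [IsProbabilityMeasure μ] {m : MeasurableSpace Ω}
    (hm : m ≤ m0) {Z : Ω → ℝ} (hZ : Measurable[m0] Z) (h : CondSubGaussian m μ 1 Z) :
    ∃ κ : @ProbabilityTheory.Kernel Ω ℝ m _, ProbabilityTheory.IsMarkovKernel κ ∧
      (∀ᵐ ω ∂μ, ∀ s : ℝ, ∫⁻ y, ENNReal.ofReal (Real.exp (s * y)) ∂(κ ω) ≤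
        ENNReal.ofReal (Real.exp (s ^ 2 / 2))) ∧
      ∀ f : Ω → ℝ → ENNReal, (Measurable[m.prod inferInstance] (Function.uncurry f)) →
        ∫⁻ ω, f ω (Z ω) ∂μ = ∫⁻ ω, ∫⁻ y, f ω y ∂(κ ω) ∂μ := by
  have hid : @Measurable Ω Ω m0 m id := measurable_id'' hm
  refine ⟨@ProbabilityTheory.condDistrib Ω Ω ℝ _ _ _ m0 m Z id μ _, inferInstance, ?_, ?_⟩
  · have hq : ∀ q : ℚ, ∀ᵐ ω ∂μ, ∫⁻ y, ENNReal.ofReal (Real.exp (q * y))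
        ∂(@ProbabilityTheory.condDistrib Ω Ω ℝ _ _ _ m0 m Z id μ _ ω) ≤
        ENNReal.ofReal (Real.exp ((q : ℝ) ^ 2 / 2)) := fun q => by
      have h1 := @ProbabilityTheory.condExp_ae_eq_integral_condDistrib Ω Ω ℝ ℝ _ _ _ _ m0 μ _ id Z m
        _ _ hid hZ.aemeasurable (fun y : ℝ => Real.exp (q * y))
        (by fun_prop) (h.2.2 q).1
      have h2 := (h.2.2 q).2
      have h3 := @Integrable.condDistrib_ae Ω Ω ℝ ℝ _ _ _ _ m0 μ _ id Z m
        (fun p => Real.exp (q * p.2)) hid.aemeasurable hZ.aemeasurable (by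
          refine (integrable_map_measure ?_ ?_).2 (h.2.2 q).1
          · exact Measurable.aestronglyMeasurable (by fun_prop)
          · exact (Measurable.prodMk hid hZ).aemeasurable)
      rw [MeasurableSpace.comap_id] at h1
      filter_upwards [h1, h2, h3] with ω e1 e2 e3
      simp only [id] at e1 e3 ⊢
      rw [← ofReal_integral_eq_lintegral_ofReal e3
        (Filter.Eventually.of_forall fun _ => Real.exp_nonneg _)]
      refine ENNReal.ofReal_le_ofReal ?_
      rw [← e1]
      simpa using e2
    filter_upwards [ae_all_iff.2 hq] with ω hω s
    obtain ⟨q, hqs⟩ : ∃ q : ℕ → ℚ,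
        Filter.Tendsto (fun n => (q n : ℝ)) Filter.atTop (nhds s) := by
      obtain ⟨a, ha, has⟩ := mem_closure_iff_seq_limit.1 (Rat.denseRange_cast (𝕜 := ℝ) s)
      choose q hq using ha
      exact ⟨q, by simpa only [hq] using has⟩
    have hlim : ∀ y : ℝ, Filter.Tendsto (fun n => ENNReal.ofReal (Real.exp (q n * y)))
        Filter.atTop (nhds (ENNReal.ofReal (Real.exp (s * y)))) := fun y =>
      ENNReal.tendsto_ofReal ((Real.continuous_exp.tendsto _).comp (hqs.mul_const y))
    have hlim2 : Filter.Tendsto (fun n => ENNReal.ofReal (Real.exp ((q n : ℝ) ^ 2 / 2)))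
        Filter.atTop (nhds (ENNReal.ofReal (Real.exp (s ^ 2 / 2)))) :=
      ENNReal.tendsto_ofReal ((Real.continuous_exp.tendsto _).comp ((hqs.pow 2).div_const 2))
    calc _ = ∫⁻ y, Filter.liminf (fun n => ENNReal.ofReal (Real.exp (q n * y))) Filter.atTop
          ∂(@ProbabilityTheory.condDistrib Ω Ω ℝ _ _ _ m0 m Z id μ _ ω) :=
          lintegral_congr fun y => (hlim y).liminf_eq.symm
      _ ≤ Filter.liminf (fun n => ∫⁻ y, ENNReal.ofReal (Real.exp (q n * y))
          ∂(@ProbabilityTheory.condDistrib Ω Ω ℝ _ _ _ m0 m Z id μ _ ω)) Filter.atTop :=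
          lintegral_liminf_le fun n => by fun_prop
      _ ≤ Filter.liminf (fun n => ENNReal.ofReal (Real.exp ((q n : ℝ) ^ 2 / 2))) Filter.atTop :=
          Filter.liminf_le_liminf (Filter.Eventually.of_forall fun n => hω (q n))
      _ = _ := hlim2.liminf_eq
  · intro f hf
    exact @lintegral_condDistrib Ω m0 μ Ω m _ id Z hid hZ (Function.uncurry f) hf

end Noise

/-! ### The self-normalized bound -/

section Measurability

variable {Ω : Type*} [MeasurableSpace Ω] {d : ℕ}

theorem measurable_dotProduct {v w : Ω → Fin d → ℝ} (hv : Measurable v) (hw : Measurable w) :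
    Measurable fun ω => v ω ⬝ᵥ w ω :=
  Finset.measurable_sum _ fun i _ => ((measurable_pi_apply i).comp hv).mul
    ((measurable_pi_apply i).comp hw)

theorem measurable_mulVec {m : ℕ} {A : Ω → Matrix (Fin m) (Fin d) ℝ}
    (hA : ∀ i j, Measurable fun ω => A ω i j) {v : Ω → Fin d → ℝ} (hv : Measurable v) :
    Measurable fun ω => A ω *ᵥ v ω :=
  measurable_pi_lambda _ fun i => measurable_dotProduct (measurable_pi_lambda _ (hA i)) hv

theorem measurable_transpose_mulVec {q : ℕ} (U : Matrix (Fin d) (Fin q) ℝ)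
    {f : Ω → Fin d → ℝ} (hf : Measurable f) : Measurable fun ω => Uᵀ *ᵥ f ω :=
  measurable_mulVec (A := fun _ => Uᵀ) (fun _ _ => measurable_const) hf

theorem measurable_det {A : Ω → Matrix (Fin d) (Fin d) ℝ}
    (hA : ∀ i j, Measurable fun ω => A ω i j) : Measurable fun ω => (A ω).det := by
  simp_rw [det_apply]
  exact Finset.measurable_sum _ fun s _ =>
    (Finset.measurable_prod _ fun i _ => hA _ _).const_smul (Equiv.Perm.sign s)

theorem measurable_inv_apply {A : Ω → Matrix (Fin d) (Fin d) ℝ}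
    (hA : ∀ i j, Measurable fun ω => A ω i j) (i j : Fin d) :
    Measurable fun ω => (A ω)⁻¹ i j := by
  simp_rw [inv_def, Ring.inverse_eq_inv', Matrix.smul_apply, adjugate_apply, smul_eq_mul]
  refine (measurable_det hA).inv.mul (measurable_det fun k l => ?_)
  by_cases h : k = j
  · subst h; simp
  · simpa [updateRow_ne h] using hA k l

theorem measurable_ridgeGram_apply {x : ℕ → Ω → Fin d → ℝ} {n : ℕ} (V : ℝ)
    (hx : ∀ k < n, Measurable (x k)) (i j : Fin d) :
    Measurable fun ω => ridgeGram V (fun k => x k ω) n i j := by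
  simp only [ridgeGram, Matrix.add_apply, Matrix.sum_apply, vecMulVec_apply]
  refine measurable_const.add (Finset.measurable_sum _ fun k hk => ?_)
  have h := hx k (Finset.mem_range.1 hk)
  exact ((measurable_pi_apply i).comp h).mul ((measurable_pi_apply j).comp h)

theorem measurable_inv_quadratic {x : ℕ → Ω → Fin d → ℝ} {n : ℕ} (V : ℝ)
    (hx : ∀ k < n, Measurable (x k)) {v w : Ω → Fin d → ℝ} (hv : Measurable v)
    (hw : Measurable w) :
    Measurable fun ω => v ω ⬝ᵥ ((ridgeGram V (fun k => x k ω) n)⁻¹ *ᵥ w ω) :=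
  measurable_dotProduct hv
    (measurable_mulVec (measurable_inv_apply (measurable_ridgeGram_apply V hx)) hw)

theorem measurable_sum_smul {x : ℕ → Ω → Fin d → ℝ} {e : ℕ → Ω → ℝ} {n : ℕ}
    (hx : ∀ k < n, Measurable (x k)) (he : ∀ k < n, Measurable (e k)) :
    Measurable fun ω => ∑ k ∈ Finset.range n, e k ω • x k ω :=
  Finset.measurable_sum _ fun k hk =>
    (he k (Finset.mem_range.1 hk)).smul (hx k (Finset.mem_range.1 hk))

end Measurability

/-- The exponential of half of the squared self-normalized sum `‖∑ e_k x_k‖²_{A_n⁻¹}`, divided by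
`(det A_n / V^d)^{1/2}`. -/
noncomputable def mixture {d : ℕ} (V : ℝ) (x : ℕ → Fin d → ℝ) (e : ℕ → ℝ) (n : ℕ) : ℝ :=
  Real.exp ((∑ k ∈ Finset.range n, e k • x k) ⬝ᵥ
      ((ridgeGram V x n)⁻¹ *ᵥ ∑ k ∈ Finset.range n, e k • x k) / 2) /
    Real.sqrt ((ridgeGram V x n).det / V ^ d)

theorem mixture_nonneg {d : ℕ} (V : ℝ) (x : ℕ → Fin d → ℝ) (e : ℕ → ℝ) (n : ℕ) :
    0 ≤ mixture V x e n := div_nonneg (Real.exp_nonneg _) (Real.sqrt_nonneg _)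

theorem mixture_succ {d : ℕ} {V : ℝ} (hV : 0 < V) (x : ℕ → Fin d → ℝ) (e : ℕ → ℝ) (n : ℕ) :
    mixture V x e (n + 1) = mixture V x e n /
      Real.sqrt (1 + x n ⬝ᵥ ((ridgeGram V x n)⁻¹ *ᵥ x n)) *
      Real.exp ((2 * (x n ⬝ᵥ ((ridgeGram V x n)⁻¹ *ᵥ ∑ k ∈ Finset.range n, e k • x k)) * e n
        + (x n ⬝ᵥ ((ridgeGram V x n)⁻¹ *ᵥ x n)) * e n ^ 2
        - (x n ⬝ᵥ ((ridgeGram V x n)⁻¹ *ᵥ ∑ k ∈ Finset.range n, e k • x k)) ^ 2)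
        / (1 + x n ⬝ᵥ ((ridgeGram V x n)⁻¹ *ᵥ x n)) / 2) := by
  have hA := posDef_ridgeGram hV x n
  rw [mixture, Finset.sum_range_succ, ridgeGram_succ, PosDef.inv_quadratic_rankOne_update hA,
    PosDef.det_rankOne_update hA, mul_div_right_comm,
    Real.sqrt_mul (div_nonneg hA.det_pos.le (by positivity)), add_div, Real.exp_add, mixture]
  field_simp

section SelfNormalized

variable {Ω : Type*} {m0 : MeasurableSpace Ω} {μ : Measure Ω} [IsProbabilityMeasure μ] {d : ℕ}

/-- The mixture has mean at most one: it is a supermartingale, since by the formulas for a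
rank-one update each step multiplies it by the factor of `lintegral_exp_quadratic_le`. -/
theorem lintegral_mixture_le_one {V : ℝ} (hV : 0 < V) {F : ℕ → MeasurableSpace Ω}
    (hF : ∀ n, F n ≤ m0) {x : ℕ → Ω → Fin d → ℝ} {e : ℕ → Ω → ℝ}
    (hx : ∀ n, ∀ k ≤ n, Measurable[F n] (x k)) (he : ∀ n, ∀ k < n, Measurable[F n] (e k))
    (hem : ∀ k, Measurable[m0] (e k)) {N : ℕ} (hsub : ∀ n < N, CondSubGaussian (F n) μ 1 (e n)) :
    ∀ n ≤ N, ∫⁻ ω, ENNReal.ofReal (mixture V (fun k => x k ω) (fun k => e k ω) n) ∂μ ≤ 1 := by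
  intro n
  induction n with
  | zero => simp [mixture, ridgeGram, (pow_pos hV d).ne']
  | succ n ih =>
    intro hn
    obtain ⟨κ, hκ, hsubκ, hint⟩ := CondSubGaussian.exists_kernel (hF n) (hem n)
      (hsub n (Nat.lt_of_succ_le hn))
    set u : Ω → ℝ := fun ω => x n ω ⬝ᵥ ((ridgeGram V (fun k => x k ω) n)⁻¹ *ᵥ x n ω) with hu
    set z : Ω → ℝ := fun ω => x n ω ⬝ᵥ ((ridgeGram V (fun k => x k ω) n)⁻¹ *ᵥ
      ∑ k ∈ Finset.range n, e k ω • x k ω) with hz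
    set W : Ω → ℝ := fun ω => mixture V (fun k => x k ω) (fun k => e k ω) n with hW
    have hxn : ∀ k < n, Measurable[F n] (x k) := fun k hk => hx n k hk.le
    have hum : Measurable[F n] u :=
      @measurable_inv_quadratic Ω (F n) d x n V hxn _ _ (hx n n le_rfl) (hx n n le_rfl)
    have hSm : Measurable[F n] fun ω => ∑ k ∈ Finset.range n, e k ω • x k ω :=
      @measurable_sum_smul Ω (F n) d x e n hxn (he n)
    have hzm : Measurable[F n] z :=
      @measurable_inv_quadratic Ω (F n) d x n V hxn _ _ (hx n n le_rfl) hSm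
    have hWm : Measurable[F n] W := by
      have h1 := @measurable_inv_quadratic Ω (F n) d x n V hxn _ _ hSm hSm
      have h2 := @measurable_det Ω (F n) d _ (@measurable_ridgeGram_apply Ω (F n) d x n V hxn)
      exact (h1.div_const 2).exp.div (h2.div_const _).sqrt
    have hu0 : ∀ ω, 0 ≤ u ω := fun ω =>
      PosDef.inv_quadratic_nonneg (posDef_ridgeGram hV _ n) _
    let f : Ω → ℝ → ENNReal := fun ω y =>
      ENNReal.ofReal (W ω / Real.sqrt (1 + u ω)) * ENNReal.ofReal
        (Real.exp ((2 * z ω * y + u ω * y ^ 2 - z ω ^ 2) / (1 + u ω) / 2))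
    have hW0 : ∀ ω, 0 ≤ W ω := fun ω => mixture_nonneg _ _ _ _
    have hstep : ∀ ω, ENNReal.ofReal (mixture V (fun k => x k ω) (fun k => e k ω) (n + 1)) =
        f ω (e n ω) := fun ω => by
      rw [mixture_succ hV, ENNReal.ofReal_mul
        (div_nonneg (mixture_nonneg _ _ _ _) (Real.sqrt_nonneg _))]
    have hfm : Measurable[(F n).prod inferInstance] (Function.uncurry f) := by
      have a1 := hum.comp (@measurable_fst Ω ℝ (F n) Real.measurableSpace)
      have a2 := hzm.comp (@measurable_fst Ω ℝ (F n) Real.measurableSpace)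
      have a3 := hWm.comp (@measurable_fst Ω ℝ (F n) Real.measurableSpace)
      have a4 := @measurable_snd Ω ℝ (F n) Real.measurableSpace
      exact ((a3.div (a1.const_add 1).sqrt).ennreal_ofReal).mul
        (((((a2.const_mul 2).mul a4).add (a1.mul (a4.pow_const 2))).sub (a2.pow_const 2)).div
          (a1.const_add 1) |>.div_const 2 |>.exp |>.ennreal_ofReal)
    simp_rw [hstep]
    rw [hint f hfm]
    refine le_trans (lintegral_mono_ae ?_) (ih (Nat.le_of_succ_le hn))
    filter_upwards [hsubκ] with ω hω
    rw [lintegral_const_mul' _ _ ENNReal.ofReal_ne_top]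
    calc _ ≤ ENNReal.ofReal (W ω / Real.sqrt (1 + u ω)) *
          ENNReal.ofReal (Real.sqrt (1 + u ω)) := by
          gcongr
          exact lintegral_exp_quadratic_le hω (z ω) (hu0 ω)
      _ = ENNReal.ofReal (W ω) := by
          have h1 : 0 < Real.sqrt (1 + u ω) := Real.sqrt_pos.2 (by linarith [hu0 ω])
          rw [← ENNReal.ofReal_mul (div_nonneg (hW0 ω) h1.le), div_mul_cancel₀ _ h1.ne']

/-- The self-normalized tail bound of Abbasi-Yadkori, Pál and Szepesvári, at a fixed time. -/
theorem self_normalized_bound {V σ η : ℝ} (hV : 0 < V) (hσ : 0 < σ) (hη : 0 < η)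
    {F : ℕ → MeasurableSpace Ω}
    (hF : ∀ n, F n ≤ m0) {x : ℕ → Ω → Fin d → ℝ} {e : ℕ → Ω → ℝ}
    (hx : ∀ n, ∀ k ≤ n, Measurable[F n] (x k)) (he : ∀ n, ∀ k < n, Measurable[F n] (e k))
    (hem : ∀ k, Measurable[m0] (e k)) {n : ℕ} (hsub : ∀ k < n, CondSubGaussian (F k) μ σ (e k)) :
    μ {ω | σ ^ 2 * (2 * Real.log (1 / η) +
        Real.log ((ridgeGram V (fun k => x k ω) n).det / V ^ d)) <
      (∑ k ∈ Finset.range n, e k ω • x k ω) ⬝ᵥ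
        ((ridgeGram V (fun k => x k ω) n)⁻¹ *ᵥ ∑ k ∈ Finset.range n, e k ω • x k ω)} ≤
      ENNReal.ofReal η := by
  have hmix := lintegral_mixture_le_one hV hF hx (e := fun k ω => e k ω / σ)
    (fun n k hk => (he n k hk).div_const σ) (fun k => (hem k).div_const σ)
    (fun k hk => (hsub k hk).div_const hσ) n le_rfl
  have hxm : ∀ k < n, Measurable[m0] (x k) := fun k hk => (hx n k hk.le).mono (hF n) le_rfl
  have hWm : Measurable[m0] fun ω => mixture V (fun k => x k ω) (fun k => e k ω / σ) n := by
    have hSm : Measurable[m0] fun ω => ∑ k ∈ Finset.range n, (e k ω / σ) • x k ω :=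
      measurable_sum_smul hxm fun k _ => (hem k).div_const σ
    exact ((measurable_inv_quadratic V hxm hSm hSm).div_const 2).exp.div
      ((measurable_det (measurable_ridgeGram_apply V hxm)).div_const _).sqrt
  have hη' : ENNReal.ofReal (1 / η) ≠ 0 := by
    simpa using hη
  calc _ ≤ μ {ω | ENNReal.ofReal (1 / η) ≤
        ENNReal.ofReal (mixture V (fun k => x k ω) (fun k => e k ω / σ) n)} := by
        refine measure_mono fun ω hω => ENNReal.ofReal_le_ofReal ?_
        have hA := posDef_ridgeGram hV (fun k => x k ω) n
        have hD : 0 < (ridgeGram V (fun k => x k ω) n).det / V ^ d :=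
          div_pos hA.det_pos (by positivity)
        rw [Set.mem_ofPred_eq] at hω
        have hS : ∑ k ∈ Finset.range n, (e k ω / σ) • x k ω
            = σ⁻¹ • ∑ k ∈ Finset.range n, e k ω • x k ω := by
          rw [Finset.smul_sum]
          refine Finset.sum_congr rfl fun k _ => ?_
          rw [smul_smul, div_eq_inv_mul]
        rw [mixture, hS, mulVec_smul, smul_dotProduct, dotProduct_smul, smul_eq_mul, smul_eq_mul,
          le_div_iff₀ (Real.sqrt_pos.2 hD), ← Real.log_le_log_iff (by positivity) (by positivity),
          Real.log_exp, Real.log_mul (by positivity) (Real.sqrt_pos.2 hD).ne',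
          Real.log_sqrt hD.le]
        rw [← lt_div_iff₀' (by positivity)] at hω
        have h1 : ∀ q : ℝ, σ⁻¹ * (σ⁻¹ * q) = q / σ ^ 2 := fun q => by field_simp
        rw [h1]
        linarith
    _ ≤ (∫⁻ ω, ENNReal.ofReal (mixture V (fun k => x k ω) (fun k => e k ω / σ) n) ∂μ) /
          ENNReal.ofReal (1 / η) :=
        meas_ge_le_lintegral_div hWm.ennreal_ofReal.aemeasurable hη' ENNReal.ofReal_ne_top
    _ ≤ 1 / ENNReal.ofReal (1 / η) := by gcongr
    _ = ENNReal.ofReal η := by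
        rw [one_div η, ENNReal.ofReal_inv_of_pos hη, one_div, inv_inv]

end SelfNormalized

/-! ### A dimension-free Hoeffding inequality for vector martingales -/

theorem convexOn_cosh_sqrt : ConvexOn ℝ (Set.Ici 0) fun s => Real.cosh (Real.sqrt s) := by
  have hsum : ∀ s : ℝ, 0 ≤ s →
      HasSum (fun n : ℕ => s ^ n / ((2 * n).factorial : ℝ)) (Real.cosh (Real.sqrt s)) :=
    fun s hs => by simpa [pow_mul, Real.sq_sqrt hs] using Real.hasSum_cosh (Real.sqrt s)
  refine ⟨convex_Ici 0, fun s hs t ht a b ha hb hab => ?_⟩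
  rw [Set.mem_Ici] at hs ht
  have hst : 0 ≤ a • s + b • t := by rw [smul_eq_mul, smul_eq_mul]; positivity
  refine hasSum_le (fun n => ?_) (hsum _ hst)
    (((hsum s hs).mul_left a).add ((hsum t ht).mul_left b))
  have h := (convexOn_pow n).2 (Set.mem_Ici.2 hs) (Set.mem_Ici.2 ht) ha hb hab
  simp only [smul_eq_mul] at h ⊢
  rw [← mul_div_assoc, ← mul_div_assoc, ← add_div]
  gcongr

theorem sq_dotProduct_le_mul {d : ℕ} (v w : Fin d → ℝ) :
    (v ⬝ᵥ w) ^ 2 ≤ (v ⬝ᵥ v) * (w ⬝ᵥ w) := by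
  simpa [dotProduct, sq] using Finset.sum_mul_sq_le_sq_mul_sq Finset.univ v w

/-- The chord of the convex function `s ↦ cosh √s` over `[(r - b)², (r + b)²]`, where `r = ‖x‖`,
bounds `cosh ‖x + y‖` by an affine function of `y`. -/
theorem cosh_norm_add_le {d : ℕ} (x y : Fin d → ℝ) {b : ℝ} (hb : 0 < b) (hy : y ⬝ᵥ y ≤ b ^ 2) :
    Real.cosh (Real.sqrt ((x + y) ⬝ᵥ (x + y))) ≤
      Real.cosh (Real.sqrt (x ⬝ᵥ x)) * Real.cosh b +
        (x ⬝ᵥ y) * (Real.sinh (Real.sqrt (x ⬝ᵥ x)) / Real.sqrt (x ⬝ᵥ x) * (Real.sinh b / b)) := by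
  have hx0 := zero_le_dotProduct_self x
  have hcs := sq_dotProduct_le_mul x y
  set r := Real.sqrt (x ⬝ᵥ x) with hr
  have hr0 : 0 ≤ r := Real.sqrt_nonneg _
  have hr2 : x ⬝ᵥ x = r ^ 2 := (Real.sq_sqrt hx0).symm
  set w := x ⬝ᵥ y with hw
  have hwr : |w| ≤ r * b := by
    refine abs_le_of_sq_le_sq ?_ (by positivity)
    rw [hr2] at hcs
    nlinarith [sq_nonneg r]
  have hexp : (x + y) ⬝ᵥ (x + y) ≤ r ^ 2 + b ^ 2 + 2 * w := by
    simp only [dotProduct_add, add_dotProduct, dotProduct_comm y x, ← hw, hr2]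
    linarith
  refine (Real.cosh_le_cosh.2 ?_ : _ ≤ Real.cosh (Real.sqrt (r ^ 2 + b ^ 2 + 2 * w))).trans ?_
  · rw [abs_of_nonneg (Real.sqrt_nonneg _), abs_of_nonneg (Real.sqrt_nonneg _)]
    exact Real.sqrt_le_sqrt hexp
  rcases hr0.eq_or_lt with h0 | hr0
  · rw [← h0, zero_mul, abs_nonpos_iff] at hwr
    simp [← h0, hwr, Real.sqrt_sq hb.le]
  · obtain ⟨h1, h2⟩ := abs_le.1 hwr
    have hrb : 0 < r * b := by positivity
    have h := convexOn_cosh_sqrt.2 (Set.mem_Ici.2 (sq_nonneg (r + b)))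
      (Set.mem_Ici.2 (sq_nonneg (r - b)))
      (show 0 ≤ (1 + w / (r * b)) / 2 by
        have : -1 ≤ w / (r * b) := by rw [le_div_iff₀ hrb]; linarith
        linarith)
      (show 0 ≤ (1 - w / (r * b)) / 2 by
        have : w / (r * b) ≤ 1 := by rw [div_le_iff₀ hrb]; linarith
        linarith) (by ring)
    simp only [smul_eq_mul, Real.sqrt_sq_eq_abs, Real.cosh_abs, Real.cosh_add,
      Real.cosh_sub] at h
    have e1 : (1 + w / (r * b)) / 2 * (r + b) ^ 2 + (1 - w / (r * b)) / 2 * (r - b) ^ 2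
        = r ^ 2 + b ^ 2 + 2 * w := by
      field_simp
      ring
    rw [e1] at h
    refine h.trans (le_of_eq ?_)
    field_simp
    ring

section VectorMartingale

variable {Ω : Type*} {m0 : MeasurableSpace Ω} {μ : Measure Ω} [IsProbabilityMeasure μ] {d : ℕ}

theorem integral_mul_eq_zero_of_condExp {m : MeasurableSpace Ω} (hm : m ≤ m0) {h Y : Ω → ℝ}
    (hh : Measurable[m] h) {R : ℝ} (hR : ∀ᵐ ω ∂μ, |h ω| ≤ R) (hY : Integrable Y μ)
    (h0 : μ[Y | m] =ᵐ[μ] 0) : Integrable (fun ω => h ω * Y ω) μ ∧ ∫ ω, h ω * Y ω ∂μ = 0 := by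
  have hint : Integrable (fun ω => h ω * Y ω) μ :=
    hY.bdd_mul (hh.mono hm le_rfl).aestronglyMeasurable hR
  refine ⟨hint, ?_⟩
  have h1 : μ[h * Y | m] =ᵐ[μ] h * μ[Y | m] :=
    condExp_mul_of_stronglyMeasurable_left hh.stronglyMeasurable hint hY
  calc ∫ ω, h ω * Y ω ∂μ = ∫ ω, (μ[h * Y | m]) ω ∂μ := (integral_condExp hm).symm
    _ = ∫ ω, (0 : ℝ) ∂μ := by
        refine integral_congr_ae ?_
        filter_upwards [h1, h0] with ω h2 h3
        simp [h2, h3]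
    _ = 0 := by simp

theorem integral_cosh_norm_le {G : ℕ → MeasurableSpace Ω} (hG : ∀ n, G n ≤ m0)
    {Y : ℕ → Ω → Fin d → ℝ} (hYm : ∀ k, Measurable[m0] (Y k))
    (hY : ∀ n, ∀ k < n, Measurable[G n] (Y k))
    {b : ℝ} (hb : 0 < b) {N : ℕ} (hbd : ∀ k < N, ∀ᵐ ω ∂μ, Y k ω ⬝ᵥ Y k ω ≤ b ^ 2)
    (h0 : ∀ k < N, ∀ i, μ[fun ω => Y k ω i | G k] =ᵐ[μ] 0) :
    ∀ n ≤ N,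
      Integrable (fun ω => Real.cosh (Real.sqrt ((∑ k ∈ Finset.range n, Y k ω) ⬝ᵥ
        ∑ k ∈ Finset.range n, Y k ω))) μ ∧
      ∫ ω, Real.cosh (Real.sqrt ((∑ k ∈ Finset.range n, Y k ω) ⬝ᵥ
        ∑ k ∈ Finset.range n, Y k ω)) ∂μ ≤ Real.cosh b ^ n := by
  have hbd' : ∀ᵐ ω ∂μ, ∀ k < N, Y k ω ⬝ᵥ Y k ω ≤ b ^ 2 := by
    rw [ae_all_iff]
    intro k
    by_cases hk : k < N
    · filter_upwards [hbd k hk] with ω hω _ using hω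
    · exact Filter.Eventually.of_forall fun ω h => absurd h hk
  have hcoord : ∀ v : Fin d → ℝ, ∀ i, v i ^ 2 ≤ v ⬝ᵥ v := fun v i => by
    rw [sq]
    exact Finset.single_le_sum (f := fun i => v i * v i) (fun j _ => mul_self_nonneg (v j))
      (Finset.mem_univ i)
  have hYi : ∀ᵐ ω ∂μ, ∀ k < N, ∀ i, |Y k ω i| ≤ b := by
    filter_upwards [hbd'] with ω hω k hk i
    exact abs_le_of_sq_le_sq ((hcoord _ i).trans (hω k hk)) hb.le
  have hS : ∀ n ≤ N, ∀ᵐ ω ∂μ, Real.sqrt ((∑ k ∈ Finset.range n, Y k ω) ⬝ᵥ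
      ∑ k ∈ Finset.range n, Y k ω) ≤ Real.sqrt (d * (n * b) ^ 2) := by
    intro n hn
    filter_upwards [hYi] with ω hω
    refine Real.sqrt_le_sqrt ?_
    calc _ ≤ ∑ _i : Fin d, (n * b) ^ 2 := by
          refine Finset.sum_le_sum fun i _ => ?_
          rw [← sq, Finset.sum_apply]
          refine sq_le_sq' ?_ ?_
          · refine neg_le_of_abs_le ((Finset.abs_sum_le_sum_abs _ _).trans ?_)
            refine (Finset.sum_le_sum fun k hk =>
              hω k ((Finset.mem_range.1 hk).trans_le hn) i).trans ?_
            simp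
          · refine le_of_abs_le ((Finset.abs_sum_le_sum_abs _ _).trans ?_)
            refine (Finset.sum_le_sum fun k hk =>
              hω k ((Finset.mem_range.1 hk).trans_le hn) i).trans ?_
            simp
      _ = _ := by simp
  have hSm : ∀ n, Measurable[m0] fun ω => ∑ k ∈ Finset.range n, Y k ω := fun n =>
    Finset.measurable_sum _ fun k _ => hYm k
  have hint : ∀ n ≤ N, Integrable (fun ω => Real.cosh (Real.sqrt
      ((∑ k ∈ Finset.range n, Y k ω) ⬝ᵥ ∑ k ∈ Finset.range n, Y k ω))) μ := fun n hn => by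
    refine Integrable.of_bound (C := Real.cosh (Real.sqrt (d * (n * b) ^ 2))) ?_ ?_
    · exact (Real.measurable_cosh.comp
        (measurable_dotProduct (hSm n) (hSm n)).sqrt).aestronglyMeasurable
    · filter_upwards [hS n hn] with ω hω
      rw [Real.norm_eq_abs, abs_of_pos (Real.cosh_pos _), Real.cosh_le_cosh,
        abs_of_nonneg (Real.sqrt_nonneg _), abs_of_nonneg (Real.sqrt_nonneg _)]
      exact hω
  intro n
  induction n with
  | zero => intro _; simp
  | succ n ih =>
    intro hn
    have hn' : n < N := Nat.lt_of_succ_le hn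
    refine ⟨hint _ hn, ?_⟩
    set S : Ω → Fin d → ℝ := fun ω => ∑ k ∈ Finset.range n, Y k ω with hSdef
    set c : Ω → ℝ := fun ω => Real.sinh (Real.sqrt (S ω ⬝ᵥ S ω)) / Real.sqrt (S ω ⬝ᵥ S ω) *
      (Real.sinh b / b) with hc
    have hSG : Measurable[G n] S :=
      @Finset.measurable_sum _ _ _ _ _ _ (G n) _ _ fun k hk => hY n k (Finset.mem_range.1 hk)
    have hcG : Measurable[G n] c := by
      have h1 := (@measurable_dotProduct Ω (G n) d _ _ hSG hSG).sqrt
      exact ((Real.measurable_sinh.comp h1).div h1).mul_const _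
    have hterm : ∀ i, Integrable (fun ω => (c ω * S ω i) * Y n ω i) μ ∧
        ∫ ω, (c ω * S ω i) * Y n ω i ∂μ = 0 := fun i => by
      refine integral_mul_eq_zero_of_condExp (hG n)
        (hcG.mul ((measurable_pi_apply i).comp hSG))
        (R := Real.sinh (Real.sqrt (d * (n * b) ^ 2)) * (Real.sinh b / b)) ?_ ?_ (h0 n hn' i)
      · filter_upwards [hS n hn'.le] with ω hω
        have hs : 0 ≤ Real.sinh b / b := div_nonneg (Real.sinh_nonneg_iff.2 hb.le) hb.le
        set r := Real.sqrt (S ω ⬝ᵥ S ω) with hr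
        have hr0 : 0 ≤ r := Real.sqrt_nonneg _
        have hSi : |S ω i| ≤ r := Real.abs_le_sqrt (hcoord _ i)
        have hsr : 0 ≤ Real.sinh r := Real.sinh_nonneg_iff.2 hr0
        rw [hc, abs_mul, abs_mul, abs_of_nonneg hs, abs_of_nonneg (div_nonneg hsr hr0),
          mul_right_comm]
        gcongr
        refine le_trans ?_ (Real.sinh_le_sinh.2 hω)
        rcases hr0.eq_or_lt with h | h
        · simp [← h]
        · rw [div_mul_eq_mul_div, div_le_iff₀ h]
          gcongr
      · refine Integrable.of_bound (C := b)
          ((measurable_pi_apply i).comp (hYm n)).aestronglyMeasurable ?_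
        filter_upwards [hYi] with ω hω
        exact hω n hn' i
    have hlin : ∀ ω, (S ω ⬝ᵥ Y n ω) * c ω = ∑ i, (c ω * S ω i) * Y n ω i := fun ω => by
      rw [dotProduct, Finset.sum_mul]
      exact Finset.sum_congr rfl fun i _ => by ring
    have hlint : Integrable (fun ω => (S ω ⬝ᵥ Y n ω) * c ω) μ := by
      simp_rw [hlin]
      exact integrable_finsetSum _ fun i _ => (hterm i).1
    have hlin0 : ∫ ω, (S ω ⬝ᵥ Y n ω) * c ω ∂μ = 0 := by
      simp_rw [hlin]
      rw [integral_finsetSum _ fun i _ => (hterm i).1]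
      exact Finset.sum_eq_zero fun i _ => (hterm i).2
    calc _ ≤ ∫ ω, (Real.cosh (Real.sqrt (S ω ⬝ᵥ S ω)) * Real.cosh b
            + (S ω ⬝ᵥ Y n ω) * c ω) ∂μ := by
          refine integral_mono_ae (hint _ hn) (((hint n hn'.le).mul_const _).add hlint) ?_
          filter_upwards [hbd'] with ω hω
          simp only [Finset.sum_range_succ]
          exact cosh_norm_add_le _ _ hb (hω n hn')
      _ = (∫ ω, Real.cosh (Real.sqrt (S ω ⬝ᵥ S ω)) ∂μ) * Real.cosh b := by
          rw [integral_add ((hint n hn'.le).mul_const _) hlint, hlin0, add_zero,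
            integral_mul_const]
      _ ≤ Real.cosh b ^ (n + 1) := by
          rw [pow_succ]
          exact mul_le_mul_of_nonneg_right (ih hn'.le).2 (Real.cosh_pos _).le

/-- Hoeffding's inequality for vector martingales with increments bounded by `b`. Following
Pinelis, `cosh (l ‖S_n‖)` grows in mean at most by the factor `cosh (l b)` per step, so that no
dimension enters. -/
theorem vector_hoeffding {G : ℕ → MeasurableSpace Ω} (hG : ∀ n, G n ≤ m0)
    {Y : ℕ → Ω → Fin d → ℝ} (hYm : ∀ k, Measurable[m0] (Y k))
    (hY : ∀ n, ∀ k < n, Measurable[G n] (Y k))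
    {b : ℝ} (hb : 0 < b) {n : ℕ} (hn : 0 < n) (hbd : ∀ k < n, ∀ᵐ ω ∂μ, Y k ω ⬝ᵥ Y k ω ≤ b ^ 2)
    (h0 : ∀ k < n, ∀ i, μ[fun ω => Y k ω i | G k] =ᵐ[μ] 0) {u : ℝ} (hu : 0 < u) :
    μ {ω | u < Real.sqrt ((∑ k ∈ Finset.range n, Y k ω) ⬝ᵥ ∑ k ∈ Finset.range n, Y k ω)} ≤
      ENNReal.ofReal (2 * Real.exp (-(u ^ 2 / (2 * (n * b ^ 2))))) := by
  have hn' : (0 : ℝ) < n := by exact_mod_cast hn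
  -- the exponent `n l² b² / 2 - l u` is minimal at this `l`
  set l : ℝ := u / (n * b ^ 2) with hl
  have hl0 : 0 < l := by positivity
  obtain ⟨hint, hle⟩ := integral_cosh_norm_le (μ := μ) hG (Y := fun k ω => l • Y k ω)
    (fun k => (hYm k).const_smul l) (fun n k hk => (hY n k hk).const_smul l)
    (b := l * b) (by positivity) (N := n)
    (fun k hk => by
      filter_upwards [hbd k hk] with ω hω
      rw [smul_dotProduct, dotProduct_smul, smul_eq_mul, smul_eq_mul]
      nlinarith [mul_le_mul_of_nonneg_left hω (sq_nonneg l)])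
    (fun k hk i => by
      have h1 := condExp_smul (μ := μ) l (fun ω => Y k ω i) (G k)
      have h2 : (fun ω => (l • Y k ω) i) = l • fun ω => Y k ω i := by ext ω; simp
      rw [h2]
      filter_upwards [h1, h0 k hk i] with ω h3 h4
      simp [h3, h4]) n le_rfl
  have hnorm : ∀ ω, Real.sqrt ((∑ k ∈ Finset.range n, l • Y k ω) ⬝ᵥ
      ∑ k ∈ Finset.range n, l • Y k ω) =
      l * Real.sqrt ((∑ k ∈ Finset.range n, Y k ω) ⬝ᵥ ∑ k ∈ Finset.range n, Y k ω) := fun ω => by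
    rw [← Finset.smul_sum, smul_dotProduct, dotProduct_smul, smul_eq_mul, smul_eq_mul,
      ← mul_assoc, ← sq, Real.sqrt_mul (sq_nonneg l), Real.sqrt_sq hl0.le]
  simp_rw [hnorm] at hint hle
  have hpos : 0 < Real.exp (l * u) / 2 := by positivity
  calc _ ≤ μ {ω | ENNReal.ofReal (Real.exp (l * u) / 2) ≤ ENNReal.ofReal (Real.cosh (l *
        Real.sqrt ((∑ k ∈ Finset.range n, Y k ω) ⬝ᵥ ∑ k ∈ Finset.range n, Y k ω)))} := by
        refine measure_mono fun ω hω => ENNReal.ofReal_le_ofReal ?_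
        rw [Set.mem_ofPred_eq] at hω
        have h1 : Real.exp (l * u) ≤ Real.exp (l * Real.sqrt ((∑ k ∈ Finset.range n, Y k ω) ⬝ᵥ
            ∑ k ∈ Finset.range n, Y k ω)) := by gcongr
        rw [Real.cosh_eq]
        have h2 := Real.exp_pos (-(l * Real.sqrt ((∑ k ∈ Finset.range n, Y k ω) ⬝ᵥ
            ∑ k ∈ Finset.range n, Y k ω)))
        linarith
    _ ≤ (∫⁻ ω, ENNReal.ofReal (Real.cosh (l * Real.sqrt ((∑ k ∈ Finset.range n, Y k ω) ⬝ᵥ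
          ∑ k ∈ Finset.range n, Y k ω))) ∂μ) / ENNReal.ofReal (Real.exp (l * u) / 2) :=
        meas_ge_le_lintegral_div hint.1.aemeasurable.ennreal_ofReal
          (by simpa using Real.exp_pos _) ENNReal.ofReal_ne_top
    _ ≤ ENNReal.ofReal (Real.cosh (l * b) ^ n) / ENNReal.ofReal (Real.exp (l * u) / 2) := by
        rw [← ofReal_integral_eq_lintegral_ofReal hint
          (Filter.Eventually.of_forall fun _ => (Real.cosh_pos _).le)]
        gcongr
    _ = ENNReal.ofReal (Real.cosh (l * b) ^ n / (Real.exp (l * u) / 2)) :=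
        (ENNReal.ofReal_div_of_pos hpos).symm
    _ ≤ _ := by
        refine ENNReal.ofReal_le_ofReal ?_
        rw [div_le_iff₀ hpos]
        calc Real.cosh (l * b) ^ n ≤ Real.exp ((l * b) ^ 2 / 2) ^ n := by
              gcongr
              exact Real.cosh_le_exp_half_sq _
          _ = Real.exp (-(u ^ 2 / (2 * (n * b ^ 2))) + l * u) := by
              rw [← Real.exp_nat_mul]
              congr 1
              rw [hl]
              field_simp
              ring
          _ = _ := by
              rw [Real.exp_add]
              ring

end VectorMartingale

/-! ### Least squares errors -/

section Deterministic

variable {d : ℕ}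

theorem sqrt_le_of_le_mul_sqrt {a c : ℝ} (ha : 0 ≤ a) (hc : 0 ≤ c) (h : a ≤ Real.sqrt a * c) :
    Real.sqrt a ≤ c := by
  rcases (Real.sqrt_nonneg a).eq_or_lt with h0 | h0
  · rw [← h0]; exact hc
  · refine le_of_mul_le_mul_left ?_ h0
    rwa [Real.mul_self_sqrt ha]

theorem le_sqrt_mul_of_sq_le {y a c : ℝ} (ha : 0 ≤ a) (hc : 0 ≤ c) (h : y ^ 2 ≤ a * c ^ 2) :
    y ≤ Real.sqrt a * c := by
  refine le_of_abs_le (abs_le_of_sq_le_sq ?_ (by positivity))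
  rwa [mul_pow, Real.sq_sqrt ha]

/-- Error of a least squares estimate without regularization. The Gram matrix `A` dominates
`κ • 1`, so that the norm of the noise term `s₁` may be taken with respect to
`(A + κ • 1)⁻¹ ≥ A⁻¹ / 2`. -/
theorem least_squares_error {κ : ℝ} (hκ : 0 < κ) {x : ℕ → Fin d → ℝ} {n : ℕ}
    (hx : ∀ v : Fin d → ℝ, κ * (v ⬝ᵥ v) ≤ v ⬝ᵥ (ridgeGram 0 x n *ᵥ v))
    {w s₁ s₂ : Fin d → ℝ} (hw : ridgeGram 0 x n *ᵥ w = s₁ + s₂) {q u : ℝ} (hq : 0 ≤ q) (hu : 0 ≤ u)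
    (h₁ : s₁ ⬝ᵥ ((ridgeGram κ x n)⁻¹ *ᵥ s₁) ≤ q) (h₂ : s₂ ⬝ᵥ s₂ ≤ u ^ 2) :
    Real.sqrt (w ⬝ᵥ (ridgeGram 0 x n *ᵥ w)) ≤ Real.sqrt (2 * q) + u / Real.sqrt κ := by
  set a := w ⬝ᵥ (ridgeGram 0 x n *ᵥ w) with ha
  have hww := zero_le_dotProduct_self w
  have hwa : κ * (w ⬝ᵥ w) ≤ a := hx w
  have ha0 : 0 ≤ a := le_trans (by positivity) hwa
  have e1 : w ⬝ᵥ (ridgeGram κ x n *ᵥ w) = κ * (w ⬝ᵥ w) + a := by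
    rw [ha, dotProduct_ridgeGram_mulVec, dotProduct_ridgeGram_mulVec]
    ring
  have hsplit : a = w ⬝ᵥ s₁ + w ⬝ᵥ s₂ := by rw [ha, hw, dotProduct_add]
  have b1 : w ⬝ᵥ s₁ ≤ Real.sqrt a * Real.sqrt (2 * q) := by
    refine le_sqrt_mul_of_sq_le ha0 (Real.sqrt_nonneg _) ?_
    rw [Real.sq_sqrt (by positivity)]
    refine (PosDef.sq_dotProduct_le (posDef_ridgeGram hκ x n) w s₁).trans ?_
    rw [e1]
    calc _ ≤ (2 * a) * q := by
          refine mul_le_mul (by linarith) h₁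
            (PosDef.inv_quadratic_nonneg (posDef_ridgeGram hκ x n) _) (by positivity)
      _ = _ := by ring
  have b2 : w ⬝ᵥ s₂ ≤ Real.sqrt a * (u / Real.sqrt κ) := by
    refine le_sqrt_mul_of_sq_le ha0 (by positivity) ?_
    rw [div_pow, Real.sq_sqrt hκ.le]
    refine (sq_dotProduct_le_mul w s₂).trans ?_
    calc _ ≤ (a / κ) * u ^ 2 := by
          refine mul_le_mul ?_ h₂ (zero_le_dotProduct_self _) (by positivity)
          rw [le_div_iff₀ hκ]; linarith
      _ = _ := by ring
  refine sqrt_le_of_le_mul_sqrt ha0 (by positivity) ?_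
  calc a = w ⬝ᵥ s₁ + w ⬝ᵥ s₂ := hsplit
    _ ≤ _ := by rw [mul_add]; exact add_le_add b1 b2

/-- Error of a ridge estimate of `δ` from responses that are off by `e k`. No assumption is made on
the errors `e k` apart from their size. -/
theorem ridge_error {V : ℝ} (hV : 0 < V) {x : ℕ → Fin d → ℝ} {n : ℕ} {w s δ : Fin d → ℝ}
    {e : ℕ → ℝ} (hw : ridgeGram V x n *ᵥ w = s - V • δ + ∑ k ∈ Finset.range n, e k • x k)
    {q M E : ℝ} (hq : 0 ≤ q) (hM : 0 ≤ M) (hE : 0 ≤ E)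
    (h₁ : s ⬝ᵥ ((ridgeGram V x n)⁻¹ *ᵥ s) ≤ q) (h₂ : δ ⬝ᵥ δ ≤ M ^ 2)
    (h₃ : ∑ k ∈ Finset.range n, e k ^ 2 ≤ E ^ 2) :
    Real.sqrt (w ⬝ᵥ (ridgeGram V x n *ᵥ w)) ≤ Real.sqrt q + Real.sqrt V * M + E := by
  set a := w ⬝ᵥ (ridgeGram V x n *ᵥ w) with ha
  have hform : a = V * (w ⬝ᵥ w) + ∑ k ∈ Finset.range n, (x k ⬝ᵥ w) ^ 2 :=
    dotProduct_ridgeGram_mulVec V x n w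
  have hww := zero_le_dotProduct_self w
  have hxx : 0 ≤ ∑ k ∈ Finset.range n, (x k ⬝ᵥ w) ^ 2 := Finset.sum_nonneg fun _ _ => sq_nonneg _
  have ha0 : 0 ≤ a := by rw [hform]; positivity
  have hsplit : a = w ⬝ᵥ s + V * (w ⬝ᵥ -δ) + ∑ k ∈ Finset.range n, e k * (x k ⬝ᵥ w) := by
    rw [ha, hw, dotProduct_add, dotProduct_sub, dotProduct_smul, dotProduct_sum, dotProduct_neg,
      smul_eq_mul, mul_neg, ← sub_eq_add_neg]
    congr 1
    refine Finset.sum_congr rfl fun k _ => ?_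
    rw [dotProduct_smul, smul_eq_mul, dotProduct_comm w]
  have b1 : w ⬝ᵥ s ≤ Real.sqrt a * Real.sqrt q := by
    refine le_sqrt_mul_of_sq_le ha0 (Real.sqrt_nonneg _) ?_
    rw [Real.sq_sqrt hq]
    refine (PosDef.sq_dotProduct_le (posDef_ridgeGram hV x n) w s).trans ?_
    rw [← ha]
    gcongr
  have b2 : V * (w ⬝ᵥ -δ) ≤ Real.sqrt a * (Real.sqrt V * M) := by
    refine le_sqrt_mul_of_sq_le ha0 (by positivity) ?_
    have h0 := sq_dotProduct_le_mul w (-δ)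
    rw [neg_dotProduct_neg] at h0
    rw [mul_pow, mul_pow, Real.sq_sqrt hV.le]
    calc V ^ 2 * (w ⬝ᵥ -δ) ^ 2 ≤ V ^ 2 * ((w ⬝ᵥ w) * M ^ 2) := by
          gcongr
          exact h0.trans (by gcongr)
      _ = (V * (w ⬝ᵥ w)) * (V * M ^ 2) := by ring
      _ ≤ a * (V * M ^ 2) := by
          gcongr
          linarith
  have b3 : ∑ k ∈ Finset.range n, e k * (x k ⬝ᵥ w) ≤ Real.sqrt a * E := by
    refine le_sqrt_mul_of_sq_le ha0 hE ?_
    refine (Finset.sum_mul_sq_le_sq_mul_sq _ _ _).trans ?_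
    rw [mul_comm]
    gcongr
    rw [hform]
    have : 0 ≤ V * (w ⬝ᵥ w) := by positivity
    linarith
  refine sqrt_le_of_le_mul_sqrt ha0 (by positivity) ?_
  rw [mul_add, mul_add]
  linarith

variable {p : ℕ}

theorem transpose_mulVec_dotProduct (U : Matrix (Fin p) (Fin d) ℝ) (v : Fin p → ℝ)
    (w : Fin d → ℝ) : (Uᵀ *ᵥ v) ⬝ᵥ w = v ⬝ᵥ (U *ᵥ w) := by
  rw [mulVec_transpose, ← dotProduct_mulVec]

theorem dotProduct_self_transpose_mulVec_le {U : Matrix (Fin p) (Fin d) ℝ} (hU : Uᵀ * U = 1)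
    (v : Fin p → ℝ) : (Uᵀ *ᵥ v) ⬝ᵥ (Uᵀ *ᵥ v) ≤ v ⬝ᵥ v := by
  have h0 := zero_le_dotProduct_self (v - U *ᵥ (Uᵀ *ᵥ v))
  have h1 : (U *ᵥ (Uᵀ *ᵥ v)) ⬝ᵥ (U *ᵥ (Uᵀ *ᵥ v)) = (Uᵀ *ᵥ v) ⬝ᵥ (Uᵀ *ᵥ v) := by
    rw [← transpose_mulVec_dotProduct, mulVec_mulVec, hU, one_mulVec]
  have h2 : v ⬝ᵥ (U *ᵥ (Uᵀ *ᵥ v)) = (Uᵀ *ᵥ v) ⬝ᵥ (Uᵀ *ᵥ v) := by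
    rw [← transpose_mulVec_dotProduct]
  simp only [dotProduct_sub, sub_dotProduct, h1, h2, dotProduct_comm (U *ᵥ (Uᵀ *ᵥ v)) v] at h0
  linarith

theorem mulVec_dotProduct_mulVec {U : Matrix (Fin p) (Fin d) ℝ} (hU : Uᵀ * U = 1)
    (v : Fin d → ℝ) : (U *ᵥ v) ⬝ᵥ (U *ᵥ v) = v ⬝ᵥ v := by
  rw [← transpose_mulVec_dotProduct, mulVec_mulVec, hU, one_mulVec]

theorem transpose_mul_vecMulVec_mul (U : Matrix (Fin p) (Fin d) ℝ) (v : Fin p → ℝ) :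
    Uᵀ * vecMulVec v v * U = vecMulVec (Uᵀ *ᵥ v) (Uᵀ *ᵥ v) := by
  rw [mul_vecMulVec, vecMulVec_mul, mulVec_transpose]

theorem matNorm_sq {A : Matrix (Fin p) (Fin p) ℝ} {v : Fin p → ℝ} (h : 0 ≤ v ⬝ᵥ (A *ᵥ v)) :
    matNorm A v ^ 2 = v ⬝ᵥ (A *ᵥ v) := Real.sq_sqrt h

theorem mulVec_quadratic (U : Matrix (Fin p) (Fin d) ℝ) (A : Matrix (Fin p) (Fin p) ℝ)
    (w : Fin d → ℝ) : (U *ᵥ w) ⬝ᵥ (A *ᵥ (U *ᵥ w)) = w ⬝ᵥ ((Uᵀ * A * U) *ᵥ w) := by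
  rw [dotProduct_comm (U *ᵥ w), ← transpose_mulVec_dotProduct, dotProduct_comm, mulVec_mulVec,
    mulVec_mulVec, Matrix.mul_assoc]

theorem dotProduct_self_le_of_l2norm_le {v : Fin p → ℝ} {b : ℝ} (h : l2norm v ≤ b) :
    v ⬝ᵥ v ≤ b ^ 2 := by
  rw [← Real.sq_sqrt (zero_le_dotProduct_self v)]
  exact pow_le_pow_left₀ (Real.sqrt_nonneg _) h 2

theorem sum_Icc_eq_sum_range {E : Type*} [AddCommMonoid E] (f : ℤ → E) (s : ℤ) (n : ℕ) {t : ℤ}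
    (ht : t = s + n - 1) : ∑ τ ∈ Finset.Icc s t, f τ = ∑ k ∈ Finset.range n, f (s + k) := by
  subst ht
  symm
  refine Finset.sum_bij (fun k _ => s + (k : ℤ)) ?_ ?_ ?_ ?_
  · intro k hk
    have := Finset.mem_range.1 hk
    rw [Finset.mem_Icc]
    omega
  · intro a _ b _ h
    omega
  · intro t ht
    rw [Finset.mem_Icc] at ht
    exact ⟨(t - s).toNat, by rw [Finset.mem_range]; omega, by omega⟩
  · intro _ _; rfl

end Deterministic

/-! ### Played features and the information of a round -/

section Bandit

variable {Ω : Type*} {𝒳 : Type*} [m0 : MeasurableSpace Ω] [MeasurableSpace 𝒳] {p K : ℕ}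

namespace LinearBandit

variable (B : LinearBandit Ω 𝒳 p K)

/-- The coordinates of the played feature of round `s + k` with respect to the columns of `U`. -/
def coordFeat {q : ℕ} (U : Matrix (Fin p) (Fin q) ℝ) (s : ℤ) (k : ℕ) (ω : Ω) : Fin q → ℝ :=
  Uᵀ *ᵥ B.feat (s + k) ω

theorem measurable_feat (t : ℤ) : Measurable (B.feat t) := by
  have h : Measurable fun y : 𝒳 × Fin K => B.φ y.1 y.2 :=
    measurable_from_prod_countable_left fun i => B.measurable_φ i
  exact h.comp ((B.measurable_X t).prodMk (B.measurable_a t))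

theorem measurable_obs (t : ℤ) : Measurable (B.obs t) :=
  (measurable_dotProduct (B.measurable_feat t) measurable_const).add (B.measurable_ε t)

theorem history_le (s t : ℤ) : B.history s t ≤ m0 :=
  sup_le (iSup₂_le fun τ _ => ((B.measurable_feat τ).prodMk (B.measurable_obs τ)).comap_le)
    (B.measurable_feat t).comap_le

theorem pastFeatures_le (s t : ℤ) : B.pastFeatures s t ≤ m0 :=
  iSup₂_le fun τ _ => (B.measurable_feat τ).comap_le

theorem measurable_feat_pastFeatures (s : ℤ) {n k : ℕ} (hk : k < n) :
    Measurable[B.pastFeatures s (s + n)] (B.feat (s + k)) := by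
  refine Measurable.mono (comap_measurable _) ?_ le_rfl
  exact le_iSup₂_of_le (f := fun τ (_ : τ ∈ Finset.Icc s (s + (n : ℤ) - 1)) =>
    MeasurableSpace.comap (B.feat τ) inferInstance) (s + k)
    (Finset.mem_Icc.2 ⟨by omega, by omega⟩) le_rfl

theorem measurable_pair_history (s : ℤ) {n k : ℕ} (hk : k < n) :
    Measurable[B.history s (s + n)] (fun ω => (B.feat (s + k) ω, B.obs (s + k) ω)) := by
  refine Measurable.mono (comap_measurable _) ?_ le_rfl
  exact le_sup_of_le_left (le_iSup₂_of_le (f := fun τ (_ : τ ∈ Finset.Icc s (s + (n : ℤ) - 1)) =>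
    MeasurableSpace.comap (fun ω => (B.feat τ ω, B.obs τ ω)) inferInstance) (s + k)
    (Finset.mem_Icc.2 ⟨by omega, by omega⟩) le_rfl)

theorem measurable_feat_history (s : ℤ) {n k : ℕ} (hk : k ≤ n) :
    Measurable[B.history s (s + n)] (B.feat (s + k)) := by
  rcases hk.eq_or_lt with rfl | hk
  · exact Measurable.mono (comap_measurable _) le_sup_right le_rfl
  · exact measurable_fst.comp (B.measurable_pair_history s hk)

theorem measurable_noise_history (s : ℤ) {n k : ℕ} (hk : k < n) :
    Measurable[B.history s (s + n)] (B.ε (s + k)) := by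
  have h1 := measurable_snd.comp (B.measurable_pair_history s hk)
  have h2 := @measurable_dotProduct Ω (B.history s (s + n)) p _ _
    (B.measurable_feat_history s hk.le) (@measurable_const _ _ _ (B.history s (s + n))
      (B.γ (s + k)))
  have h3 : B.ε (s + k) = fun ω => B.obs (s + k) ω - B.feat (s + k) ω ⬝ᵥ B.γ (s + k) := by
    ext ω
    simp [obs, reward, feat]
  rw [h3]
  exact h1.sub h2

theorem transpose_mul_sampleCov_mul {q : ℕ} (U : Matrix (Fin p) (Fin q) ℝ) (s : ℤ) (n : ℕ) {t : ℤ}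
    (ht : t = s + n - 1) (ω : Ω) :
    Uᵀ * B.sampleCov (Finset.Icc s t) ω * U = ridgeGram 0 (fun k => B.coordFeat U s k ω) n := by
  rw [sampleCov, sum_Icc_eq_sum_range _ s n ht, Matrix.mul_sum, Matrix.sum_mul, ridgeGram]
  simp only [zero_smul, zero_add, transpose_mul_vecMulVec_mul, coordFeat]

theorem transpose_mul_regCov_mul {q : ℕ} {U : Matrix (Fin p) (Fin q) ℝ} (hU : Uᵀ * U = 1)
    (lam : ℝ) (n : ℕ) (ω : Ω) :
    Uᵀ * B.regCov lam n ω * U = ridgeGram lam (fun k => B.coordFeat U 1 k ω) n := by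
  rw [regCov, Matrix.mul_add, Matrix.add_mul, B.transpose_mul_sampleCov_mul U 1 n (by ring), Matrix.mul_smul,
    Matrix.smul_mul, Matrix.mul_one, hU]
  simp [ridgeGram]

/-- The noise in consecutive rounds, projected to the columns of `U`, obeys the self-normalized
bound. -/
theorem measure_noise_le (μ : Measure Ω) [IsProbabilityMeasure μ] {q : ℕ}
    (U : Matrix (Fin p) (Fin q) ℝ) (s : ℤ) (n : ℕ) {V σ η : ℝ} (hV : 0 < V) (hσ : 0 < σ)
    (hη : 0 < η) (hsub : ∀ k < n, CondSubGaussian (B.history s (s + (k : ℕ))) μ σ (B.ε (s + k))) :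
    μ {ω | σ ^ 2 * (2 * Real.log (1 / η) +
        Real.log ((ridgeGram V (fun k => B.coordFeat U s k ω) n).det / V ^ q)) <
      (∑ k ∈ Finset.range n, B.ε (s + k) ω • B.coordFeat U s k ω) ⬝ᵥ
        ((ridgeGram V (fun k => B.coordFeat U s k ω) n)⁻¹ *ᵥ
          ∑ k ∈ Finset.range n, B.ε (s + k) ω • B.coordFeat U s k ω)} ≤ ENNReal.ofReal η :=
  self_normalized_bound (x := fun k => B.coordFeat U s k) (e := fun k => B.ε (s + k))
    (F := fun n => B.history s (s + n)) hV hσ hη (fun _ => B.history_le _ _)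
    (fun n _ hk => @measurable_transpose_mulVec Ω (B.history s (s + n)) p q U _
      (B.measurable_feat_history s hk))
    (fun _ _ hk => B.measurable_noise_history s hk) (fun _ => B.measurable_ε _) hsub

end LinearBandit

end Bandit

/-! ### The offline estimate of the invariant component -/

section Offline

variable {Ω : Type*} {𝒳 : Type*} [m0 : MeasurableSpace Ω] [MeasurableSpace 𝒳]
  {p K pinv pres : ℕ} {B : LinearBandit Ω 𝒳 p K} {μ : Measure Ω}
  {T₀ T : ℕ} {Uinv : Matrix (Fin p) (Fin pinv) ℝ} {Ures : Matrix (Fin p) (Fin pres) ℝ}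
  {L M σ lam0 : ℝ}

theorem offRounds_eq (T₀ : ℕ) : offRounds T₀ = Finset.Icc (-(T₀ : ℤ)) (-(T₀ : ℤ) + T₀ - 1) := by
  rw [offRounds]
  congr 1
  ring

theorem mem_offRounds {k : ℕ} (hk : k < T₀) : -(T₀ : ℤ) + k ∈ offRounds T₀ := by
  rw [offRounds, Finset.mem_Icc]
  omega

theorem mem_onRounds {k : ℕ} (hk : k < T) : 1 + (k : ℤ) ∈ onRounds T := by
  rw [onRounds, Finset.mem_Icc]
  omega

theorem IsModel.ae_feature_sq_le (hM : IsModel B μ T₀ T L M σ) :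
    ∀ᵐ ω ∂μ, ∀ t ∈ offRounds T₀ ∪ onRounds T, ∀ i,
      B.φ (B.X t ω) i ⬝ᵥ B.φ (B.X t ω) i ≤ L ^ 2 := by
  refine (Finset.eventually_all _).2 fun t ht => ?_
  filter_upwards [hM.feature_bound t ht] with ω hω i
  exact dotProduct_self_le_of_l2norm_le (hω i)

theorem posSemidef_sampleCov (S : Finset ℤ) (ω : Ω) : (B.sampleCov S ω).PosSemidef := by
  refine posSemidef_sum _ fun τ _ => ?_
  simpa using posSemidef_vecMulVec_self_star (B.feat τ ω)

theorem MinEigAssumption.ae_quadratic (h : MinEigAssumption B μ T₀ lam0) (hT₀ : 0 < T₀) :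
    ∀ᵐ ω ∂μ, ∀ v : Fin p → ℝ,
      T₀ * lam0 * (v ⬝ᵥ v) ≤ v ⬝ᵥ (B.sampleCov (offRounds T₀) ω *ᵥ v) := by
  have hT₀' : (0 : ℝ) < T₀ := by exact_mod_cast hT₀
  filter_upwards [h] with ω hω v
  have h1 := le_quadratic_of_le_minEigenvalue
    ((posSemidef_sampleCov (B := B) (offRounds T₀) ω).smul (by positivity)) hω v
  rw [smul_mulVec, dotProduct_smul, smul_eq_mul, one_div, inv_mul_eq_div,
    le_div_iff₀ hT₀'] at h1
  linarith

theorem MinEigAssumption.pos_rounds [IsProbabilityMeasure μ]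
    (h : MinEigAssumption B μ T₀ lam0) (hlam0 : 0 < lam0)
    (hp : 0 < p) : 0 < T₀ := by
  rcases Nat.eq_zero_or_pos T₀ with rfl | h0
  · obtain ⟨ω, hω⟩ := Filter.Eventually.exists h
    have h1 := le_quadratic_of_le_minEigenvalue
      ((posSemidef_sampleCov (B := B) (offRounds 0) ω).smul (by simp)) hω
      (Pi.single ⟨0, hp⟩ 1)
    simp at h1
    linarith
  · exact h0

/-- The smallest eigenvalue is at most the average of the diagonal. -/
theorem lam0_mul_dim_le [IsProbabilityMeasure μ] (hM : IsModel B μ T₀ T L M σ)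
    (h : MinEigAssumption B μ T₀ lam0)
    (hT₀ : 0 < T₀) : lam0 * p ≤ L ^ 2 := by
  have hT₀' : (0 : ℝ) < T₀ := by exact_mod_cast hT₀
  obtain ⟨ω, h1, h2⟩ := ((h.ae_quadratic hT₀).and hM.ae_feature_sq_le).exists
  have h3 : T₀ * lam0 * p ≤ (B.sampleCov (offRounds T₀) ω).trace := by
    calc T₀ * lam0 * p = ∑ _i : Fin p, T₀ * lam0 := by simp [mul_comm]
      _ ≤ ∑ i, B.sampleCov (offRounds T₀) ω i i :=
          Finset.sum_le_sum fun i _ => by simpa using h1 (Pi.single i 1)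
      _ = _ := rfl
  have h4 : (B.sampleCov (offRounds T₀) ω).trace ≤ T₀ * L ^ 2 := by
    rw [LinearBandit.sampleCov, trace_sum]
    refine (Finset.sum_le_sum fun τ hτ => ?_ : _ ≤ ∑ _τ ∈ offRounds T₀, L ^ 2).trans ?_
    · rw [trace_vecMulVec]
      exact h2 τ (Finset.mem_union_left _ hτ) _
    · simp [offRounds]
  have h5 : T₀ * (lam0 * p) ≤ T₀ * L ^ 2 := by linarith
  exact le_of_mul_le_mul_left h5 hT₀'

theorem IsISD.orthogonal' (hI : IsISD B μ T₀ T Uinv Ures) : Uresᵀ * Uinv = 0 := by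
  have h := congrArg transpose hI.orthogonal
  rwa [transpose_mul, transpose_transpose, transpose_zero] at h

/-- In coordinates: `Uinvᵀ γ_t` is the same in all rounds. -/
theorem IsISD.param_eq (hI : IsISD B μ T₀ T Uinv Ures) (hT : 1 ≤ T) :
    ∀ t ∈ offRounds T₀ ∪ onRounds T,
      B.γ t = Uinv *ᵥ (Uinvᵀ *ᵥ B.γ 1) + Ures *ᵥ (Uresᵀ *ᵥ B.γ t) := by
  obtain ⟨β, ⟨b, rfl⟩, h⟩ := hI.decomposition
  have h1 : ∀ t ∈ offRounds T₀ ∪ onRounds T, Uinvᵀ *ᵥ B.γ t = b := fun t ht => by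
    obtain ⟨δ, ⟨d, rfl⟩, hd⟩ := h t ht
    rw [hd, mulVec_add, mulVecLin_apply, mulVecLin_apply, mulVec_mulVec, mulVec_mulVec,
      hI.orthonormal_inv, hI.orthogonal, one_mulVec, zero_mulVec, add_zero]
  have hone : (1 : ℤ) ∈ offRounds T₀ ∪ onRounds T :=
    Finset.mem_union_right _ (by rw [onRounds, Finset.mem_Icc]; omega)
  intro t ht
  obtain ⟨δ, ⟨d, rfl⟩, hd⟩ := h t ht
  have h2 : Uresᵀ *ᵥ B.γ t = d := by
    rw [hd, mulVec_add, mulVecLin_apply, mulVecLin_apply, mulVec_mulVec, mulVec_mulVec,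
      hI.orthonormal_res, hI.orthogonal', one_mulVec, zero_mulVec, zero_add]
  rw [h1 1 hone, h2, hd, mulVecLin_apply, mulVecLin_apply]

theorem IsISD.dotProduct_param (hI : IsISD B μ T₀ T Uinv Ures) (hT : 1 ≤ T) {t : ℤ}
    (ht : t ∈ offRounds T₀ ∪ onRounds T) (v : Fin p → ℝ) :
    v ⬝ᵥ B.γ t = (Uinvᵀ *ᵥ v) ⬝ᵥ (Uinvᵀ *ᵥ B.γ 1) + (Uresᵀ *ᵥ v) ⬝ᵥ (Uresᵀ *ᵥ B.γ t) := by
  conv_lhs => rw [hI.param_eq hT t ht]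
  rw [dotProduct_add, transpose_mulVec_dotProduct Uinv, transpose_mulVec_dotProduct Ures]

theorem IsISD.obs_eq (hI : IsISD B μ T₀ T Uinv Ures) (hT : 1 ≤ T) {s : ℤ} {k : ℕ}
    (ht : s + k ∈ offRounds T₀ ∪ onRounds T) (ω : Ω) :
    B.obs (s + k) ω = B.coordFeat Uinv s k ω ⬝ᵥ (Uinvᵀ *ᵥ B.γ 1) +
      B.coordFeat Ures s k ω ⬝ᵥ (Uresᵀ *ᵥ B.γ (s + k)) + B.ε (s + k) ω := by
  rw [LinearBandit.obs, LinearBandit.reward, hI.dotProduct_param hT ht]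
  rfl

theorem resParam_sq_le (hM : IsModel B μ T₀ T L M σ) (hI : IsISD B μ T₀ T Uinv Ures) {t : ℤ}
    (ht : t ∈ offRounds T₀ ∪ onRounds T) :
    (Uresᵀ *ᵥ B.γ t) ⬝ᵥ (Uresᵀ *ᵥ B.γ t) ≤ M ^ 2 :=
  (dotProduct_self_transpose_mulVec_le hI.orthonormal_res _).trans
    (dotProduct_self_le_of_l2norm_le (hM.param_bound t ht))

/-- The contribution of the residual components to the offline estimate is a martingale with
increments bounded by `L² M`, since the two projections of the features are uncorrelated. -/
theorem measure_offline_drift_le [IsProbabilityMeasure μ] (hM : IsModel B μ T₀ T L M σ)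
    (hI : IsISD B μ T₀ T Uinv Ures) (hL : 0 < L) (hMpos : 0 < M) (hT₀ : 0 < T₀) {u : ℝ}
    (hu : 0 < u) :
    μ {ω | u < Real.sqrt
      ((∑ k ∈ Finset.range T₀, (B.coordFeat Ures (-(T₀ : ℤ)) k ω ⬝ᵥ
        (Uresᵀ *ᵥ B.γ (-(T₀ : ℤ) + k))) • B.coordFeat Uinv (-(T₀ : ℤ)) k ω) ⬝ᵥ
      ∑ k ∈ Finset.range T₀, (B.coordFeat Ures (-(T₀ : ℤ)) k ω ⬝ᵥ
        (Uresᵀ *ᵥ B.γ (-(T₀ : ℤ) + k))) • B.coordFeat Uinv (-(T₀ : ℤ)) k ω)} ≤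
      ENNReal.ofReal (2 * Real.exp (-(u ^ 2 / (2 * (T₀ * (L ^ 2 * M) ^ 2))))) := by
  have hmeas : ∀ (m : MeasurableSpace Ω) (f : Ω → Fin p → ℝ) (δ : Fin pres → ℝ),
      Measurable[m] f → Measurable[m] fun ω => ((Uresᵀ *ᵥ f ω) ⬝ᵥ δ) • (Uinvᵀ *ᵥ f ω) :=
    fun m f δ hf =>
      (@measurable_dotProduct Ω m _ _ _ (@measurable_transpose_mulVec Ω m p pres Ures _ hf)
        (@measurable_const _ _ _ m _)).smul (@measurable_transpose_mulVec Ω m p pinv Uinv _ hf)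
  have hbound := hM.ae_feature_sq_le
  refine vector_hoeffding (μ := μ) (G := fun n => B.pastFeatures (-(T₀ : ℤ)) (-(T₀ : ℤ) + n))
    (Y := fun k ω => (B.coordFeat Ures (-(T₀ : ℤ)) k ω ⬝ᵥ (Uresᵀ *ᵥ B.γ (-(T₀ : ℤ) + k))) •
      B.coordFeat Uinv (-(T₀ : ℤ)) k ω)
    (fun n => B.pastFeatures_le _ _) (fun k => hmeas m0 _ _ (B.measurable_feat _))
    (fun n k hk => hmeas _ _ _ (B.measurable_feat_pastFeatures _ hk)) (by positivity) hT₀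
    (fun k hk => ?_) (fun k hk i => ?_) hu
  · have ht := Finset.mem_union_left (onRounds T) (mem_offRounds hk)
    filter_upwards [hbound] with ω hω
    have hf := hω _ ht (B.a (-(T₀ : ℤ) + k) ω)
    have h1 := (dotProduct_self_transpose_mulVec_le hI.orthonormal_res
      (B.feat (-(T₀ : ℤ) + k) ω)).trans hf
    have h2 := (dotProduct_self_transpose_mulVec_le hI.orthonormal_inv
      (B.feat (-(T₀ : ℤ) + k) ω)).trans hf
    have h3 := resParam_sq_le hM hI ht
    rw [smul_dotProduct, dotProduct_smul, smul_eq_mul, smul_eq_mul, ← mul_assoc, ← sq]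
    calc _ ≤ (L ^ 2 * M ^ 2) * L ^ 2 := by
          refine mul_le_mul ((sq_dotProduct_le_mul _ _).trans ?_) h2 (zero_le_dotProduct_self _)
            (by positivity)
          exact mul_le_mul h1 h3 (zero_le_dotProduct_self _) (by positivity)
      _ = _ := by ring
  · have ht := mem_offRounds hk
    set xi := B.coordFeat Uinv (-(T₀ : ℤ)) k with hxi
    set xr := B.coordFeat Ures (-(T₀ : ℤ)) k with hxr
    set δ := Uresᵀ *ᵥ B.γ (-(T₀ : ℤ) + k) with hδ
    have hxim : Measurable xi := measurable_transpose_mulVec Uinv (B.measurable_feat _)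
    have hxrm : Measurable xr := measurable_transpose_mulVec Ures (B.measurable_feat _)
    have hint : ∀ j, Integrable (fun ω => xi ω i * xr ω j) μ := fun j => by
      refine Integrable.of_bound (C := L * L) (((measurable_pi_apply i).comp hxim).mul
        ((measurable_pi_apply j).comp hxrm)).aestronglyMeasurable ?_
      filter_upwards [hbound] with ω hω
      have hf := hω _ (Finset.mem_union_left _ ht) (B.a (-(T₀ : ℤ) + k) ω)
      have hcoord : ∀ {q : ℕ} (v : Fin q → ℝ) (i : Fin q), v ⬝ᵥ v ≤ L ^ 2 → |v i| ≤ L :=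
        fun v i hv => by
          refine abs_le_of_sq_le_sq (le_trans ?_ hv) hL.le
          rw [sq]
          exact Finset.single_le_sum (f := fun i => v i * v i)
            (fun j _ => mul_self_nonneg (v j)) (Finset.mem_univ i)
      rw [Real.norm_eq_abs, abs_mul]
      exact mul_le_mul
        (hcoord _ i ((dotProduct_self_transpose_mulVec_le hI.orthonormal_inv _).trans hf))
        (hcoord _ j ((dotProduct_self_transpose_mulVec_le hI.orthonormal_res _).trans hf))
        (abs_nonneg _) hL.le
    have hsum : (fun ω => ((xr ω ⬝ᵥ δ) • xi ω) i) =
        ∑ j, δ j • fun ω => xi ω i * xr ω j := by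
      ext ω
      simp only [Pi.smul_apply, smul_eq_mul, dotProduct, Finset.sum_apply, Finset.sum_mul]
      exact Finset.sum_congr rfl fun j _ => by ring
    rw [hsum]
    refine (condExp_finsetSum (fun j _ => (hint j).smul (δ j)) _).trans ?_
    have h1 : ∀ j, μ[δ j • fun ω => xi ω i * xr ω j |
        B.pastFeatures (-(T₀ : ℤ)) (-(T₀ : ℤ) + k)] =ᵐ[μ] 0 := fun j => by
      filter_upwards [condExp_smul (μ := μ) (δ j) (fun ω => xi ω i * xr ω j)
        (B.pastFeatures (-(T₀ : ℤ)) (-(T₀ : ℤ) + k)), hI.uncorrelated _ ht i j] with ω e1 e2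
      have e3 : (μ[fun ω => xi ω i * xr ω j |
        B.pastFeatures (-(T₀ : ℤ)) (-(T₀ : ℤ) + k)]) ω = 0 := e2
      simp [e1, e3]
    filter_upwards [ae_all_iff.2 h1] with ω hω
    simp [Finset.sum_apply, hω]

/-- The radius of the confidence set covers the bounds of the noise at level `1/√T` and of the
drift at level `2/T`. Half of the second summand of the radius is left for the dimension-dependent
part of the noise, which is of order `σ² L² / lam0`. -/
theorem offline_radius_bound {P : Params} (hη : P.η = 1 / T) (hT : 2 ≤ T) (hσ : 0 < P.σ)
    (hL : 0 < P.L) (hM : 0 < P.M) (hlam0 : 0 < P.lam0) (hT₀ : 0 < T₀)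
    (hdim : P.lam0 * pinv ≤ P.L ^ 2)
    (hlog : P.σ ^ 2 ≤ P.L ^ 2 * P.M ^ 2 * Real.log T) :
    (Real.sqrt (2 * (P.σ ^ 2 * (Real.log T + P.L ^ 2 / P.lam0))) +
      P.L ^ 2 * P.M * Real.sqrt (2 * T₀ * Real.log ((pinv + 1) * T)) /
        Real.sqrt (T₀ * P.lam0)) ^ 2 ≤ rhoInv P pinv := by
  have hT₀' : (0 : ℝ) < T₀ := by exact_mod_cast hT₀
  have hT' : (2 : ℝ) ≤ T := by exact_mod_cast hT
  have hlogT : 0 ≤ Real.log T := Real.log_nonneg (by linarith)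
  have hmono : Real.log T ≤ Real.log ((pinv + 1) * T) := by
    refine Real.log_le_log (by linarith) ?_
    nlinarith [(Nat.cast_nonneg pinv : (0 : ℝ) ≤ pinv)]
  have hdimlog : 0 ≤ pinv * Real.log (P.L ^ 2 / (pinv * P.lam0)) := by
    rcases Nat.eq_zero_or_pos pinv with h0 | h0
    · simp [h0]
    · have h1 : (0 : ℝ) < pinv := by exact_mod_cast h0
      refine mul_nonneg h1.le (Real.log_nonneg ?_)
      rw [le_div_iff₀ (by positivity)]
      linarith
  rw [rhoInv, hη, one_div_one_div]
  set l := Real.log ((pinv + 1) * T) with hl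
  have hl' : Real.log ((pinv + 1) / (1 / (T : ℝ))) = l := by rw [hl]; congr 1; field_simp
  rw [hl']
  have hl0 : 0 ≤ l := hlogT.trans hmono
  set c := P.L ^ 2 * P.M * Real.sqrt (2 / P.lam0 * l) with hc
  have hc0 : 0 ≤ c := by positivity
  have e1 : P.L ^ 2 * P.M * Real.sqrt (2 * T₀ * l) / Real.sqrt (T₀ * P.lam0) = c := by
    rw [hc, mul_div_assoc, ← Real.sqrt_div (by positivity)]
    congr 2
    field_simp
  set a := P.σ * Real.sqrt (2 * Real.log T + pinv * Real.log (P.L ^ 2 / (pinv * P.lam0))) with ha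
  have ha0 : 0 ≤ a := by positivity
  have e2 : Real.sqrt (2 * (P.σ ^ 2 * (Real.log T + P.L ^ 2 / P.lam0))) ≤ a + c := by
    refine Real.sqrt_le_iff.2 ⟨by positivity, ?_⟩
    have h1 : P.σ ^ 2 * (2 * Real.log T) ≤ a ^ 2 := by
      rw [ha, mul_pow, Real.sq_sqrt (by positivity)]
      gcongr
      linarith
    have h2 : 2 * (P.σ ^ 2 * (P.L ^ 2 / P.lam0)) ≤ c ^ 2 := by
      rw [hc, mul_pow, Real.sq_sqrt (by positivity)]
      have h3 : P.σ ^ 2 ≤ P.L ^ 2 * P.M ^ 2 * l := hlog.trans (by gcongr)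
      calc _ = 2 * (P.L ^ 2 / P.lam0) * P.σ ^ 2 := by ring
        _ ≤ 2 * (P.L ^ 2 / P.lam0) * (P.L ^ 2 * P.M ^ 2 * l) := by gcongr
        _ = _ := by ring
    nlinarith [mul_nonneg ha0 hc0]
  rw [e1]
  refine pow_le_pow_left₀ (by positivity) ?_ 2
  have e3 : 2 * P.L ^ 2 * P.M * Real.sqrt (2 / P.lam0 * l) = 2 * c := by rw [hc]; ring
  rw [e3]
  linarith

/-- The confidence set of the invariant component holds outside an event of probability
`O(1/√T)`. -/
theorem exists_offline_event [IsProbabilityMeasure μ] {P : Params} (hη : P.η = 1 / T)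
    (hT : 2 ≤ T) (hσ : 0 < P.σ) (hL : 0 < P.L) (hMpos : 0 < P.M) (hlam0 : 0 < P.lam0)
    (hM : IsModel B μ T₀ T P.L P.M P.σ) (hI : IsISD B μ T₀ T Uinv Ures)
    (hmin : MinEigAssumption B μ T₀ P.lam0)
    (hlog : P.σ ^ 2 ≤ P.L ^ 2 * P.M ^ 2 * Real.log T) :
    ∃ N : Set Ω, μ N ≤ ENNReal.ofReal (1 / Real.sqrt T + 2 / T) ∧
      ∀ᵐ ω ∂μ, ω ∉ N → Uinv *ᵥ (Uinvᵀ *ᵥ B.γ 1) ∈ confBeta B P T₀ Uinv ω := by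
  have hT₀ := hmin.pos_rounds hlam0 (lt_of_le_of_lt (Nat.zero_le _) hI.dim_lt)
  have hT₀' : (0 : ℝ) < T₀ := by exact_mod_cast hT₀
  have hT' : (2 : ℝ) ≤ T := by exact_mod_cast hT
  have hκ : 0 < T₀ * P.lam0 := by positivity
  have hdim : P.lam0 * pinv ≤ P.L ^ 2 := by
    refine le_trans ?_ (lam0_mul_dim_le hM hmin hT₀)
    have : (pinv : ℝ) ≤ p := by exact_mod_cast hI.dim_lt.le
    gcongr
  set l := Real.log ((pinv + 1) * T) with hl
  have hpT : (2 : ℝ) ≤ (pinv + 1) * T := by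
    nlinarith [(Nat.cast_nonneg pinv : (0 : ℝ) ≤ pinv)]
  have hl0 : 0 < l := Real.log_pos (by linarith)
  set u := P.L ^ 2 * P.M * Real.sqrt (2 * T₀ * l) with hu
  have hu0 : 0 < u := by positivity
  have hnoise := B.measure_noise_le μ Uinv (-(T₀ : ℤ)) T₀ hκ hσ
    (show 0 < 1 / Real.sqrt T by positivity) fun k hk => hM.noise_off _ (mem_offRounds hk)
  have hdrift := measure_offline_drift_le hM hI hL hMpos hT₀ hu0
  refine ⟨_, (measure_union_le _ _).trans ((add_le_add hnoise hdrift).trans ?_), ?_⟩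
  · rw [← ENNReal.ofReal_add (by positivity) (by positivity)]
    refine ENNReal.ofReal_le_ofReal (add_le_add le_rfl ?_)
    have h1 : u ^ 2 / (2 * (T₀ * (P.L ^ 2 * P.M) ^ 2)) = l := by
      rw [hu, mul_pow, Real.sq_sqrt (by positivity)]
      field_simp
    rw [h1, hl, Real.exp_neg, Real.exp_log (by linarith), ← div_eq_mul_inv]
    refine div_le_div_of_nonneg_left (by norm_num) (by linarith) ?_
    nlinarith [(Nat.cast_nonneg pinv : (0 : ℝ) ≤ pinv)]
  · filter_upwards [hmin.ae_quadratic hT₀, hM.ae_feature_sq_le] with ω hquad hfeat hN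
    rw [Set.mem_union, not_or, Set.mem_ofPred_eq, Set.mem_ofPred_eq, not_lt, not_lt] at hN
    obtain ⟨hN1, hN2⟩ := hN
    set x : ℕ → Fin pinv → ℝ := fun k => B.coordFeat Uinv (-(T₀ : ℤ)) k ω with hx
    set b := Uinvᵀ *ᵥ B.γ 1 with hb
    set s₁ := ∑ k ∈ Finset.range T₀, B.ε (-(T₀ : ℤ) + k) ω • B.coordFeat Uinv (-(T₀ : ℤ)) k ω
      with hs₁
    set s₂ := ∑ k ∈ Finset.range T₀, (B.coordFeat Ures (-(T₀ : ℤ)) k ω ⬝ᵥ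
        (Uresᵀ *ᵥ B.γ (-(T₀ : ℤ) + k))) • B.coordFeat Uinv (-(T₀ : ℤ)) k ω with hs₂
    have hgram : Uinvᵀ * B.sampleCov (offRounds T₀) ω * Uinv = ridgeGram 0 x T₀ := by
      rw [offRounds_eq]
      exact B.transpose_mul_sampleCov_mul Uinv _ T₀ rfl ω
    have hxquad : ∀ v : Fin pinv → ℝ, T₀ * P.lam0 * (v ⬝ᵥ v) ≤ v ⬝ᵥ (ridgeGram 0 x T₀ *ᵥ v) :=
      fun v => by
        rw [← hgram, ← mulVec_quadratic, ← mulVec_dotProduct_mulVec hI.orthonormal_inv v]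
        exact hquad _
    have hA : (ridgeGram 0 x T₀).PosDef := by
      refine PosDef.of_dotProduct_mulVec_pos (isHermitian_ridgeGram 0 x T₀) fun v hv => ?_
      have : 0 < v ⬝ᵥ v := lt_of_le_of_ne (zero_le_dotProduct_self v)
        (fun h => hv (dotProduct_self_eq_zero.1 h.symm))
      exact lt_of_lt_of_le (by positivity) (hxquad v)
    set y := ∑ t ∈ offRounds T₀, B.obs t ω • (Uinvᵀ *ᵥ B.feat t ω) with hy
    have hysum : y = ridgeGram 0 x T₀ *ᵥ b + s₂ + s₁ := by
      rw [hy, offRounds_eq, sum_Icc_eq_sum_range _ _ T₀ rfl, ridgeGram_mulVec, zero_smul, zero_add,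
        hs₁, hs₂, ← Finset.sum_add_distrib, ← Finset.sum_add_distrib]
      refine Finset.sum_congr rfl fun k hk => ?_
      rw [hI.obs_eq (by omega)
        (Finset.mem_union_left _ (mem_offRounds (Finset.mem_range.1 hk))), add_smul, add_smul]
      rfl
    set w := (ridgeGram 0 x T₀)⁻¹ *ᵥ y - b with hw
    have hAw : ridgeGram 0 x T₀ *ᵥ w = s₁ + s₂ := by
      rw [hw, mulVec_sub, PosDef.mulVec_inv_mulVec hA, hysum]
      abel
    have hdiff : betaHat B T₀ Uinv ω - Uinv *ᵥ b = Uinv *ᵥ w := by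
      rw [betaHat, hgram, hw, mulVec_sub]
    refine ⟨⟨b, rfl⟩, ?_⟩
    have hsq : (Uinv *ᵥ w) ⬝ᵥ (B.sampleCov (offRounds T₀) ω *ᵥ (Uinv *ᵥ w)) =
        w ⬝ᵥ (ridgeGram 0 x T₀ *ᵥ w) := by rw [mulVec_quadratic, hgram]
    have hw0 : 0 ≤ w ⬝ᵥ (ridgeGram 0 x T₀ *ᵥ w) := by
      simpa using hA.posSemidef.dotProduct_mulVec_nonneg w
    rw [hdiff, matNorm_sq (by rw [hsq]; exact hw0), hsq, ← Real.sq_sqrt hw0]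
    refine le_trans (pow_le_pow_left₀ (Real.sqrt_nonneg _) ?_ 2)
      (offline_radius_bound hη hT hσ hL hMpos hlam0 hT₀ hdim hlog)
    have hlogT : 0 ≤ Real.log T := Real.log_nonneg (by linarith)
    refine least_squares_error hκ hxquad hAw (by positivity) hu0.le (hN1.trans ?_) ?_
    · have h1 := log_det_ridgeGram_le hκ x T₀ (b := P.L ^ 2) fun k hk =>
        (dotProduct_self_transpose_mulVec_le hI.orthonormal_inv _).trans
          (hfeat _ (Finset.mem_union_left _ (mem_offRounds hk)) _)
      have h2 : T₀ * P.L ^ 2 / (T₀ * P.lam0) = P.L ^ 2 / P.lam0 := by field_simp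
      rw [h2] at h1
      rw [one_div_one_div, Real.log_sqrt (by positivity)]
      gcongr
      linarith
    · exact (Real.sqrt_le_left hu0.le).1 hN2

end Offline

/-! ### The online confidence sets and the regret of a round -/

section Online

variable {Ω : Type*} {𝒳 : Type*} [m0 : MeasurableSpace Ω] [MeasurableSpace 𝒳]
  {p K pinv pres : ℕ} {B : LinearBandit Ω 𝒳 p K} {μ : Measure Ω}
  {T₀ T : ℕ} {Uinv : Matrix (Fin p) (Fin pinv) ℝ} {Ures : Matrix (Fin p) (Fin pres) ℝ}

theorem rhoInv_nonneg (P : Params) (pinv : ℕ) : 0 ≤ rhoInv P pinv := sq_nonneg _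

theorem rhoRes_nonneg (P : Params) (p pinv pres T₀ : ℕ) (t : ℤ) : 0 ≤ rhoRes P p pinv pres T₀ t :=
  sq_nonneg _

/-- Euclidean size of the confidence set of the invariant component. -/
theorem sq_norm_sub_le_of_mem_confBeta {P : Params} {ω : Ω} {κ : ℝ} (hκ : 0 < κ)
    (hquad : ∀ v : Fin p → ℝ, κ * (v ⬝ᵥ v) ≤ v ⬝ᵥ (B.sampleCov (offRounds T₀) ω *ᵥ v))
    {β : Fin p → ℝ} (hβ : β ∈ confBeta B P T₀ Uinv ω) :
    (betaHat B T₀ Uinv ω - β) ⬝ᵥ (betaHat B T₀ Uinv ω - β) ≤ rhoInv P pinv / κ := by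
  have h := hquad (betaHat B T₀ Uinv ω - β)
  have h0 := zero_le_dotProduct_self (betaHat B T₀ Uinv ω - β)
  have h1 := hβ.2
  rw [matNorm_sq (le_trans (by positivity) h)] at h1
  rw [le_div_iff₀ hκ]
  linarith

/-- On the event that the offline confidence set holds, the confidence set of the residual component
holds in each online round outside an event of probability `1/T`. The misspecification by
`β - β̂` is bounded deterministically, with no assumption on the online features. -/
theorem exists_online_event [IsProbabilityMeasure μ] {P : Params} (hη : P.η = 1 / T) (hT : 2 ≤ T)
    (hσ : 0 < P.σ)
    (hL : 0 < P.L) (hMpos : 0 < P.M) (hlam : 0 < P.lam) (hlam0 : 0 < P.lam0)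
    (hM : IsModel B μ T₀ T P.L P.M P.σ) (hI : IsISD B μ T₀ T Uinv Ures)
    (hmin : MinEigAssumption B μ T₀ P.lam0)
    (hlog : P.lam ≤ 8 * P.L ^ 2 * Real.log T) {n : ℕ} (hn : n < T) :
    ∃ N : Set Ω, μ N ≤ ENNReal.ofReal (1 / T) ∧
      ∀ᵐ ω ∂μ, ω ∉ N → Uinv *ᵥ (Uinvᵀ *ᵥ B.γ 1) ∈ confBeta B P T₀ Uinv ω →
        Ures *ᵥ (Uresᵀ *ᵥ B.γ 1) ∈ confDelta B P T₀ Uinv Ures (1 + n) ω := by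
  have hT₀ := hmin.pos_rounds hlam0 (lt_of_le_of_lt (Nat.zero_le _) hI.dim_lt)
  have hT₀' : (0 : ℝ) < T₀ := by exact_mod_cast hT₀
  have hT' : (2 : ℝ) ≤ T := by exact_mod_cast hT
  have hκ : 0 < T₀ * P.lam0 := by positivity
  have hpres : 0 < pres := by have := hI.dim_add; have := hI.dim_lt; omega
  have hpres' : (0 : ℝ) < pres := by exact_mod_cast hpres
  have hlogT : 0 ≤ Real.log T := Real.log_nonneg (by linarith)
  refine ⟨_, B.measure_noise_le μ Ures 1 n hlam hσ (show (0 : ℝ) < 1 / T by positivity)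
    fun k hk => hM.noise_on _ (mem_onRounds (hk.trans hn)), ?_⟩
  filter_upwards [hmin.ae_quadratic hT₀, hM.ae_feature_sq_le] with ω hquad hfeat hN hβ
  replace hN := not_lt.1 hN
  set x : ℕ → Fin pres → ℝ := fun k => B.coordFeat Ures 1 k ω with hx
  set β := Uinv *ᵥ (Uinvᵀ *ᵥ B.γ 1) with hβdef
  set δ := Uresᵀ *ᵥ B.γ 1 with hδ
  set s := ∑ k ∈ Finset.range n, B.ε (1 + k) ω • B.coordFeat Ures 1 k ω with hs
  set e : ℕ → ℝ := fun k => B.feat (1 + k) ω ⬝ᵥ (β - betaHat B T₀ Uinv ω) with he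
  have hon : ∀ k < n, 1 + (k : ℤ) ∈ offRounds T₀ ∪ onRounds T := fun k hk =>
    Finset.mem_union_right _ (mem_onRounds (hk.trans hn))
  have hA := posDef_ridgeGram hlam x n
  have hgram : Uresᵀ * B.regCov P.lam (1 + (n : ℤ) - 1) ω * Ures = ridgeGram P.lam x n := by
    rw [add_sub_cancel_left]
    exact B.transpose_mul_regCov_mul hI.orthonormal_res P.lam n ω
  set y := ∑ τ ∈ Finset.Icc 1 (1 + (n : ℤ) - 1),
      (B.obs τ ω - B.feat τ ω ⬝ᵥ betaHat B T₀ Uinv ω) • (Uresᵀ *ᵥ B.feat τ ω) with hy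
  have hysum : y = (ridgeGram P.lam x n *ᵥ δ - P.lam • δ) + s +
      ∑ k ∈ Finset.range n, e k • x k := by
    rw [hy, sum_Icc_eq_sum_range _ _ n rfl, ridgeGram_mulVec, add_sub_cancel_left,
      hs, ← Finset.sum_add_distrib, ← Finset.sum_add_distrib]
    refine Finset.sum_congr rfl fun k hk => ?_
    have hk' := Finset.mem_range.1 hk
    rw [hI.obs_eq (by omega) (hon k hk'), hM.param_const _ (mem_onRounds (hk'.trans hn)),
      ← add_smul, ← add_smul]
    simp only [he, hx, hδ, hβdef, dotProduct_sub, LinearBandit.coordFeat,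
      transpose_mulVec_dotProduct Uinv]
    congr 1
    ring
  set w := (ridgeGram P.lam x n)⁻¹ *ᵥ y - δ with hw
  have hAw : ridgeGram P.lam x n *ᵥ w = s - P.lam • δ + ∑ k ∈ Finset.range n, e k • x k := by
    rw [hw, mulVec_sub, PosDef.mulVec_inv_mulVec hA, hysum]
    abel
  have hdiff : deltaHat B P T₀ Uinv Ures (1 + n) ω - Ures *ᵥ δ = Ures *ᵥ w := by
    rw [deltaHat, hgram, hw, mulVec_sub]
  refine ⟨⟨δ, rfl⟩, ?_⟩
  have hsq : (Ures *ᵥ w) ⬝ᵥ (B.regCov P.lam (1 + (n : ℤ) - 1) ω *ᵥ (Ures *ᵥ w)) =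
      w ⬝ᵥ (ridgeGram P.lam x n *ᵥ w) := by rw [mulVec_quadratic, hgram]
  have hw0 : 0 ≤ w ⬝ᵥ (ridgeGram P.lam x n *ᵥ w) := by
    simpa using hA.posSemidef.dotProduct_mulVec_nonneg w
  rw [hdiff, matNorm_sq (by rw [hsq]; exact hw0), hsq, ← Real.sq_sqrt hw0, rhoRes]
  refine pow_le_pow_left₀ (Real.sqrt_nonneg _) ?_ 2
  have hlogdet : 0 ≤ (pres : ℝ) *
      Real.log (1 + ((1 + n : ℤ) : ℝ) * P.L ^ 2 / (P.lam * pres)) := by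
    refine mul_nonneg hpres'.le (Real.log_nonneg ?_)
    have : (0 : ℝ) ≤ ((1 + n : ℤ) : ℝ) := by positivity
    have : 0 ≤ ((1 + n : ℤ) : ℝ) * P.L ^ 2 / (P.lam * pres) := by positivity
    linarith
  have hfk : ∀ k < n, B.feat (1 + k) ω ⬝ᵥ B.feat (1 + k) ω ≤ P.L ^ 2 := fun k hk =>
    hfeat _ (hon k hk) _
  rw [hη, one_div_one_div]
  have hq : P.σ * Real.sqrt (2 * Real.log T + pres * Real.log (1 +
      ((1 + n : ℤ) : ℝ) * P.L ^ 2 / (P.lam * pres))) = Real.sqrt (P.σ ^ 2 * (2 * Real.log T +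
      pres * Real.log (1 + ((1 + n : ℤ) : ℝ) * P.L ^ 2 / (P.lam * pres)))) := by
    rw [Real.sqrt_mul (sq_nonneg _), Real.sqrt_sq hσ.le]
  rw [hq]
  have hr := rhoInv_nonneg P pinv
  have hn1 : ((1 + n : ℤ) : ℝ) - 1 = n := by push_cast; ring
  rw [hn1]
  have hplog : Real.log T ≤ Real.log ((p + 1) / (1 / (T : ℝ))) := by
    refine Real.log_le_log (by linarith) ?_
    rw [div_div_eq_mul_div, div_one]
    nlinarith [(Nat.cast_nonneg p : (0 : ℝ) ≤ p)]
  refine ridge_error hlam hAw (by positivity) hMpos.le (by positivity) (hN.trans ?_)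
    (resParam_sq_le hM hI (Finset.mem_union_right _ (by rw [onRounds, Finset.mem_Icc]; omega))) ?_
  · have h1 := log_det_ridgeGram_le_mul_log hlam hpres x n (sq_nonneg P.L) fun k hk =>
      (dotProduct_self_transpose_mulVec_le hI.orthonormal_res _).trans (hfk k hk)
    rw [one_div_one_div]
    refine mul_le_mul_of_nonneg_left (add_le_add le_rfl (h1.trans ?_)) (sq_nonneg _)
    refine mul_le_mul_of_nonneg_left (Real.log_le_log (by positivity) ?_) hpres'.le
    gcongr
    push_cast
    linarith
  · have hb := sq_norm_sub_le_of_mem_confBeta hκ hquad hβ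
    rw [← neg_dotProduct_neg, neg_sub] at hb
    have hek : ∀ k ∈ Finset.range n, e k ^ 2 ≤ P.L ^ 2 * (rhoInv P pinv / (T₀ * P.lam0)) :=
      fun k hk => (sq_dotProduct_le_mul _ _).trans
        (mul_le_mul (hfk k (Finset.mem_range.1 hk)) hb (zero_le_dotProduct_self _)
          (by positivity))
    have hrew : P.lam0 * T₀ = T₀ * P.lam0 := mul_comm _ _
    rw [hrew]
    refine (Finset.sum_le_sum hek).trans ?_
    rw [Finset.sum_const, Finset.card_range, nsmul_eq_mul, mul_pow, mul_pow, div_pow, one_pow,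
      Real.sq_sqrt hlam.le, Real.sq_sqrt (by positivity), mul_pow,
      Real.sq_sqrt (mul_nonneg (by positivity) (hlogT.trans hplog)), ← mul_assoc]
    refine mul_le_mul_of_nonneg_right ?_ (by positivity)
    rw [one_div, inv_mul_eq_div, le_div_iff₀ hlam]
    calc n * P.L ^ 2 * P.lam ≤ n * P.L ^ 2 * (8 * P.L ^ 2 * Real.log T) := by gcongr
      _ ≤ n * P.L ^ 2 * (8 * P.L ^ 2 * Real.log ((p + 1) / (1 / (T : ℝ)))) := by gcongr
      _ = _ := by ring

/-- The half-width in direction `v` of the sum of the two confidence sets. -/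
noncomputable def confWidth (P : Params) (T₀ pinv : ℕ) (Ures : Matrix (Fin p) (Fin pres) ℝ)
    (x : ℕ → Fin pres → ℝ) (n : ℕ) (v : Fin p → ℝ) : ℝ :=
  P.L * Real.sqrt (rhoInv P pinv / (T₀ * P.lam0)) +
    Real.sqrt (rhoRes P p pinv pres T₀ (1 + n)) *
      Real.sqrt ((Uresᵀ *ᵥ v) ⬝ᵥ ((ridgeGram P.lam x n)⁻¹ *ᵥ (Uresᵀ *ᵥ v)))

theorem abs_dotProduct_sub_le_confWidth {P : Params} (hL : 0 < P.L) (hlam : 0 < P.lam)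
    (hU : Uresᵀ * Ures = 1) {ω : Ω} (hκ : 0 < T₀ * P.lam0)
    (hquad : ∀ v : Fin p → ℝ, T₀ * P.lam0 * (v ⬝ᵥ v) ≤
      v ⬝ᵥ (B.sampleCov (offRounds T₀) ω *ᵥ v)) {n : ℕ} {v : Fin p → ℝ}
    (hv : v ⬝ᵥ v ≤ P.L ^ 2) {g : Fin p → ℝ}
    (hg : g ∈ confBeta B P T₀ Uinv ω + confDelta B P T₀ Uinv Ures (1 + n) ω) :
    |v ⬝ᵥ (betaHat B T₀ Uinv ω + deltaHat B P T₀ Uinv Ures (1 + n) ω) - v ⬝ᵥ g| ≤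
      confWidth P T₀ pinv Ures (fun k => B.coordFeat Ures 1 k ω) n v := by
  obtain ⟨β, hβ, δ, hδ, rfl⟩ := Set.mem_add.1 hg
  set x : ℕ → Fin pres → ℝ := fun k => B.coordFeat Ures 1 k ω with hx
  have hr := rhoInv_nonneg P pinv
  have hA := posDef_ridgeGram hlam x n
  have h1 : |v ⬝ᵥ (betaHat B T₀ Uinv ω - β)| ≤
      P.L * Real.sqrt (rhoInv P pinv / (T₀ * P.lam0)) := by
    refine abs_le_of_sq_le_sq ((sq_dotProduct_le_mul _ _).trans ?_) (by positivity)
    rw [mul_pow, Real.sq_sqrt (by positivity)]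
    exact mul_le_mul hv (sq_norm_sub_le_of_mem_confBeta hκ hquad hβ) (zero_le_dotProduct_self _)
      (by positivity)
  have h2 : |v ⬝ᵥ (deltaHat B P T₀ Uinv Ures (1 + n) ω - δ)| ≤
      Real.sqrt (rhoRes P p pinv pres T₀ (1 + n)) *
      Real.sqrt ((Uresᵀ *ᵥ v) ⬝ᵥ ((ridgeGram P.lam x n)⁻¹ *ᵥ (Uresᵀ *ᵥ v))) := by
    obtain ⟨⟨d, rfl⟩, hd⟩ := hδ
    have hgram : Uresᵀ * B.regCov P.lam (1 + (n : ℤ) - 1) ω * Ures = ridgeGram P.lam x n := by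
      rw [add_sub_cancel_left]
      exact B.transpose_mul_regCov_mul hU P.lam n ω
    obtain ⟨w, hw⟩ : ∃ w, deltaHat B P T₀ Uinv Ures (1 + n) ω - mulVecLin Ures d = Ures *ᵥ w := by
      rw [deltaHat, mulVecLin_apply, ← mulVec_sub]
      exact ⟨_, rfl⟩
    have hw0 : 0 ≤ w ⬝ᵥ (ridgeGram P.lam x n *ᵥ w) := by
      simpa using hA.posSemidef.dotProduct_mulVec_nonneg w
    rw [hw, matNorm_sq (by rw [mulVec_quadratic, hgram]; exact hw0), mulVec_quadratic,
      hgram] at hd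
    refine abs_le_of_sq_le_sq ?_ (by positivity)
    rw [hw, mul_pow, Real.sq_sqrt (rhoRes_nonneg _ _ _ _ _ _),
      Real.sq_sqrt (PosDef.inv_quadratic_nonneg hA _), ← transpose_mulVec_dotProduct,
      dotProduct_comm]
    exact (PosDef.sq_dotProduct_le hA _ _).trans
      (mul_le_mul_of_nonneg_right hd (PosDef.inv_quadratic_nonneg hA _))
  rw [← dotProduct_sub, add_sub_add_comm, dotProduct_add]
  exact (abs_add_le _ _).trans (add_le_add h1 h2)

/-- Optimism: if the confidence sets hold, the instantaneous regret is at most twice the width of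
the confidence interval of the played action. -/
theorem gap_le_two_mul_confWidth {P : Params} (hL : 0 < P.L) (hlam : 0 < P.lam)
    (hU : Uresᵀ * Ures = 1) {ω : Ω} (hκ : 0 < T₀ * P.lam0)
    (hquad : ∀ v : Fin p → ℝ, T₀ * P.lam0 * (v ⬝ᵥ v) ≤
      v ⬝ᵥ (B.sampleCov (offRounds T₀) ω *ᵥ v)) {n : ℕ}
    (hfeat : ∀ i, B.φ (B.X (1 + n) ω) i ⬝ᵥ B.φ (B.X (1 + n) ω) i ≤ P.L ^ 2)
    (hmax : ∀ i, ucb B P T₀ Uinv Ures (1 + n) i ω ≤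
      ucb B P T₀ Uinv Ures (1 + n) (B.a (1 + n) ω) ω) {γ : Fin p → ℝ}
    (hγ : γ ∈ confBeta B P T₀ Uinv ω + confDelta B P T₀ Uinv Ures (1 + n) ω) (i : Fin K) :
    B.φ (B.X (1 + n) ω) i ⬝ᵥ γ - B.feat (1 + n) ω ⬝ᵥ γ ≤
      2 * confWidth P T₀ pinv Ures (fun k => B.coordFeat Ures 1 k ω) n (B.feat (1 + n) ω) := by
  have hw := fun j g (hg : g ∈ confBeta B P T₀ Uinv ω + confDelta B P T₀ Uinv Ures (1 + n) ω) =>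
    abs_le.1 (abs_dotProduct_sub_le_confWidth hL hlam hU hκ hquad (hfeat j) hg)
  have h1 : B.φ (B.X (1 + n) ω) i ⬝ᵥ γ ≤ ucb B P T₀ Uinv Ures (1 + n) i ω := by
    refine le_csSup ⟨B.φ (B.X (1 + n) ω) i ⬝ᵥ
      (betaHat B T₀ Uinv ω + deltaHat B P T₀ Uinv Ures (1 + n) ω) + confWidth P T₀ pinv Ures
        (fun k => B.coordFeat Ures 1 k ω) n (B.φ (B.X (1 + n) ω) i), ?_⟩ ⟨γ, hγ, rfl⟩
    rintro _ ⟨g, hg, rfl⟩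
    exact neg_le_sub_iff_le_add.1 (hw i g hg).1
  have h2 : ucb B P T₀ Uinv Ures (1 + n) (B.a (1 + n) ω) ω ≤
      B.feat (1 + n) ω ⬝ᵥ (betaHat B T₀ Uinv ω + deltaHat B P T₀ Uinv Ures (1 + n) ω) +
      confWidth P T₀ pinv Ures (fun k => B.coordFeat Ures 1 k ω) n (B.feat (1 + n) ω) := by
    refine csSup_le ⟨_, γ, hγ, rfl⟩ ?_
    rintro _ ⟨g, hg, rfl⟩
    exact neg_le_sub_iff_le_add.1 (hw (B.a (1 + n) ω) g hg).1
  have h3 := (hw (B.a (1 + n) ω) γ hγ).2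
  have h4 := hmax i
  change B.feat (1 + n) ω ⬝ᵥ _ - B.feat (1 + n) ω ⬝ᵥ γ ≤ confWidth P T₀ pinv Ures
    (fun k => B.coordFeat Ures 1 k ω) n (B.feat (1 + n) ω) at h3
  linarith

end Online

/-! ### The expected regret -/

section Expectation

variable {Ω : Type*} {𝒳 : Type*} [m0 : MeasurableSpace Ω] [MeasurableSpace 𝒳]
  {p K pinv pres : ℕ} {B : LinearBandit Ω 𝒳 p K} {μ : Measure Ω}
  {T₀ T : ℕ} {Uinv : Matrix (Fin p) (Fin pinv) ℝ} {Ures : Matrix (Fin p) (Fin pres) ℝ}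
  {astar : ℤ → Ω → Fin K} {L M σ : ℝ}

/-- The noise cancels in the reward differences. -/
theorem rewardGap_eq (B : LinearBandit Ω 𝒳 p K) (T : ℕ) (astar : ℤ → Ω → Fin K) (ω : Ω) :
    rewardGap B T astar ω = ∑ n ∈ Finset.range T,
      (B.φ (B.X (1 + n) ω) (astar (1 + n) ω) ⬝ᵥ B.γ (1 + n) -
        B.feat (1 + n) ω ⬝ᵥ B.γ (1 + n)) := by
  rw [rewardGap, onRounds, sum_Icc_eq_sum_range _ 1 T (by ring)]
  refine Finset.sum_congr rfl fun n _ => ?_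
  simp only [LinearBandit.reward, LinearBandit.feat]
  ring

/-- The optimal action need not be measurable, but the optimal mean reward is a finite maximum. -/
theorem measurable_rewardGap [Nonempty (Fin K)] (hopt : IsOptimal B T astar) :
    Measurable (rewardGap B T astar) := by
  have h : rewardGap B T astar = fun ω => ∑ n ∈ Finset.range T,
      (Finset.univ.sup' Finset.univ_nonempty
        (fun i ω => B.φ (B.X (1 + n) ω) i ⬝ᵥ B.γ (1 + n)) ω -
          B.feat (1 + n) ω ⬝ᵥ B.γ (1 + n)) := by
    ext ω
    rw [rewardGap_eq]
    refine Finset.sum_congr rfl fun n hn => ?_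
    congr 1
    rw [Finset.sup'_apply]
    refine le_antisymm (Finset.le_sup' (fun i => B.φ (B.X (1 + n) ω) i ⬝ᵥ B.γ (1 + n))
      (Finset.mem_univ _)) (Finset.sup'_le _ _ fun i _ => ?_)
    exact hopt _ (mem_onRounds (Finset.mem_range.1 hn)) ω i
  rw [h]
  refine Finset.measurable_sum _ fun n _ => Measurable.sub ?_
    (measurable_dotProduct (B.measurable_feat _) measurable_const)
  exact Finset.measurable_sup' _ fun i _ => measurable_dotProduct
    ((B.measurable_φ i).comp (B.measurable_X _)) measurable_const

theorem IsModel.ae_gap_le (hM : IsModel B μ T₀ T L M σ) (hL : 0 < L) (hMpos : 0 < M) :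
    ∀ᵐ ω ∂μ, ∀ n < T, ∀ i j, |B.φ (B.X (1 + (n : ℕ)) ω) i ⬝ᵥ B.γ (1 + n) -
      B.φ (B.X (1 + n) ω) j ⬝ᵥ B.γ (1 + n)| ≤ 2 * L * M := by
  filter_upwards [hM.ae_feature_sq_le] with ω hω n hn i j
  have ht := Finset.mem_union_right (offRounds T₀) (mem_onRounds hn)
  have h : ∀ i, |B.φ (B.X (1 + n) ω) i ⬝ᵥ B.γ (1 + n)| ≤ L * M := fun i => by
    refine abs_le_of_sq_le_sq ((sq_dotProduct_le_mul _ _).trans ?_) (by positivity)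
    rw [mul_pow]
    exact mul_le_mul (hω _ ht i) (dotProduct_self_le_of_l2norm_le (hM.param_bound _ ht))
      (zero_le_dotProduct_self _) (by positivity)
  have h1 := abs_le.1 (h i)
  have h2 := abs_le.1 (h j)
  rw [abs_le]
  constructor <;> linarith [h1.1, h1.2, h2.1, h2.2]

theorem integrable_rewardGap [IsProbabilityMeasure μ] (hM : IsModel B μ T₀ T L M σ) (hL : 0 < L)
    (hMpos : 0 < M) (hopt : IsOptimal B T astar) :
    Integrable (rewardGap B T astar) μ ∧ regret B μ T astar ≤ T * (2 * L * M) := by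
  have : Nonempty (Fin K) := ⟨B.a 0 (nonempty_of_isProbabilityMeasure μ).some⟩
  have hbd : ∀ᵐ ω ∂μ, ‖rewardGap B T astar ω‖ ≤ T * (2 * L * M) := by
    filter_upwards [hM.ae_gap_le hL hMpos] with ω hω
    rw [rewardGap_eq, Real.norm_eq_abs]
    refine (Finset.abs_sum_le_sum_abs _ _).trans
      ((Finset.sum_le_sum fun n hn => hω n (Finset.mem_range.1 hn) _ _).trans ?_)
    simp
  have hint := Integrable.of_bound (measurable_rewardGap hopt).aestronglyMeasurable _ hbd
  refine ⟨hint, ?_⟩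
  calc regret B μ T astar ≤ ∫ _, T * (2 * L * M) ∂μ := by
        refine integral_mono_ae hint (integrable_const _) ?_
        filter_upwards [hbd] with ω hω using le_of_abs_le hω
    _ = _ := by simp

/-- The regret is bounded by the sum of the confidence widths, which the elliptical potential lemma
controls, and by the cost of the failure of the confidence sets. -/
theorem regret_le_of_radius_le [IsProbabilityMeasure μ] {P : Params} (hη : P.η = 1 / T)
    (hT : 2 ≤ T) (hσ : 0 < P.σ)
    (hL : 0 < P.L) (hMpos : 0 < P.M) (hlam : 0 < P.lam) (hlam0 : 0 < P.lam0)
    (hM : IsModel B μ T₀ T P.L P.M P.σ) (hI : IsISD B μ T₀ T Uinv Ures)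
    (hmin : MinEigAssumption B μ T₀ P.lam0)
    (hplay : PlaysISDLinUCB B P T₀ Uinv Ures μ T) (hopt : IsOptimal B T astar)
    (hlog₁ : P.σ ^ 2 ≤ P.L ^ 2 * P.M ^ 2 * Real.log T)
    (hlog₂ : P.lam ≤ 8 * P.L ^ 2 * Real.log T) {R : ℝ} (hR0 : 0 ≤ R)
    (hR : ∀ n < T, Real.sqrt (rhoRes P p pinv pres T₀ (1 + (n : ℕ))) ≤ R) :
    regret B μ T astar ≤
      2 * P.L * T * Real.sqrt (rhoInv P pinv / (T₀ * P.lam0)) +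
      2 * R * (Real.sqrt T * Real.sqrt ((1 + P.L ^ 2 / P.lam) *
        (pres * Real.log (1 + T * P.L ^ 2 / (P.lam * pres))))) +
      2 * P.L * P.M * (Real.sqrt T + 3) := by
  have hT₀ := hmin.pos_rounds hlam0 (lt_of_le_of_lt (Nat.zero_le _) hI.dim_lt)
  have hT₀' : (0 : ℝ) < T₀ := by exact_mod_cast hT₀
  have hT' : (2 : ℝ) ≤ T := by exact_mod_cast hT
  have hκ : 0 < T₀ * P.lam0 := by positivity
  have hpres : 0 < pres := by have := hI.dim_add; have := hI.dim_lt; omega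
  obtain ⟨N₀', hN₀', hβ⟩ := exists_offline_event hη hT hσ hL hMpos hlam0 hM hI hmin hlog₁
  have hev : ∀ n : ℕ, ∃ N : Set Ω, μ N ≤ ENNReal.ofReal (1 / T) ∧ (n < T → ∀ᵐ ω ∂μ, ω ∉ N →
      Uinv *ᵥ (Uinvᵀ *ᵥ B.γ 1) ∈ confBeta B P T₀ Uinv ω →
        Ures *ᵥ (Uresᵀ *ᵥ B.γ 1) ∈ confDelta B P T₀ Uinv Ures (1 + n) ω) := fun n => by
    by_cases hn : n < T
    · obtain ⟨N, h1, h2⟩ :=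
        exists_online_event hη hT hσ hL hMpos hlam hlam0 hM hI hmin hlog₂ hn
      exact ⟨N, h1, fun _ => h2⟩
    · exact ⟨∅, by simp, fun h => absurd h hn⟩
  choose N' hN' hδ using hev
  set N₀ := toMeasurable μ N₀' with hN₀def
  set N := fun n => toMeasurable μ (N' n) with hNdef
  have hN₀m : MeasurableSet N₀ := measurableSet_toMeasurable _ _
  have hNm : ∀ n, MeasurableSet (N n) := fun n => measurableSet_toMeasurable _ _
  have hN₀ : μ.real N₀ ≤ 1 / Real.sqrt T + 2 / T := by
    rw [measureReal_def, hN₀def, measure_toMeasurable]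
    exact ENNReal.toReal_le_of_le_ofReal (by positivity) hN₀'
  have hN : ∀ n, μ.real (N n) ≤ 1 / T := fun n => by
    rw [measureReal_def, hNdef, measure_toMeasurable]
    exact ENNReal.toReal_le_of_le_ofReal (by positivity) (hN' n)
  set W := P.L * Real.sqrt (rhoInv P pinv / (T₀ * P.lam0)) with hW
  have hW0 : 0 ≤ W := by positivity
  set D := (1 + P.L ^ 2 / P.lam) * (pres * Real.log (1 + T * P.L ^ 2 / (P.lam * pres))) with hD
  set Z : Ω → ℝ := fun ω => ∑ n ∈ Finset.range T,
    (N₀.indicator (fun _ => 2 * P.L * P.M) ω + (N n).indicator (fun _ => 2 * P.L * P.M) ω) with hZ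
  have hLM : 0 ≤ 2 * P.L * P.M := by positivity
  have hδ' : ∀ᵐ ω ∂μ, ∀ n < T, ω ∉ N' n →
      Uinv *ᵥ (Uinvᵀ *ᵥ B.γ 1) ∈ confBeta B P T₀ Uinv ω →
        Ures *ᵥ (Uresᵀ *ᵥ B.γ 1) ∈ confDelta B P T₀ Uinv Ures (1 + (n : ℕ)) ω := by
    rw [ae_all_iff]
    intro n
    by_cases hn : n < T
    · filter_upwards [hδ n hn] with ω hω _ using hω
    · exact Filter.Eventually.of_forall fun ω h => absurd h hn
  have hplay' : ∀ᵐ ω ∂μ, ∀ t ∈ onRounds T, ∀ i,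
      ucb B P T₀ Uinv Ures t i ω ≤ ucb B P T₀ Uinv Ures t (B.a t ω) ω :=
    (Finset.eventually_all _).2 hplay
  have hpoint : ∀ᵐ ω ∂μ, rewardGap B T astar ω ≤
      (2 * T * W + 2 * R * (Real.sqrt T * Real.sqrt D)) + Z ω := by
    filter_upwards [hmin.ae_quadratic hT₀, hM.ae_feature_sq_le, hβ, hδ', hplay',
      hM.ae_gap_le hL hMpos] with ω hquad hfeat hβω hδω hmax hgap
    set x : ℕ → Fin pres → ℝ := fun k => B.coordFeat Ures 1 k ω with hx
    have hon : ∀ {n : ℕ}, n < T → 1 + (n : ℤ) ∈ offRounds T₀ ∪ onRounds T := fun hn =>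
      Finset.mem_union_right _ (mem_onRounds hn)
    have hxk : ∀ k < T, x k ⬝ᵥ x k ≤ P.L ^ 2 := fun k hk =>
      (dotProduct_self_transpose_mulVec_le hI.orthonormal_res _).trans (hfeat _ (hon hk) _)
    set v : ℕ → ℝ := fun n => Real.sqrt (x n ⬝ᵥ ((ridgeGram P.lam x n)⁻¹ *ᵥ x n)) with hv
    have hround : ∀ n ∈ Finset.range T,
        B.φ (B.X (1 + n) ω) (astar (1 + n) ω) ⬝ᵥ B.γ (1 + n) -
          B.feat (1 + n) ω ⬝ᵥ B.γ (1 + n) ≤ (2 * W + 2 * R * v n) +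
          (N₀.indicator (fun _ => 2 * P.L * P.M) ω +
            (N n).indicator (fun _ => 2 * P.L * P.M) ω) := by
      intro n hn
      have hn' := Finset.mem_range.1 hn
      have hpos : 0 ≤ 2 * W + 2 * R * v n := by positivity
      have hi : ∀ S : Set Ω, 0 ≤ S.indicator (fun _ => 2 * P.L * P.M) ω := fun S =>
        Set.indicator_nonneg (fun _ _ => hLM) ω
      by_cases hbad : ω ∈ N₀ ∨ ω ∈ N n
      · have h1 : 2 * P.L * P.M ≤ N₀.indicator (fun _ => 2 * P.L * P.M) ω +
            (N n).indicator (fun _ => 2 * P.L * P.M) ω := by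
          rcases hbad with h | h
          · have := hi (N n)
            rw [Set.indicator_of_mem h]
            linarith
          · have := hi N₀
            rw [Set.indicator_of_mem h]
            linarith
        have h2 := le_of_abs_le (hgap n hn' (astar (1 + n) ω) (B.a (1 + n) ω))
        refine le_trans h2 ?_
        linarith
      · rw [not_or] at hbad
        have hβ₁ := hβω fun h => hbad.1 (subset_toMeasurable _ _ h)
        have hδ₁ := hδω n hn' (fun h => hbad.2 (subset_toMeasurable _ _ h)) hβ₁
        have hγ : B.γ (1 + n) ∈ confBeta B P T₀ Uinv ω +
            confDelta B P T₀ Uinv Ures (1 + n) ω := by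
          rw [hI.param_eq (by omega) _ (hon hn')]
          rw [hM.param_const _ (mem_onRounds hn')]
          exact Set.add_mem_add hβ₁ hδ₁
        have h1 := gap_le_two_mul_confWidth hL hlam hI.orthonormal_res hκ hquad
          (hfeat _ (hon hn')) (hmax _ (mem_onRounds hn')) hγ (astar (1 + n) ω)
        rw [confWidth] at h1
        have h2 : Real.sqrt (rhoRes P p pinv pres T₀ (1 + n)) * v n ≤ R * v n :=
          mul_le_mul_of_nonneg_right (hR n hn') (Real.sqrt_nonneg _)
        have h3 := hi N₀
        have h4 := hi (N n)
        change _ ≤ 2 * (W + Real.sqrt (rhoRes P p pinv pres T₀ (1 + n)) * v n) at h1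
        linarith
    have hpot : ∑ n ∈ Finset.range T, v n ^ 2 ≤ D := by
      have h1 := sum_inv_quadratic_le hlam x T (q := P.L ^ 2 / P.lam) fun k hk =>
        (inv_quadratic_le hlam x k (x k)).trans (by gcongr; exact hxk k hk)
      have h2 := log_det_ridgeGram_le_mul_log hlam hpres x T (sq_nonneg P.L) hxk
      calc _ = ∑ k ∈ Finset.range T, x k ⬝ᵥ ((ridgeGram P.lam x k)⁻¹ *ᵥ x k) :=
            Finset.sum_congr rfl fun k _ =>
              Real.sq_sqrt (PosDef.inv_quadratic_nonneg (posDef_ridgeGram hlam x k) _)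
        _ ≤ _ := h1.trans (mul_le_mul_of_nonneg_left h2 (by positivity))
    have hsumv : ∑ n ∈ Finset.range T, v n ≤ Real.sqrt T * Real.sqrt D := by
      have h1 := Finset.sum_mul_sq_le_sq_mul_sq (Finset.range T) (fun _ => (1 : ℝ)) v
      simp only [one_mul, one_pow, Finset.sum_const, Finset.card_range, nsmul_eq_mul,
        mul_one] at h1
      rw [← Real.sqrt_mul (by positivity)]
      exact Real.le_sqrt_of_sq_le (h1.trans (by gcongr))
    rw [rewardGap_eq]
    refine (Finset.sum_le_sum hround).trans ?_
    rw [Finset.sum_add_distrib, Finset.sum_add_distrib, Finset.sum_const, Finset.card_range,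
      nsmul_eq_mul, ← Finset.mul_sum]
    have h5 : 2 * R * ∑ n ∈ Finset.range T, v n ≤ 2 * R * (Real.sqrt T * Real.sqrt D) :=
      mul_le_mul_of_nonneg_left hsumv (by positivity)
    have h6 : (T : ℝ) * (2 * W) = 2 * T * W := by ring
    rw [h6]
    exact add_le_add (add_le_add le_rfl h5) le_rfl
  have hind : ∀ S : Set Ω, MeasurableSet S →
      Integrable (S.indicator fun _ => 2 * P.L * P.M) μ := fun S hS =>
    (integrable_const _).indicator hS
  have hZint : Integrable Z μ := integrable_finsetSum _ fun n _ =>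
    (hind N₀ hN₀m).add (hind (N n) (hNm n))
  have hZle : ∫ ω, Z ω ∂μ ≤ 2 * P.L * P.M * (Real.sqrt T + 3) := by
    calc ∫ ω, Z ω ∂μ = ∑ n ∈ Finset.range T,
          ∫ ω, (N₀.indicator (fun _ => 2 * P.L * P.M) ω +
            (N n).indicator (fun _ => 2 * P.L * P.M) ω) ∂μ :=
          integral_finsetSum _ fun n _ => (hind N₀ hN₀m).add (hind (N n) (hNm n))
      _ = ∑ n ∈ Finset.range T, (μ.real N₀ + μ.real (N n)) * (2 * P.L * P.M) := by
          refine Finset.sum_congr rfl fun n _ => ?_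
          rw [integral_add (hind N₀ hN₀m) (hind (N n) (hNm n)), integral_indicator_const _ hN₀m,
            integral_indicator_const _ (hNm n), smul_eq_mul, smul_eq_mul, add_mul]
      _ ≤ ∑ n ∈ Finset.range T, ((1 / Real.sqrt T + 2 / T) + 1 / T) * (2 * P.L * P.M) := by
          gcongr with n
          exact hN n
      _ = 2 * P.L * P.M * (T / Real.sqrt T + 3) := by
          rw [Finset.sum_const, Finset.card_range, nsmul_eq_mul]
          field_simp
          ring
      _ = _ := by rw [Real.div_sqrt]
  calc regret B μ T astar ≤
        ∫ ω, ((2 * T * W + 2 * R * (Real.sqrt T * Real.sqrt D)) + Z ω) ∂μ :=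
        integral_mono_ae (integrable_rewardGap hM hL hMpos hopt).1
          ((integrable_const _).add hZint) hpoint
    _ = (2 * T * W + 2 * R * (Real.sqrt T * Real.sqrt D)) + ∫ ω, Z ω ∂μ := by
        rw [integral_add (integrable_const _) hZint]
        simp
    _ ≤ _ := by
        rw [hW]
        linarith

end Expectation

/-! ### Size of the radii -/

theorem sqrt_rhoInv_le {P : Params} {p pinv T : ℕ} (hη : P.η = 1 / T) (hT : 2 ≤ T) (hp : pinv < p)
    (hσ : 0 < P.σ) (hL : 0 < P.L) (hM : 0 < P.M) (hlam0 : 0 < P.lam0)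
    (hdim : P.lam0 * p ≤ P.L ^ 2) {l : ℝ} (hl1 : 1 ≤ l) (hl : 2 * Real.log (p * T) ≤ l) :
    Real.sqrt (rhoInv P pinv) ≤
      (2 * P.σ * P.L + 2 * P.L ^ 2 * P.M) * Real.sqrt (l / P.lam0) := by
  have hT' : (2 : ℝ) ≤ T := by exact_mod_cast hT
  have hp1 : (1 : ℝ) ≤ p := by exact_mod_cast (by omega : 1 ≤ p)
  have hpp : (pinv : ℝ) + 1 ≤ p := by exact_mod_cast hp
  have hl0 : 0 < l := by linarith
  have hpinv0 : (0 : ℝ) ≤ pinv := Nat.cast_nonneg _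
  have hlogT : Real.log T ≤ Real.log (p * T) :=
    Real.log_le_log (by linarith) (by nlinarith)
  have hlam0L : P.lam0 ≤ P.L ^ 2 := by nlinarith
  have hle : 1 ≤ P.L ^ 2 / P.lam0 := by rwa [one_le_div hlam0]
  -- for `pinv = 0` the left-hand side is `0`
  have hdimlog : pinv * Real.log (P.L ^ 2 / (pinv * P.lam0)) ≤ P.L ^ 2 / P.lam0 := by
    rcases hpinv0.eq_or_lt with h0 | h0
    · rw [← h0]
      simp only [zero_mul]
      positivity
    · calc pinv * Real.log (P.L ^ 2 / (pinv * P.lam0)) ≤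
            pinv * (P.L ^ 2 / (pinv * P.lam0)) := by
            gcongr
            exact Real.log_le_self (by positivity)
        _ = _ := by field_simp
  rw [rhoInv, hη, one_div_one_div, Real.sqrt_sq (by positivity), add_mul]
  refine add_le_add ?_ ?_
  · have h : 2 * P.σ * P.L * Real.sqrt (l / P.lam0) =
        P.σ * (P.L * (2 * Real.sqrt (l / P.lam0))) := by ring
    rw [h]
    gcongr
    refine Real.sqrt_le_iff.2 ⟨by positivity, ?_⟩
    rw [mul_pow, mul_pow, Real.sq_sqrt (div_nonneg hl0.le hlam0.le)]
    have h1 : 2 * Real.log T ≤ l * (P.L ^ 2 / P.lam0) := by nlinarith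
    have h2 : P.L ^ 2 / P.lam0 ≤ l * (P.L ^ 2 / P.lam0) := by nlinarith
    have h3 : P.L ^ 2 * (2 ^ 2 * (l / P.lam0)) = 4 * (l * (P.L ^ 2 / P.lam0)) := by ring
    rw [h3]
    linarith
  · gcongr
    rw [div_mul_eq_mul_div]
    gcongr
    refine le_trans ?_ hl
    gcongr
    rw [div_div_eq_mul_div, div_one]
    gcongr

theorem log_potential_le {t T q L lam l : ℝ} (hlam : 0 < lam) (hq : 1 ≤ q) (hT : 1 ≤ T)
    (ht : 0 ≤ t) (htT : t ≤ T) (hl1 : 1 ≤ l) (hl : Real.log T ≤ l) :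
    Real.log (1 + t * L ^ 2 / (lam * q)) ≤ (1 + L ^ 2 / lam) * l := by
  have h1 : 1 + t * L ^ 2 / (lam * q) ≤ T * (1 + L ^ 2 / lam) := by
    have h2 : t * L ^ 2 / (lam * q) ≤ T * L ^ 2 / (lam * 1) := by gcongr
    rw [mul_add, mul_one, ← mul_div_assoc]
    rw [mul_one] at h2
    linarith
  have h3 : Real.log (1 + L ^ 2 / lam) ≤ L ^ 2 / lam := by
    have := Real.log_le_sub_one_of_pos (show 0 < 1 + L ^ 2 / lam by positivity)
    linarith
  calc _ ≤ Real.log (T * (1 + L ^ 2 / lam)) := Real.log_le_log (by positivity) h1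
    _ = Real.log T + Real.log (1 + L ^ 2 / lam) :=
        Real.log_mul (by positivity) (by positivity)
    _ ≤ l + L ^ 2 / lam * l := by
        refine add_le_add (by linarith) (h3.trans ?_)
        exact le_mul_of_one_le_right (by positivity) hl1
    _ = _ := by ring

theorem sqrt_rhoRes_le {P : Params} {p pinv pres T₀ T : ℕ} (hη : P.η = 1 / T) (hT : 2 ≤ T)
    (hp : 1 ≤ p) (hpres : 1 ≤ pres) (hσ : 0 < P.σ) (hL : 0 < P.L) (hM : 0 < P.M)
    (hlam : 0 < P.lam)
    {l : ℝ} (hl1 : 1 ≤ l) (hl : 2 * Real.log (p * T) ≤ l) {n : ℕ} (hn : n < T) :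
    Real.sqrt (rhoRes P p pinv pres T₀ (1 + n)) ≤
      (P.σ * Real.sqrt (2 + P.L ^ 2 / P.lam) + Real.sqrt P.lam * P.M) * Real.sqrt (pres * l) +
        4 * P.L ^ 2 / Real.sqrt P.lam * Real.sqrt l *
          (Real.sqrt T * Real.sqrt (rhoInv P pinv / (T₀ * P.lam0))) := by
  have hT' : (2 : ℝ) ≤ T := by exact_mod_cast hT
  have hp1 : (1 : ℝ) ≤ p := by exact_mod_cast hp
  have hpres1 : (1 : ℝ) ≤ pres := by exact_mod_cast hpres
  have hlogT : Real.log T ≤ Real.log (p * T) :=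
    Real.log_le_log (by linarith) (by nlinarith)
  have hlogT0 : 0 ≤ Real.log T := Real.log_nonneg (by linarith)
  have ht0 : (0 : ℝ) ≤ ((1 + n : ℤ) : ℝ) := by positivity
  have htT : ((1 + n : ℤ) : ℝ) ≤ T := by exact_mod_cast (by omega : (1 + n : ℤ) ≤ T)
  have hlogdet0 : 0 ≤ Real.log (1 + ((1 + n : ℤ) : ℝ) * P.L ^ 2 / (P.lam * pres)) := by
    refine Real.log_nonneg ?_
    have : 0 ≤ ((1 + n : ℤ) : ℝ) * P.L ^ 2 / (P.lam * pres) := by positivity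
    linarith
  have hlogdet : Real.log (1 + ((1 + n : ℤ) : ℝ) * P.L ^ 2 / (P.lam * pres)) ≤
      (1 + P.L ^ 2 / P.lam) * l :=
    log_potential_le hlam hpres1 (by linarith) ht0 htT hl1 (by linarith)
  have hlogp : Real.log ((p + 1) / (1 / (T : ℝ))) ≤ l := by
    refine le_trans ?_ hl
    rw [div_div_eq_mul_div, div_one, ← Nat.cast_ofNat, ← Real.log_pow]
    refine Real.log_le_log (by positivity) ?_
    have h2 : (2 : ℝ) ≤ p * T := by nlinarith
    nlinarith
  have hlogp0 : 0 ≤ Real.log ((p + 1) / (1 / (T : ℝ))) := by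
    refine Real.log_nonneg ?_
    rw [div_div_eq_mul_div, div_one]
    nlinarith
  have hsub : ((1 + n : ℤ) : ℝ) - 1 = n := by push_cast; ring
  have hnT : (n : ℝ) ≤ T := by exact_mod_cast hn.le
  rw [rhoRes, hη, hsub, Real.sqrt_sq (by rw [one_div_one_div]; positivity), one_div_one_div,
    add_mul]
  have hpl : 1 ≤ pres * l := by nlinarith
  refine add_le_add (add_le_add ?_ ?_) ?_
  · rw [mul_assoc, ← Real.sqrt_mul (by positivity)]
    gcongr
    calc _ ≤ pres * l + pres * ((1 + P.L ^ 2 / P.lam) * l) := by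
          refine add_le_add ?_ (by gcongr)
          have : 2 * Real.log T ≤ l := by linarith
          nlinarith
      _ = _ := by ring
  · refine le_mul_of_one_le_right (by positivity) ?_
    rw [Real.one_le_sqrt]
    exact hpl
  · have h1 : Real.sqrt (2 * n * Real.log ((p + 1) / (1 / (T : ℝ)))) ≤
        2 * (Real.sqrt l * Real.sqrt T) := by
      refine Real.sqrt_le_iff.2 ⟨by positivity, ?_⟩
      rw [mul_pow, mul_pow, Real.sq_sqrt (by positivity), Real.sq_sqrt (by positivity)]
      calc 2 * n * Real.log ((p + 1) / (1 / (T : ℝ))) ≤ 2 * T * l := by gcongr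
        _ ≤ 2 ^ 2 * (l * T) := by nlinarith
    rw [mul_comm P.lam0]
    calc _ ≤ 1 / Real.sqrt P.lam * (2 * P.L ^ 2 * (2 * (Real.sqrt l * Real.sqrt T))) *
          Real.sqrt (rhoInv P pinv / (T₀ * P.lam0)) := by gcongr
      _ = _ := by ring

/-- The final combination of the bounds, with `x = √l`, `y = √pres` and `z` the size of
`√(T/T₀) / lam0`. -/
theorem combine_bounds {x y z c₁ c₂ c₃ c₄ L : ℝ} (hx : 1 ≤ x) (hy : 1 ≤ y) (hz : 0 ≤ z)
    (hc₁ : 0 ≤ c₁) (hc₂ : 0 ≤ c₂) (hc₃ : 0 ≤ c₃) (hc₄ : 0 ≤ c₄) (hL : 0 ≤ L) :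
    2 * L * (c₁ * x * z) + 2 * (c₃ * (y * x) + c₄ * x * (c₁ * x * z)) * (c₂ * (y * x)) ≤
      x ^ 4 * (2 * c₂ * c₃ * y ^ 2 + (2 * L * c₁ + 2 * c₂ * c₄ * c₁) * (y * z)) := by
  have hx2 : x ≤ x ^ 4 := le_self_pow₀ hx (by norm_num)
  have hx3 : x ^ 2 ≤ x ^ 4 := pow_le_pow_right₀ hx (by norm_num)
  have hx4 : x ^ 3 ≤ x ^ 4 := pow_le_pow_right₀ hx (by norm_num)
  have h1 : 2 * L * (c₁ * x * z) ≤ 2 * L * c₁ * (x ^ 4 * (y * z)) := by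
    calc 2 * L * (c₁ * x * z) = 2 * L * c₁ * (x * (1 * z)) := by ring
      _ ≤ _ := by gcongr
  have h2 : 2 * c₂ * c₃ * (x ^ 2 * y ^ 2) ≤ 2 * c₂ * c₃ * (x ^ 4 * y ^ 2) := by gcongr
  have h3 : 2 * c₂ * c₄ * c₁ * (x ^ 3 * (y * z)) ≤ 2 * c₂ * c₄ * c₁ * (x ^ 4 * (y * z)) := by
    gcongr
  linarith

/-! ### The regret bound -/

set_option maxHeartbeats 1000000 in
/-- The regret bound with explicit constants for all horizons: for small `T` it holds since the
regret of a round is at most `2 L M`, for large `T` by `regret_le_of_radius_le`. -/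
theorem regret_bound (L M σ lam : ℝ) (hL : 0 < L) (hM : 0 < M) (hσ : 0 < σ) (hlam : 0 < lam) :
    ∃ c C : ℝ, 0 ≤ c ∧ 0 ≤ C ∧
      ∀ {Ω 𝒳 : Type*} [MeasurableSpace Ω] [MeasurableSpace 𝒳]
        (μ : Measure Ω) [IsProbabilityMeasure μ] (p K pinv pres : ℕ)
        (B : LinearBandit Ω 𝒳 p K)
        (Uinv : Matrix (Fin p) (Fin pinv) ℝ) (Ures : Matrix (Fin p) (Fin pres) ℝ)
        (T₀ T : ℕ) (lam0 : ℝ) (astar : ℤ → Ω → Fin K),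
        2 ≤ T → 0 < lam0 → IsModel B μ T₀ T L M σ → IsISD B μ T₀ T Uinv Ures →
        MinEigAssumption B μ T₀ lam0 →
        PlaysISDLinUCB B { lam := lam, η := 1 / (T : ℝ), L := L, M := M, σ := σ, lam0 := lam0 }
          T₀ Uinv Ures μ T →
        IsOptimal B T astar →
        regret B μ T astar ≤ (2 * Real.log (p * T)) ^ 2 * (Real.sqrt T *
          (c * pres + C * (Real.sqrt pres * (Real.sqrt (T / T₀) / lam0)))) := by
  set c₁ := 2 * σ * L + 2 * L ^ 2 * M with hc₁
  set c₂ := 1 + L ^ 2 / lam with hc₂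
  set c₃ := σ * Real.sqrt (2 + L ^ 2 / lam) + Real.sqrt lam * M with hc₃
  set c₄ := 4 * L ^ 2 / Real.sqrt lam with hc₄
  -- for `log T ≥ H` the radii exceed the deviation bounds
  set H := σ ^ 2 / (L ^ 2 * M ^ 2) + lam / (8 * L ^ 2) with hH
  have hc₁0 : 0 ≤ c₁ := by positivity
  have hc₂0 : 0 ≤ c₂ := by positivity
  have hc₃0 : 0 ≤ c₃ := by positivity
  have hc₄0 : 0 ≤ c₄ := by positivity
  refine ⟨2 * c₂ * c₃ + 8 * L * M + 2 * L * M * Real.sqrt (Real.exp H),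
    2 * L * c₁ + 2 * c₂ * c₄ * c₁, by positivity, by positivity, ?_⟩
  intro Ω 𝒳 _ _ μ _ p K pinv pres B Uinv Ures T₀ T lam0 astar hT hlam0 hmodel hI hmin hplay hopt
  have hT₀ := hmin.pos_rounds hlam0 (lt_of_le_of_lt (Nat.zero_le _) hI.dim_lt)
  have hT₀' : (0 : ℝ) < T₀ := by exact_mod_cast hT₀
  have hT' : (2 : ℝ) ≤ T := by exact_mod_cast hT
  have hp : 1 ≤ p := by have := hI.dim_lt; omega
  have hpres : 1 ≤ pres := by have := hI.dim_lt; have := hI.dim_add; omega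
  have hp1 : (1 : ℝ) ≤ p := by exact_mod_cast hp
  have hpres1 : (1 : ℝ) ≤ pres := by exact_mod_cast hpres
  have hdim := lam0_mul_dim_le hmodel hmin hT₀
  set l := 2 * Real.log (p * T) with hl
  have hl1 : 1 ≤ l := by
    have h1 : Real.log 2 ≤ Real.log (p * T) := Real.log_le_log (by norm_num) (by nlinarith)
    have := Real.log_two_gt_d9
    linarith
  have hl0 : 0 ≤ l := by linarith
  have hlogT : Real.log T ≤ l := by
    have h1 : Real.log T ≤ Real.log (p * T) := Real.log_le_log (by linarith) (by nlinarith)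
    linarith
  set x := Real.sqrt l with hx
  have hx1 : 1 ≤ x := Real.one_le_sqrt.2 hl1
  have hx4 : x ^ 4 = l ^ 2 := by
    rw [show x ^ 4 = (x ^ 2) ^ 2 by ring, hx, Real.sq_sqrt hl0]
  set y := Real.sqrt pres with hy
  have hy1 : 1 ≤ y := Real.one_le_sqrt.2 hpres1
  have hy2 : y ^ 2 = pres := Real.sq_sqrt (by positivity)
  set z := Real.sqrt (T / T₀) / lam0 with hz
  have hz0 : 0 ≤ z := by positivity
  have hsqT : 1 ≤ Real.sqrt T := Real.one_le_sqrt.2 (by linarith)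
  have hTT : (T : ℝ) = Real.sqrt T * Real.sqrt T := (Real.mul_self_sqrt (by positivity)).symm
  have hl2 : 1 ≤ l ^ 2 := one_le_pow₀ hl1
  by_cases hbig : H ≤ Real.log T
  · set P : Params :=
      { lam := lam, η := 1 / (T : ℝ), L := L, M := M, σ := σ, lam0 := lam0 } with hP
    have hlog₁ : σ ^ 2 ≤ L ^ 2 * M ^ 2 * Real.log T := by
      have h1 : σ ^ 2 / (L ^ 2 * M ^ 2) ≤ Real.log T :=
        le_trans (le_add_of_nonneg_right (by positivity)) hbig
      rwa [div_le_iff₀' (by positivity)] at h1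
    have hlog₂ : lam ≤ 8 * L ^ 2 * Real.log T := by
      have h1 : lam / (8 * L ^ 2) ≤ Real.log T :=
        le_trans (le_add_of_nonneg_left (by positivity)) hbig
      rwa [div_le_iff₀' (by positivity)] at h1
    set s := Real.sqrt (rhoInv P pinv / (T₀ * lam0)) with hs
    have hTs : Real.sqrt T * s ≤ c₁ * x * z := by
      have h1 := sqrt_rhoInv_le (P := P) (p := p) (pinv := pinv) rfl hT hI.dim_lt hσ hL hM hlam0
        hdim hl1 le_rfl
      have h2 : Real.sqrt (l / lam0) / Real.sqrt (T₀ * lam0) = x / (Real.sqrt T₀ * lam0) := by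
        rw [← Real.sqrt_div (by positivity), div_div, hx,
          show lam0 * (T₀ * lam0) = T₀ * lam0 ^ 2 by ring, Real.sqrt_div hl0,
          Real.sqrt_mul hT₀'.le, Real.sqrt_sq hlam0.le]
      calc Real.sqrt T * s = Real.sqrt T * (Real.sqrt (rhoInv P pinv) /
            Real.sqrt (T₀ * lam0)) := by rw [hs, Real.sqrt_div (rhoInv_nonneg _ _)]
        _ ≤ Real.sqrt T * (c₁ * Real.sqrt (l / lam0) / Real.sqrt (T₀ * lam0)) := by
            gcongr
        _ = c₁ * x * z := by
            rw [mul_div_assoc, h2, hz, Real.sqrt_div (by positivity)]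
            ring
    have hpl : Real.sqrt (pres * l) = y * x := Real.sqrt_mul (by positivity) _
    have hR : ∀ n < T, Real.sqrt (rhoRes P p pinv pres T₀ (1 + (n : ℕ))) ≤
        c₃ * (y * x) + c₄ * x * (c₁ * x * z) := fun n hn => by
      have h1 := sqrt_rhoRes_le (P := P) (p := p) (pinv := pinv) (pres := pres) (T₀ := T₀)
        rfl hT hp hpres hσ hL hM hlam hl1 le_rfl hn
      rw [hpl] at h1
      refine h1.trans (add_le_add le_rfl ?_)
      exact mul_le_mul_of_nonneg_left hTs (by positivity)
    have hU : Real.sqrt ((1 + L ^ 2 / lam) *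
        (pres * Real.log (1 + T * L ^ 2 / (lam * pres)))) ≤ c₂ * (y * x) := by
      refine Real.sqrt_le_iff.2 ⟨by positivity, ?_⟩
      have h1 := log_potential_le (t := T) (T := T) (q := pres) (L := L) (lam := lam) (l := l)
        hlam hpres1 (by linarith) (by positivity) le_rfl hl1 hlogT
      have h2 : (c₂ * (y * x)) ^ 2 = c₂ * (pres * (c₂ * l)) := by
        rw [mul_pow, mul_pow, hy2, hx, Real.sq_sqrt hl0]
        ring
      rw [h2]
      gcongr
    have hmain := regret_le_of_radius_le (P := P) rfl hT hσ hL hM hlam hlam0 hmodel hI hmin hplay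
      hopt hlog₁ hlog₂ (R := c₃ * (y * x) + c₄ * x * (c₁ * x * z)) (by positivity) hR
    have hcomb := combine_bounds hx1 hy1 hz0 hc₁0 hc₂0 hc₃0 hc₄0 hL.le
    rw [hx4, hy2] at hcomb
    have h1 : 2 * L * T * s ≤ Real.sqrt T * (2 * L * (c₁ * x * z)) := by
      calc 2 * L * T * s = Real.sqrt T * (2 * L * (Real.sqrt T * s)) := by
            rw [hTT]
            simp only [Real.sqrt_mul_self (Real.sqrt_nonneg _)]
            ring
        _ ≤ _ := by gcongr
    have h2 : 2 * (c₃ * (y * x) + c₄ * x * (c₁ * x * z)) * (Real.sqrt T *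
        Real.sqrt ((1 + L ^ 2 / lam) * (pres * Real.log (1 + T * L ^ 2 / (lam * pres))))) ≤
        Real.sqrt T * (2 * (c₃ * (y * x) + c₄ * x * (c₁ * x * z)) * (c₂ * (y * x))) := by
      calc _ ≤ 2 * (c₃ * (y * x) + c₄ * x * (c₁ * x * z)) *
            (Real.sqrt T * (c₂ * (y * x))) := by gcongr
        _ = _ := by ring
    have h3 : 2 * L * M * (Real.sqrt T + 3) ≤ Real.sqrt T * (l ^ 2 * (8 * L * M * pres)) := by
      have h4 : 1 ≤ l ^ 2 * pres := one_le_mul_of_one_le_of_one_le hl2 hpres1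
      calc 2 * L * M * (Real.sqrt T + 3) ≤ 2 * L * M * (4 * Real.sqrt T) := by
            gcongr
            linarith
        _ = Real.sqrt T * (8 * L * M) * 1 := by ring
        _ ≤ Real.sqrt T * (8 * L * M) * (l ^ 2 * pres) := by gcongr
        _ = _ := by ring
    calc regret B μ T astar ≤ Real.sqrt T * (2 * L * (c₁ * x * z)) +
          Real.sqrt T * (2 * (c₃ * (y * x) + c₄ * x * (c₁ * x * z)) * (c₂ * (y * x))) +
          Real.sqrt T * (l ^ 2 * (8 * L * M * pres)) :=
          hmain.trans (add_le_add (add_le_add h1 h2) h3)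
      _ = Real.sqrt T * ((2 * L * (c₁ * x * z) +
          2 * (c₃ * (y * x) + c₄ * x * (c₁ * x * z)) * (c₂ * (y * x))) +
          l ^ 2 * (8 * L * M * pres)) := by ring
      _ ≤ Real.sqrt T * (l ^ 2 * (2 * c₂ * c₃ * pres +
          (2 * L * c₁ + 2 * c₂ * c₄ * c₁) * (y * z)) + l ^ 2 * (8 * L * M * pres)) := by gcongr
      _ ≤ Real.sqrt T * (l ^ 2 * (2 * c₂ * c₃ * pres +
          (2 * L * c₁ + 2 * c₂ * c₄ * c₁) * (y * z)) + l ^ 2 * (8 * L * M * pres)) +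
          Real.sqrt T * (l ^ 2 * (2 * L * M * Real.sqrt (Real.exp H) * pres)) :=
          le_add_of_nonneg_right (by positivity)
      _ = _ := by ring
  · have hsmall : (T : ℝ) ≤ Real.exp H := by
      rw [← Real.exp_log (show (0 : ℝ) < T by linarith)]
      exact Real.exp_le_exp.2 (not_le.1 hbig).le
    have h4 : 1 ≤ l ^ 2 * pres := one_le_mul_of_one_le_of_one_le hl2 hpres1
    calc regret B μ T astar ≤ T * (2 * L * M) :=
          (integrable_rewardGap hmodel hL hM hopt).2
      _ = Real.sqrt T * Real.sqrt T * (2 * L * M) * 1 := by rw [← hTT, mul_one]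
      _ ≤ Real.sqrt T * Real.sqrt (Real.exp H) * (2 * L * M) * (l ^ 2 * pres) := by gcongr
      _ = l ^ 2 * (Real.sqrt T * (2 * L * M * Real.sqrt (Real.exp H) * pres)) := by ring
      _ ≤ l ^ 2 * (Real.sqrt T * (2 * L * M * Real.sqrt (Real.exp H) * pres)) +
          l ^ 2 * (Real.sqrt T * ((2 * c₂ * c₃ + 8 * L * M) * pres +
            (2 * L * c₁ + 2 * c₂ * c₄ * c₁) * (y * z))) :=
          le_add_of_nonneg_right (by positivity)
      _ = _ := by ring

end ISDBandit

theorem theorem2 (L M σ lam : ℝ) (hL : 0 < L) (hM : 0 < M) (hσ : 0 < σ) (hlam : 0 < lam) :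
    -- `k`, `c` depend on `L, M, σ, lam` only; `C pres` depends in addition on `dim S^res` only
    ∃ (k : ℕ) (c : ℝ) (C : ℕ → ℝ),
      ∀ (Ω : Type*) (𝒳 : Type*) [MeasurableSpace Ω] [MeasurableSpace 𝒳]
        (μ : Measure Ω) [IsProbabilityMeasure μ] (p K pinv pres : ℕ)
        (B : ISDBandit.LinearBandit Ω 𝒳 p K)
        (Uinv : Matrix (Fin p) (Fin pinv) ℝ) (Ures : Matrix (Fin p) (Fin pres) ℝ)
        (T₀ T : ℕ) (lam0 : ℝ) (astar : ℤ → Ω → Fin K),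
        2 ≤ T → 0 < lam0 →
        ISDBandit.IsModel B μ T₀ T L M σ →
        ISDBandit.IsISD B μ T₀ T Uinv Ures →
        ISDBandit.MinEigAssumption B μ T₀ lam0 →
        ISDBandit.PlaysISDLinUCB B
          { lam := lam, η := 1 / (T : ℝ), L := L, M := M, σ := σ, lam0 := lam0 }
          T₀ Uinv Ures μ T →
        ISDBandit.IsOptimal B T astar →
        Integrable (ISDBandit.rewardGap B T astar) μ ∧
        -- the regret bound, up to powers of `log (p T)`
        ISDBandit.regret B μ T astar ≤
          Real.log (p * T) ^ k *
            (Real.sqrt T * (c * pres +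
              C pres * ((Real.sqrt (pinv / lam0) + 1 / lam0) * Real.sqrt (T / T₀)))) ∧
        -- the oracle rate, with a constant free of all dimensions, once `T₀` is large against `T`
        ((Real.sqrt (pinv / lam0) + 1 / lam0) ^ 2 * T ≤ pres * T₀ →
          ISDBandit.regret B μ T astar ≤
            c * Real.log (p * T) ^ k * (pres * Real.sqrt T))
    := by
  obtain ⟨c₀, C₀, hc₀, hC, hbound⟩ := ISDBandit.regret_bound L M σ lam hL hM hσ hlam
  refine ⟨2, 4 * (c₀ + C₀), fun q => 4 * (C₀ * Real.sqrt q), ?_⟩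
  intro Ω 𝒳 _ _ μ _ p K pinv pres B Uinv Ures T₀ T lam0 astar hT hlam0 hmodel hI hmin hplay hopt
  have h := hbound μ p K pinv pres B Uinv Ures T₀ T lam0 astar hT hlam0 hmodel hI hmin hplay hopt
  have hT₀ := hmin.pos_rounds hlam0 (lt_of_le_of_lt (Nat.zero_le _) hI.dim_lt)
  have hT₀' : (0 : ℝ) < T₀ := by exact_mod_cast hT₀
  set Δ := Real.sqrt (pinv / lam0) + 1 / lam0 with hΔ
  have hΔ0 : 0 ≤ Δ := by positivity
  have hle : Real.sqrt (T / T₀) / lam0 ≤ Δ * Real.sqrt (T / T₀) := by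
    rw [div_eq_mul_one_div, mul_comm]
    gcongr
    exact le_add_of_nonneg_left (Real.sqrt_nonneg _)
  have h' : ISDBandit.regret B μ T astar ≤ (2 * Real.log (p * T)) ^ 2 * (Real.sqrt T *
      (c₀ * pres + C₀ * (Real.sqrt pres * (Δ * Real.sqrt (T / T₀))))) :=
    h.trans (by gcongr)
  refine ⟨(ISDBandit.integrable_rewardGap hmodel hL hM hopt).1, h'.trans ?_, fun hlarge =>
    h'.trans ?_⟩
  · have h1 : 0 ≤ C₀ * (pres : ℝ) := by positivity
    calc _ = Real.log (p * T) ^ 2 * (Real.sqrt T * (4 * c₀ * pres +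
          4 * (C₀ * Real.sqrt pres) * (Δ * Real.sqrt (T / T₀)))) := by ring
      _ ≤ _ := by
          gcongr
          linarith
  · have h1 : Δ * Real.sqrt (T / T₀) ≤ Real.sqrt pres := by
      refine Real.le_sqrt_of_sq_le ?_
      rw [mul_pow, Real.sq_sqrt (by positivity), ← mul_div_assoc, div_le_iff₀ hT₀']
      exact hlarge
    calc _ ≤ (2 * Real.log (p * T)) ^ 2 * (Real.sqrt T *
          (c₀ * pres + C₀ * (Real.sqrt pres * Real.sqrt pres))) := by gcongr
      _ = _ := by
          rw [Real.mul_self_sqrt (Nat.cast_nonneg _)]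
          ring
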